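/- Let $B$ be a smooth projective variety over $\mathbb C$ (the statement holds for every scheme $B$), let $L_1,\dots,L_n,M_1,\dots,M_n$ be line bundles on $B$, and put $E=\bigoplus_{j=1}^n L_j$, $F=\bigoplus_{i=1}^n M_i$. Let $0\le r<n$ (the statement holds for every integer $r\ge 0$). Consider the total spaces over $B$ $$V=\mathrm{tot}\bigl(\mathcal Hom(F,\mathcal O_B^{r})\oplus\mathcal Hom(\mathcal O_B^{r},E)\bigr),\qquad H=\mathrm{tot}\,\mathcal Hom(F,E),$$ $$\tilde V=\mathrm{tot}\bigl(\mathcal Hom(F,\mathcal O_B^{r})\oplus\mathcal Hom(\mathcal O_B^{r},\mathcal O_B^{r})\oplus\mathcal Hom(\mathcal O_B^{r},E)\bigr),$$ with the right actions of $\mathrm{GL}_r$ on $V$ by $(M,N)\cdot g=(g^{-1}M,Ng)$ and of $\tilde G=\mathrm{GL}_r\times\mathrm{GL}_r$ on $\tilde V$ by $(M,D,N)\cdot(g_1,g_2)=(g_1^{-1}M,\,g_2^{-1}Dg_1,\,Ng_2)$. For a character $\theta$ of a group $G$ acting from the right on an affine $B$-scheme $Y\to B$, the semistable locus $Y^{ss}_\theta\subseteq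 Y$ is the union of the loci $\{f\ne0\}$, where $f$ is a function on the preimage of an affine open subset of $B$ with $f(y\cdot g)=\theta(g)^k f(y)$ for some $k>0$, and the GIT quotient $Y/\!\!/_\theta G$ is the good quotient of $Y^{ss}_\theta$ by $G$ (which, when it exists, is unique up to a unique isomorphism). Set $$X_+=V/\!\!/_{\det}\mathrm{GL}_r,\qquad X_-=V/\!\!/_{\det^{-1}}\mathrm{GL}_r,\qquad \tilde X=\tilde V/\!\!/_{\tilde\theta}\tilde G,\quad \tilde\theta(g_1,g_2)=\det(g_1)^{-1}\det(g_2).$$ Then these three GIT quotients exist. The map $V\to H$, $(M,N)\mapsto NM$, induces unique morphisms $h_\pm:X_\pm\to H$. The maps $\tilde V\to V$, $(M,D,N)\mapsto(DM,N)$ and $(M,D,N)\mapsto(M,ND)$, send $\tilde V^{ss}_{\tilde\theta}$ into $V^{ss}_{\det}$ and $V^{ss}_{\det^{-1}}$ respectively, and induce unique morphisms $f_+:\tilde X\to X_+$ and $f_-:\tilde X\to X_-$. Finally, the square formed by $f_+$, $f_-$, $h_+$, $h_-$ is cartesian: $h_+\circ f_+=h_-\circ f_-$, and $(f_+,f_-)$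 is an isomorphism $$\tilde X\;\cong\;X_+\times_H X_-.$$ -/

import Mathlib

open CategoryTheory Opposite AlgebraicGeometry TopologicalSpace

noncomputable section
namespace GrassmannFlop

/-! ### Line bundles, frames and transition functions -/

section LineBundles

variable {B : Scheme.{0}}

/-- The structure sheaf as a module over itself. -/
abbrev structureModule (X : Scheme.{0}) : X.Modules := SheafOfModules.unit X.ringCatSheaf

/-- A line bundle on `B`: a sheaf of `𝒪_B`-modules that is locally isomorphic to `𝒪_B`. -/
def IsLineBundle (L : B.Modules) : Prop :=
  ∀ x : B, ∃ U : B.Opens, x ∈ U ∧ Nonempty (L.restrict U.ι ≅ structureModule U.toScheme)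

/-- The section `s` of `L` over `U` is a frame: multiplication by `s` is an isomorphism from
`𝒪_U` to `L|_U`. -/
def IsFrame (L : B.Modules) {U : B.Opens} (s : Γ(L, U)) : Prop :=
  ∀ (W : B.Opens) (h : W ≤ U),
    Function.Bijective fun a : Γ(B, W) => a • L.presheaf.map (homOfLE h).op s

theorem map_map_section (L : B.Modules) {U W W' : B.Opens} (h : W ≤ U) (h' : W' ≤ W)
    (s : Γ(L, U)) : L.presheaf.map (homOfLE h').op (L.presheaf.map (homOfLE h).op s) =
      L.presheaf.map (homOfLE (h'.trans h)).op s := by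
  rw [← homOfLE_comp h' h, op_comp, Functor.map_comp]; rfl

theorem map_map_fun {X : Scheme.{0}} {U W W' : X.Opens} (h : W ≤ U) (h' : W' ≤ W)
    (s : Γ(X, U)) : X.presheaf.map (homOfLE h').op (X.presheaf.map (homOfLE h).op s) =
      X.presheaf.map (homOfLE (h'.trans h)).op s := by
  rw [← homOfLE_comp h' h, op_comp, Functor.map_comp]; rfl

theorem IsFrame.restrict {L : B.Modules} {U W : B.Opens} {s : Γ(L, U)} (hs : IsFrame L s)
    (h : W ≤ U) : IsFrame L (L.presheaf.map (homOfLE h).op s) := by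
  intro W' h'
  simp_rw [map_map_section]
  exact hs W' (h'.trans h)

theorem exists_frame_of_iso {L : B.Modules} {U : B.Opens}
    (e : L.restrict U.ι ≅ structureModule U.toScheme) :
    ∃ s : Γ(L, U.ι ''ᵁ ⊤), IsFrame L s := by
  let u : U.toScheme.Modules := structureModule U.toScheme
  let φ : u ⟶ L.restrict U.ι := e.inv
  have : IsIso φ := inferInstanceAs (IsIso e.inv)
  let one : ∀ W' : U.toScheme.Opens, Γ(u, W') := fun W' => (1 : Γ(U.toScheme, W'))
  let s0 : Γ(L, U.ι ''ᵁ ⊤) := (φ.app ⊤).hom (one ⊤)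
  refine ⟨s0, ?_⟩
  intro W hW
  obtain ⟨W', rfl⟩ : ∃ W' : U.toScheme.Opens, U.ι ''ᵁ W' = W :=
    ⟨U.ι ⁻¹ᵁ W, by
      rw [Scheme.Hom.image_preimage_eq_opensRange_inf]; simpa using hW⟩
  have hn : L.presheaf.map (homOfLE hW).op s0 = (φ.app W').hom (one W') := by
    have h1 := ConcreteCategory.congr_hom (φ.mapPresheaf.naturality (homOfLE le_top : W' ⟶ ⊤).op)
      (one ⊤)
    have h2 : (u.presheaf.map (homOfLE le_top : W' ⟶ ⊤).op) (one ⊤) = one W' :=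
      map_one (U.toScheme.presheaf.map (homOfLE le_top : W' ⟶ ⊤).op).hom
    refine Eq.trans ?_ (h1.symm.trans ?_)
    · rfl
    · exact congrArg (φ.app W').hom h2
  have key : ∀ a : Γ(B, U.ι ''ᵁ W'),
      a • L.presheaf.map (homOfLE hW).op s0 =
        (φ.app W').hom ((U.ι.appIso W').hom a : Γ(U.toScheme, W')) := by
    intro a
    rw [hn]
    have h1 := φ.app_smul ((U.ι.appIso W').hom a) (one W')
    have h2 : ((U.ι.appIso W').hom a) • (one W') =
      (show Γ(u, W') from ((U.ι.appIso W').hom a : Γ(U.toScheme, W'))) :=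
        mul_one ((U.ι.appIso W').hom a : Γ(U.toScheme, W'))
    rw [h2] at h1
    refine Eq.trans ?_ h1.symm
    have h3 : a = (U.ι.appIso W').inv ((U.ι.appIso W').hom a) :=
      (ConcreteCategory.congr_hom (U.ι.appIso W').hom_inv_id a).symm
    conv_lhs => rw [h3]
    rfl
  simp_rw [key]
  have b1 : Function.Bijective (φ.app W').hom :=
    ConcreteCategory.bijective_of_isIso (φ.app W')
  have b2 : Function.Bijective (U.ι.appIso W').hom :=
    ConcreteCategory.bijective_of_isIso (U.ι.appIso W').hom
  exact b1.comp b2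

theorem IsLineBundle.exists_frame {L : B.Modules} (hL : IsLineBundle L) (x : B) :
    ∃ (U : B.Opens) (_ : x ∈ U) (s : Γ(L, U)), IsFrame L s := by
  obtain ⟨U, hxU, ⟨e⟩⟩ := hL x
  obtain ⟨s, hs⟩ := exists_frame_of_iso e
  exact ⟨_, by simpa using hxU, s, hs⟩

/-- An open subset of `B` together with a frame over it of every member of the family `𝓛`. -/
structure Frame {κ : Type} (𝓛 : κ → B.Modules) where
  U : B.Opens
  s : ∀ k, Γ(𝓛 k, U)
  isFrame : ∀ k, IsFrame (𝓛 k) (s k)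

theorem iSup_frame {κ : Type} [Finite κ] (𝓛 : κ → B.Modules) (h : ∀ k, IsLineBundle (𝓛 k)) :
    ⨆ i : Frame 𝓛, i.U = ⊤ := by
  cases nonempty_fintype κ
  rw [eq_top_iff]
  intro x _
  choose U hU s hs using fun k => (h k).exists_frame x
  have hle : ∀ k, Finset.univ.inf U ≤ U k := fun k => Finset.inf_le (Finset.mem_univ k)
  refine Opens.mem_iSup.mpr ⟨⟨Finset.univ.inf U, fun k => (𝓛 k).presheaf.map (homOfLE (hle k)).op (s k),
    fun k => (hs k).restrict (hle k)⟩, ?_⟩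
  have : ∀ t : Finset κ, x ∈ t.inf U := by
    classical
    intro t
    induction t using Finset.induction_on with
    | empty => trivial
    | insert a t _ ih => rw [Finset.inf_insert]; exact ⟨hU a, ih⟩
  exact this _

/-- A Čech cocycle with values in `𝒪_Bˣ` for the family of opens `U`, i.e. the transition
functions `s j = g i j • s i` of local frames `s i` over `U i`. -/
@[ext]
structure LineCocycle {ι : Type} (U : ι → B.Opens) where
  g : ∀ i j, Γ(B, U i ⊓ U j)ˣ
  cocycle : ∀ i j k (W : B.Opens) (hi : W ≤ U i) (hj : W ≤ U j) (hk : W ≤ U k),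
    B.presheaf.map (homOfLE (le_inf hi hk)).op (g i k : Γ(B, U i ⊓ U k)) =
      B.presheaf.map (homOfLE (le_inf hi hj)).op (g i j : Γ(B, U i ⊓ U j)) *
        B.presheaf.map (homOfLE (le_inf hj hk)).op (g j k : Γ(B, U j ⊓ U k))

namespace LineCocycle

variable {ι : Type} {U : ι → B.Opens}

/-- The tensor product of line bundles. -/
instance : Mul (LineCocycle U) where
  mul K K' :=
    { g := fun i j => K.g i j * K'.g i j
      cocycle := fun i j k W hi hj hk => by
        simp only [Units.val_mul, map_mul, K.cocycle i j k W hi hj hk, K'.cocycle i j k W hi hj hk]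
        ring }

/-- The trivial line bundle. -/
instance : One (LineCocycle U) where
  one :=
    { g := fun _ _ => 1
      cocycle := fun i j k W hi hj hk => by simp }

/-- The dual of a line bundle. -/
instance : Inv (LineCocycle U) where
  inv K :=
    { g := fun i j => (K.g i j)⁻¹
      cocycle := fun i j k W hi hj hk => by
        have h := K.cocycle i j k W hi hj hk
        have e : Units.map (B.presheaf.map (homOfLE (le_inf hi hk)).op).hom.toMonoidHom (K.g i k) =
            Units.map (B.presheaf.map (homOfLE (le_inf hi hj)).op).hom.toMonoidHom (K.g i j) *
            Units.map (B.presheaf.map (homOfLE (le_inf hj hk)).op).hom.toMonoidHom (K.g j k) :=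
          Units.ext h
        have e' := congrArg (fun u => ((u⁻¹ : _ˣ) : Γ(B, W))) e
        simp only [mul_inv, ← map_inv] at e'
        exact e' }

theorem mul_g (K K' : LineCocycle U) (i j : ι) : (K * K').g i j = K.g i j * K'.g i j := rfl
theorem one_g (i j : ι) : (1 : LineCocycle U).g i j = 1 := rfl
theorem inv_g (K : LineCocycle U) (i j : ι) : K⁻¹.g i j = (K.g i j)⁻¹ := rfl

instance : CommGroup (LineCocycle U) where
  mul_assoc a b c := by ext i j; simp [mul_g, mul_assoc]
  one_mul a := by ext i j; simp [mul_g, one_g]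
  mul_one a := by ext i j; simp [mul_g, one_g]
  mul_comm a b := by ext i j; simp [mul_g, mul_comm]
  inv_mul_cancel a := by ext i j; simp [mul_g, one_g, inv_g]

end LineCocycle

/-- The coefficient `c` with `t = c • s` for a frame `s`. -/
def IsFrame.coeff {L : B.Modules} {U : B.Opens} {s : Γ(L, U)} (hs : IsFrame L s) {W : B.Opens}
    (h : W ≤ U) (t : Γ(L, W)) : Γ(B, W) :=
  ((hs W h).2 t).choose

theorem IsFrame.coeff_smul {L : B.Modules} {U : B.Opens} {s : Γ(L, U)} (hs : IsFrame L s)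
    {W : B.Opens} (h : W ≤ U) (t : Γ(L, W)) :
    hs.coeff h t • L.presheaf.map (homOfLE h).op s = t :=
  ((hs W h).2 t).choose_spec

theorem IsFrame.eq_coeff {L : B.Modules} {U : B.Opens} {s : Γ(L, U)} (hs : IsFrame L s)
    {W : B.Opens} (h : W ≤ U) {c c' : Γ(B, W)}
    (e : c • L.presheaf.map (homOfLE h).op s = c' • L.presheaf.map (homOfLE h).op s) : c = c' :=
  (hs W h).1 e

variable {κ : Type} (𝓛 : κ → B.Modules)

/-- The coefficient `g i j` in `s j = g i j • s i` on `U i ⊓ U j`. -/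
def transitionCoeff (k : κ) (i j : Frame 𝓛) : Γ(B, i.U ⊓ j.U) :=
  (i.isFrame k).coeff inf_le_left ((𝓛 k).presheaf.map (homOfLE inf_le_right).op (j.s k))

theorem transitionCoeff_smul (k : κ) (i j : Frame 𝓛) (W : B.Opens) (hi : W ≤ i.U) (hj : W ≤ j.U) :
    B.presheaf.map (homOfLE (le_inf hi hj)).op (transitionCoeff 𝓛 k i j) •
      (𝓛 k).presheaf.map (homOfLE hi).op (i.s k) = (𝓛 k).presheaf.map (homOfLE hj).op (j.s k) := by
  have h := congrArg ((𝓛 k).presheaf.map (homOfLE (le_inf hi hj)).op)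
    ((i.isFrame k).coeff_smul inf_le_left
      ((𝓛 k).presheaf.map (homOfLE (inf_le_right : i.U ⊓ j.U ≤ j.U)).op (j.s k)))
  rw [Scheme.Modules.map_smul, map_map_section, map_map_section] at h
  exact h

theorem transitionCoeff_cocycle (k : κ) (i j l : Frame 𝓛) (W : B.Opens) (hi : W ≤ i.U)
    (hj : W ≤ j.U) (hl : W ≤ l.U) :
    B.presheaf.map (homOfLE (le_inf hi hl)).op (transitionCoeff 𝓛 k i l) =
      B.presheaf.map (homOfLE (le_inf hi hj)).op (transitionCoeff 𝓛 k i j) *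
        B.presheaf.map (homOfLE (le_inf hj hl)).op (transitionCoeff 𝓛 k j l) := by
  apply (i.isFrame k).eq_coeff hi
  rw [transitionCoeff_smul 𝓛 k i l W hi hl, mul_comm, mul_smul,
    transitionCoeff_smul 𝓛 k i j W hi hj, transitionCoeff_smul 𝓛 k j l W hj hl]

theorem transitionCoeff_self (k : κ) (i : Frame 𝓛) (W : B.Opens) (hi : W ≤ i.U) :
    B.presheaf.map (homOfLE (le_inf hi hi)).op (transitionCoeff 𝓛 k i i) = 1 := by
  apply (i.isFrame k).eq_coeff hi
  rw [transitionCoeff_smul, one_smul]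

theorem transitionCoeff_mul (k : κ) (i j : Frame 𝓛) :
    transitionCoeff 𝓛 k i j *
      B.presheaf.map (homOfLE (le_inf inf_le_right inf_le_left)).op (transitionCoeff 𝓛 k j i) = 1 := by
  have h := transitionCoeff_cocycle 𝓛 k i j i (i.U ⊓ j.U) inf_le_left inf_le_right inf_le_left
  rw [transitionCoeff_self 𝓛 k i _ inf_le_left] at h
  rw [h]
  congr 1
  exact (ConcreteCategory.congr_hom (B.presheaf.map_id _) _).symm

/-- The cocycle of the line bundle `𝓛 k` with respect to all frames. -/
def frameCocycle (k : κ) : LineCocycle (fun i : Frame 𝓛 => i.U) where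
  g i j := Units.mkOfMulEqOne _ _ (transitionCoeff_mul 𝓛 k i j)
  cocycle i j l W hi hj hl := transitionCoeff_cocycle 𝓛 k i j l W hi hj hl

end LineBundles

/-! ### Total spaces of direct sums of line bundles -/

section TotalSpace

variable {B : Scheme.{0}} {ι : Type} {U : ι → B.Opens}

theorem appLE_appLE_apply {X Y Z : Scheme.{0}} (f : X ⟶ Y) (g : Y ⟶ Z) (U : Z.Opens) (V : Y.Opens)
    (W : X.Opens) (e₁ : V ≤ g ⁻¹ᵁ U) (e₂ : W ≤ f ⁻¹ᵁ V) (e₃ : W ≤ (f ≫ g) ⁻¹ᵁ U) (s : Γ(Z, U)) :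
    f.appLE V W e₂ (g.appLE U V e₁ s) = (f ≫ g).appLE U W e₃ s := by
  rw [← Scheme.Hom.appLE_comp_appLE f g U V W e₁ e₂]; rfl

theorem appLE_map_apply {X Y : Scheme.{0}} (f : X ⟶ Y) (U : Y.Opens) (V V' : X.Opens)
    (e : V ≤ f ⁻¹ᵁ U) (h : V' ≤ V) (s : Γ(Y, U)) :
    X.presheaf.map (homOfLE h).op (f.appLE U V e s) = f.appLE U V' (h.trans e) s := by
  rw [← Scheme.Hom.appLE_map f e (homOfLE h).op]; rfl

theorem map_appLE_apply {X Y : Scheme.{0}} (f : X ⟶ Y) (U U' : Y.Opens) (V : X.Opens)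
    (h : U ≤ U') (e : V ≤ f ⁻¹ᵁ U) (s : Γ(Y, U')) :
    f.appLE U V e (Y.presheaf.map (homOfLE h).op s) =
      f.appLE U' V (e.trans (f.preimage_mono h)) s := by
  rw [← Scheme.Hom.map_appLE f e (homOfLE h).op]; rfl

theorem LineCocycle.appLE_cocycle (K : LineCocycle U) {T : Scheme.{0}} (q : T ⟶ B) (i j l : ι)
    (W : T.Opens) (hij : W ≤ q ⁻¹ᵁ (U i ⊓ U j)) (hjl : W ≤ q ⁻¹ᵁ (U j ⊓ U l))
    (hil : W ≤ q ⁻¹ᵁ (U i ⊓ U l)) :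
    q.appLE (U i ⊓ U l) W hil (K.g i l) =
      q.appLE (U i ⊓ U j) W hij (K.g i j) * q.appLE (U j ⊓ U l) W hjl (K.g j l) := by
  have h3 : W ≤ q ⁻¹ᵁ (U i ⊓ U j ⊓ U l) := fun _ ht => ⟨hij ht, (hjl ht).2⟩
  have h := congrArg (q.appLE (U i ⊓ U j ⊓ U l) W h3)
    (K.cocycle i j l (U i ⊓ U j ⊓ U l) (inf_le_left.trans inf_le_left)
      (inf_le_left.trans inf_le_right) inf_le_right)
  rw [map_mul, map_appLE_apply, map_appLE_apply, map_appLE_apply] at h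
  exact h

/-- The sections over `T` of the pullback along `q : T ⟶ B` of the line bundle with cocycle `K`:
families of functions `x i`, the coordinate with respect to the `i`-th local frame `s i`, such that
`x i • s i = x j • s j`, where `s j = g i j • s i`. -/
def Sec (K : LineCocycle U) {T : Scheme.{0}} (q : T ⟶ B) :
    AddSubgroup (∀ i, Γ(T, q ⁻¹ᵁ U i)) where
  carrier := {x | ∀ (i j : ι) (W : T.Opens) (hi : W ≤ q ⁻¹ᵁ U i) (hj : W ≤ q ⁻¹ᵁ U j),
    T.presheaf.map (homOfLE hi).op (x i) =
      q.appLE (U i ⊓ U j) W (le_inf hi hj) (K.g i j) * T.presheaf.map (homOfLE hj).op (x j)}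
  zero_mem' := by intro i j W hi hj; simp
  add_mem' := by
    intro x y hx hy i j W hi hj
    simp only [Pi.add_apply, map_add, hx i j W hi hj, hy i j W hi hj]; ring
  neg_mem' := by
    intro x hx i j W hi hj
    simp only [Pi.neg_apply, map_neg, hx i j W hi hj]; ring

namespace Sec

variable {K K' K'' : LineCocycle U} {T T' : Scheme.{0}} {q : T ⟶ B}

/-- Multiplication of a section by a global function. -/
def smul (c : Γ(T, ⊤)) (x : Sec K q) : Sec K q :=
  ⟨fun i => T.presheaf.map (homOfLE le_top).op c * x.1 i, by
    intro i j W hi hj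
    simp only [map_mul, x.2 i j W hi hj, map_map_fun]; ring⟩

/-- The product of sections of two line bundles, a section of the tensor product. -/
def mul (h : K * K' = K'') (x : Sec K q) (y : Sec K' q) : Sec K'' q :=
  ⟨fun i => x.1 i * y.1 i, by
    subst h
    intro i j W hi hj
    simp only [map_mul, x.2 i j W hi hj, y.2 i j W hi hj, LineCocycle.mul_g, Units.val_mul]; ring⟩

theorem appLE_fun (x : Sec K q) (u : T' ⟶ T) (i j : ι) (W : T'.Opens)
    (hi : W ≤ u ⁻¹ᵁ (q ⁻¹ᵁ U i)) (hj : W ≤ u ⁻¹ᵁ (q ⁻¹ᵁ U j))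
    (hij : W ≤ (u ≫ q) ⁻¹ᵁ (U i ⊓ U j)) :
    u.appLE (q ⁻¹ᵁ U i) W hi (x.1 i) =
      (u ≫ q).appLE (U i ⊓ U j) W hij (K.g i j) * u.appLE (q ⁻¹ᵁ U j) W hj (x.1 j) := by
  have h := congrArg (u.appLE (q ⁻¹ᵁ (U i ⊓ U j)) W hij)
    (x.2 i j (q ⁻¹ᵁ (U i ⊓ U j)) (fun _ ht => ht.1) (fun _ ht => ht.2))
  rw [map_mul] at h
  refine Eq.trans ?_ (h.trans (congrArg₂ _ ?_ ?_))
  · exact (map_appLE_apply _ _ _ _ _ _ _).symm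
  · exact appLE_appLE_apply _ _ _ _ _ _ _ hij _
  · exact map_appLE_apply _ _ _ _ _ _ _

/-- The pullback of a section along `u : T' ⟶ T`. -/
def pull (u : T' ⟶ T) (x : Sec K q) : Sec K (u ≫ q) :=
  ⟨fun i => u.appLE (q ⁻¹ᵁ U i) ((u ≫ q) ⁻¹ᵁ U i) le_rfl (x.1 i), by
    intro i j W hi hj
    refine (appLE_map_apply _ _ _ _ _ _ _).trans
      ((appLE_fun x u i j W hi hj (le_inf hi hj)).trans (congrArg₂ _ rfl ?_))
    exact (appLE_map_apply _ _ _ _ _ _ _).symm⟩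

theorem map_pull (u : T' ⟶ T) (x : Sec K q) (i : ι) (W : T'.Opens) (h : W ≤ (u ≫ q) ⁻¹ᵁ U i) :
    T'.presheaf.map (homOfLE h).op ((pull u x).1 i) = u.appLE (q ⁻¹ᵁ U i) W h (x.1 i) :=
  appLE_map_apply _ _ _ _ _ _ _

theorem appLE_pull {T'' : Scheme.{0}} (w : T'' ⟶ T') (u : T' ⟶ T) (x : Sec K q) (i : ι)
    (W : T''.Opens) (h : W ≤ w ⁻¹ᵁ ((u ≫ q) ⁻¹ᵁ U i)) :
    w.appLE ((u ≫ q) ⁻¹ᵁ U i) W h ((pull u x).1 i) = (w ≫ u).appLE (q ⁻¹ᵁ U i) W h (x.1 i) :=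
  appLE_appLE_apply _ _ _ _ _ _ _ _ _

end Sec

/-- The `T`-points of the total space of the direct sum of the line bundles with cocycles `K a`:
a morphism `q : T ⟶ B` and a section over `T` of the pullback along `q` of each of them. -/
abbrev Point {A : Type} (K : A → LineCocycle U) (T : Scheme.{0}) : Type :=
  Σ q : T ⟶ B, ∀ a, Sec (K a) q

namespace Point

variable {A : Type} {K : A → LineCocycle U} {T T' T'' : Scheme.{0}}

/-- The pullback of a point along `u : T' ⟶ T`. -/
def pull (u : T' ⟶ T) (x : Point K T) : Point K T' :=
  ⟨u ≫ x.1, fun a => Sec.pull u (x.2 a)⟩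

theorem ext' {x y : Point K T} (h : x.1 = y.1)
    (h' : ∀ a i (W : T.Opens) (hx : W ≤ x.1 ⁻¹ᵁ U i) (hy : W ≤ y.1 ⁻¹ᵁ U i),
      T.presheaf.map (homOfLE hx).op ((x.2 a).1 i) =
        T.presheaf.map (homOfLE hy).op ((y.2 a).1 i)) : x = y := by
  obtain ⟨q, x⟩ := x
  obtain ⟨q', y⟩ := y
  obtain rfl : q = q' := h
  congr 1
  funext a
  apply Subtype.ext
  funext i
  have := h' a i (q ⁻¹ᵁ U i) le_rfl le_rfl
  simpa using this

theorem pull_pull (u : T' ⟶ T) (w : T'' ⟶ T') (x : Point K T) :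
    (x.pull u).pull w = x.pull (w ≫ u) := by
  refine ext' (Category.assoc _ _ _).symm ?_
  intro a i W hx hy
  exact (Sec.map_pull _ _ _ _ _).trans ((Sec.appLE_pull _ _ _ _ _ _).trans
    (Sec.map_pull _ _ _ _ _).symm)

theorem pull_id (x : Point K T) : x.pull (𝟙 T) = x := by
  refine ext' (Category.id_comp _) ?_
  intro a i W hx hy
  refine (Sec.map_pull _ _ _ _ _).trans ?_
  simp only [Scheme.Hom.appLE, Scheme.Hom.id_app]
  exact ConcreteCategory.congr_hom (Category.id_comp (T.presheaf.map (homOfLE hx).op)) _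

end Point

/-- The `B`-scheme `p : V ⟶ B`, with the tautological section `x a` of the pullback of each of the
line bundles `K a`, is the total space of the direct sum of the line bundles `K a`: it represents
the functor of `T`-points. -/
def IsTotalSpace {A : Type} (K : A → LineCocycle U) (V : Scheme.{0}) (x : Point K V) : Prop :=
  ∀ T : Scheme.{0}, Function.Bijective fun v : T ⟶ V => x.pull v

namespace LocalModel

variable {A : Type} (K : A → LineCocycle U)

/-- An open subset of one of the members of the family `U`. -/
structure Ix (U : ι → B.Opens) where
  i : ι
  W : B.Opens
  le : W ≤ U i

instance : Preorder (Ix U) := Preorder.lift Ix.W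

theorem appLE_congr_apply {X Y : Scheme.{0}} {f f' : X ⟶ Y} (h : f = f') (U : Y.Opens)
    (V : X.Opens) (e : V ≤ f ⁻¹ᵁ U) (e' : V ≤ f' ⁻¹ᵁ U) (s : Γ(Y, U)) :
    f.appLE U V e s = f'.appLE U V e' s := by
  subst h; rfl

theorem point_eq {T : Scheme.{0}} {x y : Point K T} (h : x = y) (a : A) (i : ι) (W : T.Opens)
    (hx : W ≤ x.1 ⁻¹ᵁ U i) (hy : W ≤ y.1 ⁻¹ᵁ U i) :
      T.presheaf.map (homOfLE hx).op ((x.2 a).1 i) =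
        T.presheaf.map (homOfLE hy).op ((y.2 a).1 i) := by
  subst h; rfl

variable (A) in
/-- The local model of the total space: the affine space over the open subset `k`. -/
abbrev space (k : Ix U) : Scheme.{0} := 𝔸(A; k.W.toScheme)

variable (A) in
/-- The projection of the local model to `B`. -/
abbrev proj (k : Ix U) : space A k ⟶ B := 𝔸(A; k.W.toScheme) ↘ k.W.toScheme ≫ k.W.ι

theorem le_proj (k : Ix U) {T : Scheme.{0}} (v : T ⟶ space A k) (O : T.Opens) :
    O ≤ (v ≫ proj A k) ⁻¹ᵁ k.W := by
  intro t _
  simp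

theorem le_proj' (k : Ix U) (O : (space A k).Opens) : O ≤ proj A k ⁻¹ᵁ k.W := by
  intro t _
  simp

theorem le_proj_inf (k : Ix U) {i : ι} {O : (space A k).Opens} (h : O ≤ proj A k ⁻¹ᵁ U i) :
    O ≤ proj A k ⁻¹ᵁ (U i ⊓ U k.i) :=
  fun _ ht => ⟨h ht, k.le (le_proj' k _ ht)⟩

/-- The tautological point of the local model: its coordinate `a` is the coordinate of the
tautological section of the line bundle `K a` with respect to the local frame over `U k.i`. -/
def taut (k : Ix U) : Point K (space A k) :=
  ⟨proj A k, fun a => ⟨fun i => (proj A k).appLE (U i ⊓ U k.i) (proj A k ⁻¹ᵁ U i)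
      (le_proj_inf k le_rfl) ((K a).g i k.i) *
        (space A k).presheaf.map (homOfLE le_top).op (AffineSpace.coord _ a), by
    intro i j W hi hj
    have hij : W ≤ proj A k ⁻¹ᵁ (U i ⊓ U j) := le_inf hi hj
    have h := (K a).appLE_cocycle (proj A k) i j k.i W hij (le_proj_inf k hj) (le_proj_inf k hi)
    refine (map_mul _ _ _).trans ?_
    refine (congrArg₂ _ ((appLE_map_apply _ _ _ _ _ _ _).trans h) (map_map_fun _ _ _)).trans ?_
    refine (mul_assoc _ _ _).trans (congrArg₂ _ rfl ?_)
    refine Eq.trans ?_ (map_mul _ _ _).symm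
    exact congrArg₂ _ (appLE_map_apply _ _ _ _ _ _ _).symm (map_map_fun _ _ _).symm⟩⟩

theorem appLE_taut (k : Ix U) {T : Scheme.{0}} (v : T ⟶ space A k) (a : A) (i : ι) (W : T.Opens)
    (h : W ≤ v ⁻¹ᵁ (proj A k ⁻¹ᵁ U i)) (h' : W ≤ (v ≫ proj A k) ⁻¹ᵁ (U i ⊓ U k.i)) :
    v.appLE (proj A k ⁻¹ᵁ U i) W h (((taut K k).2 a).1 i) =
      (v ≫ proj A k).appLE (U i ⊓ U k.i) W h' ((K a).g i k.i) *
        T.presheaf.map (homOfLE le_top).op (v.appTop (AffineSpace.coord _ a)) := by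
  refine (map_mul _ _ _).trans (congrArg₂ _ (appLE_appLE_apply _ _ _ _ _ _ _ _ _) ?_)
  refine (map_appLE_apply _ _ _ _ _ _ _).trans ?_
  rfl

theorem g_self (L : LineCocycle U) (i : ι) : L.g i i = 1 := by
  have h := L.cocycle i i i (U i ⊓ U i) inf_le_left inf_le_left inf_le_left
  have e : ∀ s : Γ(B, U i ⊓ U i), B.presheaf.map (homOfLE (le_inf inf_le_left inf_le_left :
      U i ⊓ U i ≤ U i ⊓ U i)).op s = s := fun s =>
    ConcreteCategory.congr_hom (B.presheaf.map_id _) s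
  rw [e] at h
  apply Units.ext
  exact (L.g i i).isUnit.mul_left_cancel (h.symm.trans (mul_one _).symm)

theorem taut_injective (k : Ix U) {T : Scheme.{0}} {v w : T ⟶ space A k}
    (h : (taut K k).pull v = (taut K k).pull w) : v = w := by
  have h1 : v ≫ proj A k = w ≫ proj A k := congrArg Sigma.fst h
  apply AffineSpace.hom_ext
  · rw [← cancel_mono k.W.ι]
    simpa using h1
  · intro a
    have hv : ⊤ ≤ (v ≫ proj A k) ⁻¹ᵁ U k.i := fun t ht => k.le (le_proj k v ⊤ ht)
    have hw : ⊤ ≤ (w ≫ proj A k) ⁻¹ᵁ U k.i := fun t ht => k.le (le_proj k w ⊤ ht)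
    have h2 := point_eq K h a k.i ⊤ hv hw
    have key : ∀ (v : T ⟶ space A k) (hv : ⊤ ≤ (v ≫ proj A k) ⁻¹ᵁ U k.i),
        T.presheaf.map (homOfLE hv).op ((((taut K k).pull v).2 a).1 k.i) =
          v.appTop (AffineSpace.coord _ a) := by
      intro v hv
      refine (Sec.map_pull _ _ _ _ _).trans
        ((appLE_taut K k v a k.i ⊤ hv (fun _ ht => ⟨hv ht, hv ht⟩)).trans ?_)
      rw [g_self]
      refine (congrArg₂ _ (map_one _) ?_).trans (one_mul _)
      exact ConcreteCategory.congr_hom (T.presheaf.map_id _) _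
    exact (key v hv).symm.trans (h2.trans (key w hw))

theorem taut_surjective (k : Ix U) {T : Scheme.{0}} (x : Point K T) (h : ⊤ ≤ x.1 ⁻¹ᵁ k.W) :
    ∃ v : T ⟶ space A k, (taut K k).pull v = x := by
  have hk : ⊤ ≤ x.1 ⁻¹ᵁ U k.i := fun t ht => k.le (h ht)
  have hr : Set.range x.1 ⊆ Set.range k.W.ι := by
    rintro _ ⟨t, rfl⟩
    simpa using h (Opens.mem_top t)
  let b : T ⟶ k.W.toScheme := IsOpenImmersion.lift k.W.ι x.1 hr
  have hb : b ≫ k.W.ι = x.1 := IsOpenImmersion.lift_fac _ _ _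
  let v : T ⟶ space A k :=
    AffineSpace.homOfVector b fun a => T.presheaf.map (homOfLE hk).op ((x.2 a).1 k.i)
  have hv : v ≫ proj A k = x.1 := by simp [v, hb]
  refine ⟨v, Point.ext' hv ?_⟩
  intro a i W hx hy
  have hx' : W ≤ (v ≫ proj A k) ⁻¹ᵁ U i := hx
  have hi : W ≤ (v ≫ proj A k) ⁻¹ᵁ (U i ⊓ U k.i) := fun t ht =>
    ⟨hx' ht, k.le (le_proj k v _ ht)⟩
  refine (Sec.map_pull _ _ _ _ _).trans ((appLE_taut K k v a i W hx' hi).trans ?_)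
  have hc : v.appTop (AffineSpace.coord _ a) = T.presheaf.map (homOfLE hk).op ((x.2 a).1 k.i) := by
    simp only [v, AffineSpace.homOfVector_appTop_coord]
  rw [hc, map_map_fun]
  refine Eq.trans (congrArg₂ _ ?_ rfl) ((x.2 a).2 i k.i W hy (le_top.trans hk)).symm
  exact appLE_congr_apply hv _ _ _ _ _

/-- The transition map between the local models. -/
def trans {k l : Ix U} (h : k ≤ l) : space A k ⟶ space A l :=
  (taut_surjective K l (taut K k) (fun _ ht => h (le_proj' k _ ht))).choose

theorem trans_spec {k l : Ix U} (h : k ≤ l) : (taut K l).pull (trans K h) = taut K k :=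
  (taut_surjective K l (taut K k) (fun _ ht => h (le_proj' k _ ht))).choose_spec

theorem trans_proj {k l : Ix U} (h : k ≤ l) : trans K h ≫ proj A l = proj A k :=
  congrArg Sigma.fst (trans_spec K h)

theorem taut_pull_comp_trans {k l : Ix U} (h : k ≤ l) {T : Scheme.{0}} (v : T ⟶ space A k) :
    (taut K l).pull (v ≫ trans K h) = (taut K k).pull v := by
  rw [← Point.pull_pull, trans_spec]

theorem trans_id (k : Ix U) (h : k ≤ k) : trans K h = 𝟙 _ :=
  taut_injective K k (by rw [trans_spec, Point.pull_id])

theorem trans_comp {k l m : Ix U} (h : k ≤ l) (h' : l ≤ m) (h'' : k ≤ m) :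
    trans K h'' = trans K h ≫ trans K h' :=
  taut_injective K m (by rw [trans_spec, taut_pull_comp_trans, trans_spec])

theorem trans_isPullback {k l : Ix U} (h : k ≤ l) :
    IsPullback (trans K h) (𝔸(A; k.W.toScheme) ↘ k.W.toScheme)
      (𝔸(A; l.W.toScheme) ↘ l.W.toScheme) (B.homOfLE h) := by
  have hw : trans K h ≫ (𝔸(A; l.W.toScheme) ↘ l.W.toScheme) =
      (𝔸(A; k.W.toScheme) ↘ k.W.toScheme) ≫ B.homOfLE h := by
    rw [← cancel_mono l.W.ι]
    simpa using trans_proj K h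
  have ex : ∀ (S : Scheme.{0}) (a : S ⟶ space A l) (b : S ⟶ k.W.toScheme),
      a ≫ (𝔸(A; l.W.toScheme) ↘ l.W.toScheme) = b ≫ B.homOfLE h →
      ∃ m : S ⟶ space A k, m ≫ trans K h = a ∧ m ≫ (𝔸(A; k.W.toScheme) ↘ k.W.toScheme) = b := by
    intro S a b hab
    have hs : a ≫ proj A l = b ≫ k.W.ι := by
      rw [← Category.assoc, hab, Category.assoc, B.homOfLE_ι]
    have hk : ⊤ ≤ (a ≫ proj A l) ⁻¹ᵁ k.W := by
      rw [hs]; intro t _; simp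
    obtain ⟨m, hm⟩ := taut_surjective K k ((taut K l).pull a) hk
    have h1 : m ≫ trans K h = a := taut_injective K l (by rw [taut_pull_comp_trans, hm])
    refine ⟨m, h1, ?_⟩
    rw [← cancel_mono (B.homOfLE h), Category.assoc, ← hw, ← Category.assoc, h1, hab]
  have mono : ∀ (S : Scheme.{0}) (m m' : S ⟶ space A k), m ≫ trans K h = m' ≫ trans K h →
      m = m' := by
    intro S m m' e
    apply taut_injective K k
    rw [← taut_pull_comp_trans K h, ← taut_pull_comp_trans K h, e]
  exact ⟨⟨hw⟩, ⟨Limits.PullbackCone.IsLimit.mk _ (fun s => (ex _ _ _ s.condition).choose)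
    (fun s => (ex _ _ _ s.condition).choose_spec.1)
    (fun s => (ex _ _ _ s.condition).choose_spec.2)
    (fun s m h1 _ => mono _ _ _ (h1.trans (ex _ _ _ s.condition).choose_spec.1.symm))⟩⟩

/-- The open cover of `B` by all open subsets of the members of `U`. -/
def cover (hU : ⨆ i, U i = ⊤) : B.OpenCover where
  I₀ := Ix U
  X k := k.W.toScheme
  f k := k.W.ι
  mem₀ := by
    rw [Scheme.presieve₀_mem_precoverage_iff]
    refine ⟨fun x => ?_, inferInstance⟩
    obtain ⟨i, hi⟩ := Opens.mem_iSup.mp (hU ▸ Opens.mem_top x : x ∈ ⨆ i, U i)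
    exact ⟨⟨i, U i, le_rfl⟩, by simpa using hi⟩

instance (hU : ⨆ i, U i = ⊤) : Preorder (cover hU).I₀ := inferInstanceAs <| Preorder (Ix U)

instance (hU : ⨆ i, U i = ⊤) : (cover hU).LocallyDirected :=
  .ofIsBasisOpensRange (by intro i j; simp [cover]; rfl) <| by
    rw [Opens.isBasis_iff_nbhd]
    intro O x hx
    obtain ⟨i, hi⟩ := Opens.mem_iSup.mp (hU ▸ Opens.mem_top x : x ∈ ⨆ i, U i)
    exact ⟨_, ⟨⟨i, U i ⊓ O, inf_le_left⟩, rfl⟩, by simpa [cover] using ⟨hi, hx⟩,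
      by simp [cover]⟩

/-- The gluing data for the local models along the transition maps. -/
def gluing (hU : ⨆ i, U i = ⊤) : (cover hU).RelativeGluingData where
  functor :=
    { obj := fun k => space A k
      map := fun f => trans K (leOfHom f)
      map_id := fun k => trans_id K k _
      map_comp := fun f g => trans_comp K (leOfHom f) (leOfHom g) _ }
  natTrans :=
    { app := fun k => (𝔸(A; k.W.toScheme) ↘ k.W.toScheme)
      naturality := fun _ _ f => (trans_isPullback K (leOfHom f)).w }
  equifibered := fun _ _ f => trans_isPullback K (leOfHom f)


section Glue

variable (hU : ⨆ i, U i = ⊤)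

/-- The inclusion of a local model. -/
def incl (k : Ix U) : space A k ⟶ (gluing K hU).glued :=
  Limits.colimit.ι (gluing K hU).functor k

theorem trans_incl {k l : Ix U} (h : k ≤ l) : trans K h ≫ incl K hU l = incl K hU k :=
  Limits.colimit.w (gluing K hU).functor (homOfLE (X := (cover hU).I₀) h)

instance (k : Ix U) : IsOpenImmersion (incl K hU k) :=
  (gluing K hU).cover.map_prop k

theorem incl_toBase (k : Ix U) : incl K hU k ≫ (gluing K hU).toBase = proj A k :=
  (gluing K hU).ι_toBase k

theorem opensRange_incl (k : Ix U) :
    (incl K hU k).opensRange = (gluing K hU).toBase ⁻¹ᵁ k.W := by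
  have h := (gluing K hU).toBase_preimage_eq_opensRange_ι k
  refine h.symm.trans ?_
  congr 1
  exact Scheme.Opens.opensRange_ι k.W

theorem isOpenImmersion_trans {k l : Ix U} (h : k ≤ l) : IsOpenImmersion (trans K h) :=
  MorphismProperty.of_isPullback (trans_isPullback K h).flip inferInstance

theorem appLE_bijective {X Y : Scheme.{0}} (f : X ⟶ Y) [IsOpenImmersion f] (O : Y.Opens)
    (O' : X.Opens) (h : O' = f ⁻¹ᵁ O) (hO : O ≤ f.opensRange) :
    Function.Bijective (f.appLE O O' h.le) := by
  subst h
  have := f.isIso_app O hO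
  rw [f.appLE_eq_app]
  exact ConcreteCategory.bijective_of_isIso (f.app O)

theorem proj_preimage (k : Ix U) (O : B.Opens) :
    proj A k ⁻¹ᵁ O = incl K hU k ⁻¹ᵁ ((gluing K hU).toBase ⁻¹ᵁ O) := by
  rw [← incl_toBase K hU k]; rfl

/-- The coordinates on the glued scheme. -/
def gluedCoord (a : A) (i : ι) : Γ((gluing K hU).glued, (gluing K hU).toBase ⁻¹ᵁ U i) :=
  ((appLE_bijective (incl K hU ⟨i, U i, le_rfl⟩) ((gluing K hU).toBase ⁻¹ᵁ U i)
    (proj A ⟨i, U i, le_rfl⟩ ⁻¹ᵁ U i) (proj_preimage K hU _ _)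
    (opensRange_incl K hU ⟨i, U i, le_rfl⟩).ge).2
    (((taut K ⟨i, U i, le_rfl⟩).2 a).1 i)).choose

theorem gluedCoord_spec (a : A) (i : ι) :
    (incl K hU ⟨i, U i, le_rfl⟩).appLE _ (proj A ⟨i, U i, le_rfl⟩ ⁻¹ᵁ U i)
      (proj_preimage K hU _ _).le (gluedCoord K hU a i) = ((taut K ⟨i, U i, le_rfl⟩).2 a).1 i :=
  ((appLE_bijective (incl K hU ⟨i, U i, le_rfl⟩) ((gluing K hU).toBase ⁻¹ᵁ U i)
    (proj A ⟨i, U i, le_rfl⟩ ⁻¹ᵁ U i) (proj_preimage K hU _ _)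
    (opensRange_incl K hU ⟨i, U i, le_rfl⟩).ge).2
    (((taut K ⟨i, U i, le_rfl⟩).2 a).1 i)).choose_spec

theorem trans_appLE_taut {k l : Ix U} (h : k ≤ l) (a : A) (i : ι) (W : (space A k).Opens)
    (hW : W ≤ trans K h ⁻¹ᵁ (proj A l ⁻¹ᵁ U i)) (hW' : W ≤ proj A k ⁻¹ᵁ U i) :
    (trans K h).appLE (proj A l ⁻¹ᵁ U i) W hW (((taut K l).2 a).1 i) =
      (space A k).presheaf.map (homOfLE hW').op (((taut K k).2 a).1 i) := by
  have := point_eq K (trans_spec K h) a i W hW hW'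
  exact (Sec.map_pull _ _ _ _ _).symm.trans this

theorem incl_appLE_gluedCoord (k : Ix U) (a : A) (i : ι) :
    (incl K hU k).appLE ((gluing K hU).toBase ⁻¹ᵁ U i) (proj A k ⁻¹ᵁ U i)
      (proj_preimage K hU _ _).le (gluedCoord K hU a i) = ((taut K k).2 a).1 i := by
  let n : Ix U := ⟨i, U i, le_rfl⟩
  let m : Ix U := ⟨i, k.W ⊓ U i, inf_le_right⟩
  have hmk : m ≤ k := (inf_le_left : k.W ⊓ U i ≤ k.W)
  have hmn : m ≤ n := (inf_le_right : k.W ⊓ U i ≤ U i)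
  have := isOpenImmersion_trans K hmk
  have hpre : ⊤ = trans K hmk ⁻¹ᵁ (proj A k ⁻¹ᵁ U i) := by
    have : trans K hmk ⁻¹ᵁ (proj A k ⁻¹ᵁ U i) = (trans K hmk ≫ proj A k) ⁻¹ᵁ U i := rfl
    rw [this, trans_proj]
    exact (top_le_iff.mp (fun t ht => (le_proj' m ⊤ ht).2)).symm
  have htop : ⊤ ≤ proj A m ⁻¹ᵁ U i := fun t ht => (le_proj' m ⊤ ht).2
  have hrange : proj A k ⁻¹ᵁ U i ≤ (trans K hmk).opensRange := by
    intro t ht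
    have h1 : incl K hU k t ∈ (incl K hU m).opensRange := by
      rw [opensRange_incl]
      have h2 : (gluing K hU).toBase (incl K hU k t) = proj A k t := by
        rw [← Scheme.Hom.comp_apply, incl_toBase]
      change (gluing K hU).toBase (incl K hU k t) ∈ m.W
      rw [h2]
      exact ⟨le_proj' k ⊤ (Opens.mem_top t), ht⟩
    obtain ⟨z, hz⟩ := h1
    refine ⟨z, (incl K hU k).isOpenEmbedding.injective ?_⟩
    rw [← Scheme.Hom.comp_apply, trans_incl]
    exact hz
  apply (appLE_bijective (trans K hmk) (proj A k ⁻¹ᵁ U i) ⊤ hpre hrange).1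
  have e1 : ⊤ ≤ (incl K hU m) ⁻¹ᵁ ((gluing K hU).toBase ⁻¹ᵁ U i) := by
    rw [← proj_preimage]; exact htop
  have hn : ⊤ ≤ trans K hmn ⁻¹ᵁ (proj A n ⁻¹ᵁ U i) := by
    have : trans K hmn ⁻¹ᵁ (proj A n ⁻¹ᵁ U i) = (trans K hmn ≫ proj A n) ⁻¹ᵁ U i := rfl
    rw [this, trans_proj]; exact htop
  refine (appLE_appLE_apply _ _ _ _ _ _ _ (by rw [trans_incl]; exact e1) _).trans ?_
  refine (appLE_congr_apply (trans_incl K hU hmk) _ _ _ e1 _).trans ?_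
  refine (appLE_congr_apply (trans_incl K hU hmn).symm _ _ _ (by rw [trans_incl]; exact e1) _).trans
    ?_
  refine (appLE_appLE_apply _ _ _ (proj A n ⁻¹ᵁ U i) _ (proj_preimage K hU _ _).le hn _ _).symm.trans
    ?_
  refine (congrArg _ (gluedCoord_spec K hU a i)).trans ?_
  exact (trans_appLE_taut K hmn a i ⊤ hn htop).trans (trans_appLE_taut K hmk a i ⊤ hpre.le htop).symm

theorem incl_appLE_gluedCoord' (k : Ix U) (a : A) (i : ι) (W : (space A k).Opens)
    (h : W ≤ incl K hU k ⁻¹ᵁ ((gluing K hU).toBase ⁻¹ᵁ U i)) (h' : W ≤ proj A k ⁻¹ᵁ U i) :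
    (incl K hU k).appLE ((gluing K hU).toBase ⁻¹ᵁ U i) W h (gluedCoord K hU a i) =
      (space A k).presheaf.map (homOfLE h').op (((taut K k).2 a).1 i) := by
  rw [← incl_appLE_gluedCoord K hU k a i]
  exact (appLE_map_apply _ _ _ _ _ _ _).symm

/-- The tautological point of the glued scheme. -/
def gluedTaut : Point K (gluing K hU).glued :=
  ⟨(gluing K hU).toBase, fun a => ⟨gluedCoord K hU a, by
    intro i j W hi hj
    let k : Ix U := ⟨i, U i ⊓ U j, inf_le_left⟩
    have hW : W ≤ (incl K hU k).opensRange := by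
      rw [opensRange_incl]; exact le_inf hi hj
    have hij : W ≤ (gluing K hU).toBase ⁻¹ᵁ (U i ⊓ U j) := le_inf hi hj
    have hi' : incl K hU k ⁻¹ᵁ W ≤ proj A k ⁻¹ᵁ U i := by
      rw [proj_preimage K hU]; exact fun _ ht => hi ht
    have hj' : incl K hU k ⁻¹ᵁ W ≤ proj A k ⁻¹ᵁ U j := by
      rw [proj_preimage K hU]; exact fun _ ht => hj ht
    have hij' : incl K hU k ⁻¹ᵁ W ≤ proj A k ⁻¹ᵁ (U i ⊓ U j) := by
      rw [proj_preimage K hU]; exact fun _ ht => hij ht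
    apply (appLE_bijective (incl K hU k) W _ rfl hW).1
    refine (map_appLE_apply _ _ _ _ _ _ _).trans ?_
    refine (incl_appLE_gluedCoord' K hU k a i _ _ hi').trans ?_
    refine Eq.trans ?_ (map_mul _ _ _).symm
    refine (((taut K k).2 a).2 i j _ hi' hj').trans (congrArg₂ _ ?_ ?_)
    · refine (appLE_congr_apply (incl_toBase K hU k).symm _ _ _ ?_ _).trans
        (appLE_appLE_apply _ _ _ _ _ _ _ _ _).symm
      rw [incl_toBase]; exact hij'
    · refine Eq.trans ?_ (map_appLE_apply _ _ _ _ _ _ _).symm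
      exact (incl_appLE_gluedCoord' K hU k a j _ _ hj').symm⟩⟩

theorem pull_incl (k : Ix U) : (gluedTaut K hU).pull (incl K hU k) = taut K k := by
  refine Point.ext' (incl_toBase K hU k) ?_
  intro a i W hx hy
  refine (Sec.map_pull _ _ _ _ _).trans ?_
  exact incl_appLE_gluedCoord' K hU k a i W hx hy

theorem glued_injective {T : Scheme.{0}} {v w : T ⟶ (gluing K hU).glued}
    (h : (gluedTaut K hU).pull v = (gluedTaut K hU).pull w) : v = w := by
  have hb : v ≫ (gluing K hU).toBase = w ≫ (gluing K hU).toBase := congrArg Sigma.fst h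
  apply Scheme.hom_ext_of_forall
  intro t
  obtain ⟨i, hi⟩ := Opens.mem_iSup.mp
    (hU ▸ Opens.mem_top _ : (v ≫ (gluing K hU).toBase) t ∈ ⨆ i, U i)
  let k : Ix U := ⟨i, U i, le_rfl⟩
  let O : T.Opens := (v ≫ (gluing K hU).toBase) ⁻¹ᵁ U i
  have fac : ∀ (v : T ⟶ (gluing K hU).glued), O = (v ≫ (gluing K hU).toBase) ⁻¹ᵁ U i →
      ∃ v' : O.toScheme ⟶ space A k, v' ≫ incl K hU k = O.ι ≫ v := by
    intro v hv
    refine ⟨IsOpenImmersion.lift (incl K hU k) (O.ι ≫ v) ?_, IsOpenImmersion.lift_fac _ _ _⟩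
    rintro _ ⟨t, rfl⟩
    change _ ∈ (incl K hU k).opensRange
    rw [opensRange_incl]
    have : O.ι t ∈ O := t.2
    exact hv.le this
  obtain ⟨v', hv'⟩ := fac v rfl
  obtain ⟨w', hw'⟩ := fac w (by rw [← hb])
  refine ⟨O, hi, ?_⟩
  rw [← hv', ← hw']
  congr 1
  apply taut_injective K k
  rw [← pull_incl K hU k, Point.pull_pull, Point.pull_pull, hv', hw', ← Point.pull_pull,
    ← Point.pull_pull, h]

theorem glued_surjective {T : Scheme.{0}} (x : Point K T) :
    ∃ v : T ⟶ (gluing K hU).glued, (gluedTaut K hU).pull v = x := by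
  let O : ι → T.Opens := fun i => x.1 ⁻¹ᵁ U i
  have hO : ∀ t : T, ∃ i, t ∈ O i := fun t => by
    obtain ⟨i, hi⟩ := Opens.mem_iSup.mp (hU ▸ Opens.mem_top _ : x.1 t ∈ ⨆ i, U i)
    exact ⟨i, hi⟩
  let 𝒰 : T.OpenCover :=
    { I₀ := ι
      X := fun i => (O i).toScheme
      f := fun i => (O i).ι
      mem₀ := by
        rw [Scheme.presieve₀_mem_precoverage_iff]
        exact ⟨fun t => ⟨(hO t).choose, by simpa using (hO t).choose_spec⟩, inferInstance⟩ }
  have ex : ∀ i, ∃ v : (O i).toScheme ⟶ (gluing K hU).glued,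
      (gluedTaut K hU).pull v = x.pull (O i).ι := by
    intro i
    obtain ⟨v, hv⟩ := taut_surjective K ⟨i, U i, le_rfl⟩ (x.pull (O i).ι) (by
      intro t _
      have : (O i).ι t ∈ O i := t.2
      exact this)
    exact ⟨v ≫ incl K hU _, by rw [← Point.pull_pull, pull_incl, hv]⟩
  choose v hv using ex
  let V : T ⟶ (gluing K hU).glued := 𝒰.glueMorphisms v (by
    intro i j
    apply glued_injective K hU
    rw [← Point.pull_pull, ← Point.pull_pull, hv, hv, Point.pull_pull, Point.pull_pull]
    congr 1
    exact Limits.pullback.condition (f := 𝒰.f i) (g := 𝒰.f j))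
  have hV : ∀ i, (O i).ι ≫ V = v i := fun i => 𝒰.ι_glueMorphisms _ _ i
  have hx : ∀ i, ((gluedTaut K hU).pull V).pull (O i).ι = x.pull (O i).ι := by
    intro i
    rw [Point.pull_pull, hV, hv]
  refine ⟨V, Point.ext' (𝒰.hom_ext _ _ fun i => congrArg Sigma.fst (hx i)) ?_⟩
  intro a i W hW hW'
  have hWO : W ≤ (O i).ι.opensRange := by simpa using hW'
  apply (appLE_bijective (O i).ι W _ rfl hWO).1
  have h1 : (O i).ι ⁻¹ᵁ W ≤ ((O i).ι ≫ V ≫ (gluing K hU).toBase) ⁻¹ᵁ U i := fun _ ht => hW ht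
  have h2 : (O i).ι ⁻¹ᵁ W ≤ ((O i).ι ≫ x.1) ⁻¹ᵁ U i := fun _ ht => hW' ht
  have := point_eq K (hx i) a i _ h1 h2
  refine (map_appLE_apply _ _ _ _ _ _ _).trans (Eq.trans ?_ (map_appLE_apply _ _ _ _ _ _ _).symm)
  exact (Sec.map_pull _ _ _ _ _).symm.trans (this.trans (Sec.map_pull _ _ _ _ _))

end Glue

end LocalModel

variable {A : Type} (K : A → LineCocycle U) (hU : ⨆ i, U i = ⊤)

/-- The total space of the direct sum of the line bundles with cocycles `K a`, glued from the affine
spaces over the members of the open cover (and their open subsets). -/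
def totalSpace : Scheme.{0} := (LocalModel.gluing K hU).glued

/-- The tautological point of the total space. -/
def tautPoint : Point K (totalSpace K hU) := LocalModel.gluedTaut K hU

theorem isTotalSpace : IsTotalSpace K (totalSpace K hU) (tautPoint K hU) := fun _ =>
  ⟨fun _ _ h => LocalModel.glued_injective K hU h, LocalModel.glued_surjective K hU⟩

/-- The projection of the total space to the base. -/
def toBase : totalSpace K hU ⟶ B := (tautPoint K hU).1

/-- The bijection between morphisms to the total space and points. -/
def homEquiv (T : Scheme.{0}) : (T ⟶ totalSpace K hU) ≃ Point K T :=
  Equiv.ofBijective _ (isTotalSpace K hU T)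

theorem homEquiv_comp {T T' : Scheme.{0}} (u : T' ⟶ T) (v : T ⟶ totalSpace K hU) :
    homEquiv K hU T' (u ≫ v) = (homEquiv K hU T v).pull u :=
  (Point.pull_pull _ _ _).symm

theorem homEquiv_symm_comp {T T' : Scheme.{0}} (u : T' ⟶ T) (x : Point K T) :
    u ≫ (homEquiv K hU T).symm x = (homEquiv K hU T').symm (x.pull u) := by
  apply (homEquiv K hU T').injective
  rw [homEquiv_comp, Equiv.apply_symm_apply, Equiv.apply_symm_apply]

theorem homEquiv_fst {T : Scheme.{0}} (v : T ⟶ totalSpace K hU) :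
    (homEquiv K hU T v).1 = v ≫ toBase K hU := rfl

theorem homEquiv_symm_toBase {T : Scheme.{0}} (x : Point K T) :
    (homEquiv K hU T).symm x ≫ toBase K hU = x.1 := by
  rw [← homEquiv_fst, Equiv.apply_symm_apply]

/-- The morphism of total spaces over `B` with a given effect on the tautological point. -/
def totalSpaceMap {A' : Type} (K' : A' → LineCocycle U)
    (φ : ∀ {T : Scheme.{0}} (q : T ⟶ B), (∀ a, Sec (K a) q) → ∀ a, Sec (K' a) q) :
    totalSpace K hU ⟶ totalSpace K' hU :=
  (homEquiv K' hU _).symm ⟨(tautPoint K hU).1, φ _ (tautPoint K hU).2⟩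

end TotalSpace

/-! ### Group actions and GIT quotients -/

section GIT

/-- A group-valued functor on schemes, for instance the functor of points of a group scheme. -/
abbrev GroupFunctor := Scheme.{0}ᵒᵖ ⥤ GrpCat.{0}

/-- The multiplicative group. -/
def Gm : GroupFunctor where
  obj T := GrpCat.of Γ(T.unop, ⊤)ˣ
  map f := GrpCat.ofHom (Units.map f.unop.appTop.hom.toMonoidHom)

/-- The general linear group. -/
def GLr (r : ℕ) : GroupFunctor where
  obj T := GrpCat.of (GL (Fin r) Γ(T.unop, ⊤))
  map f := GrpCat.ofHom (Matrix.GeneralLinearGroup.map f.unop.appTop.hom)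

/-- The group `GL_r × GL_r`. -/
def GLrGLr (r : ℕ) : GroupFunctor where
  obj T := GrpCat.of (GL (Fin r) Γ(T.unop, ⊤) × GL (Fin r) Γ(T.unop, ⊤))
  map f := GrpCat.ofHom ((Matrix.GeneralLinearGroup.map f.unop.appTop.hom).prodMap
    (Matrix.GeneralLinearGroup.map f.unop.appTop.hom))

/-- The character `det` of `GL_r`. -/
def detChar (r : ℕ) : GLr r ⟶ Gm where
  app _ := GrpCat.ofHom Matrix.GeneralLinearGroup.det
  naturality _ _ f := by
    apply GrpCat.hom_ext
    apply MonoidHom.ext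
    intro g
    exact Matrix.GeneralLinearGroup.map_det (n := Fin r) f.unop.appTop.hom g

/-- The character `det⁻¹` of `GL_r`. -/
def detInvChar (r : ℕ) : GLr r ⟶ Gm where
  app _ := GrpCat.ofHom Matrix.GeneralLinearGroup.det⁻¹
  naturality _ _ f := by
    apply GrpCat.hom_ext
    apply MonoidHom.ext
    intro g
    refine (congrArg (fun u => u⁻¹)
      (Matrix.GeneralLinearGroup.map_det (n := Fin r) f.unop.appTop.hom g)).trans ?_
    exact (map_inv (Units.map f.unop.appTop.hom.toMonoidHom) _).symm

/-- The character `(g₁, g₂) ↦ det(g₁)⁻¹ det(g₂)` of `GL_r × GL_r`. -/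
def detInvDetChar (r : ℕ) : GLrGLr r ⟶ Gm where
  app _ := GrpCat.ofHom ((Matrix.GeneralLinearGroup.det.comp (MonoidHom.fst _ _))⁻¹ *
    Matrix.GeneralLinearGroup.det.comp (MonoidHom.snd _ _))
  naturality _ _ f := by
    apply GrpCat.hom_ext
    apply MonoidHom.ext
    intro g
    refine (congrArg₂ (fun u v => u⁻¹ * v)
      (Matrix.GeneralLinearGroup.map_det (n := Fin r) f.unop.appTop.hom g.1)
      (Matrix.GeneralLinearGroup.map_det (n := Fin r) f.unop.appTop.hom g.2)).trans ?_
    refine Eq.trans ?_ (map_mul (Units.map f.unop.appTop.hom.toMonoidHom) _ _).symm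
    exact congrArg₂ _ (map_inv (Units.map f.unop.appTop.hom.toMonoidHom) _).symm rfl

/-- The value of a character, as a function on `T`. -/
def charValue {𝒢 : GroupFunctor} (θ : 𝒢 ⟶ Gm) {T : Scheme.{0}} (g : 𝒢.obj (op T)) : Γ(T, ⊤) :=
  Units.val (show Γ(T, ⊤)ˣ from (θ.app (op T)).hom g)

/-- A right action of `𝒢` on the `B`-scheme `p : V ⟶ B`, given on `T`-points, naturally in `T`. -/
structure RightAction (𝒢 : GroupFunctor) {V B : Scheme.{0}} (p : V ⟶ B) where
  act : ∀ {T : Scheme.{0}}, (T ⟶ V) → 𝒢.obj (op T) → (T ⟶ V)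
  act_toBase : ∀ {T : Scheme.{0}} (v : T ⟶ V) (g : 𝒢.obj (op T)), act v g ≫ p = v ≫ p
  act_one : ∀ {T : Scheme.{0}} (v : T ⟶ V), act v 1 = v
  act_mul : ∀ {T : Scheme.{0}} (v : T ⟶ V) (g h : 𝒢.obj (op T)),
    act v (g * h) = act (act v g) h
  comp_act : ∀ {T T' : Scheme.{0}} (u : T' ⟶ T) (v : T ⟶ V) (g : 𝒢.obj (op T)),
    u ≫ act v g = act (u ≫ v) (𝒢.map u.op g)

variable {𝒢 : GroupFunctor} {V B : Scheme.{0}} {p : V ⟶ B} (ρ : RightAction 𝒢 p)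

namespace RightAction

/-- The function `f` on the open subset `O` of `V` is semi-invariant of weight `θ ^ k`:
`f (v · g) = θ (g) ^ k * f (v)`. -/
def IsSemiInvariant (θ : 𝒢 ⟶ Gm) (k : ℕ) {O : V.Opens} (f : Γ(V, O)) : Prop :=
  ∀ (T : Scheme.{0}) (v : T ⟶ V) (g : 𝒢.obj (op T)) (hv : ⊤ ≤ v ⁻¹ᵁ O)
    (hvg : ⊤ ≤ ρ.act v g ⁻¹ᵁ O),
    (ρ.act v g).appLE O ⊤ hvg f =
      charValue θ g ^ k * v.appLE O ⊤ hv f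

/-- The semistable locus of `V` with respect to the character `θ`, relative to `B` (for `p`
affine): the union of the non-vanishing loci of the semi-invariant functions of weight `θ ^ k`,
`k > 0`, on the preimages of the affine open subsets of `B`. -/
def semistableLocus (θ : 𝒢 ⟶ Gm) : V.Opens :=
  sSup {O | ∃ (W : B.Opens) (_ : IsAffineOpen W) (k : ℕ) (_ : 0 < k) (f : Γ(V, p ⁻¹ᵁ W)),
    ρ.IsSemiInvariant θ k f ∧ O = V.basicOpen f}

/-- Two `T`-points of the open subset `O` of `V` are in the same orbit. -/
def SameOrbit {O : V.Opens} {T : Scheme.{0}} (v w : T ⟶ O.toScheme) : Prop :=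
  ∃ g : 𝒢.obj (op T), ρ.act (v ≫ O.ι) g = w ≫ O.ι

/-- Invariance of a function on an open subset of `O`. -/
def IsInvariantFunction {O : V.Opens} {O' : O.toScheme.Opens} (f : Γ(O.toScheme, O')) : Prop :=
  ∀ (T : Scheme.{0}) (v w : T ⟶ O.toScheme) (hv : ⊤ ≤ v ⁻¹ᵁ O') (hw : ⊤ ≤ w ⁻¹ᵁ O'),
    ρ.SameOrbit v w → w.appLE O' ⊤ hw f = v.appLE O' ⊤ hv f

/-- Invariance of a subset of `O`. -/
def IsInvariantSet {O : V.Opens} (Z : Set O.toScheme) : Prop :=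
  ∀ (T : Scheme.{0}) (v w : T ⟶ O.toScheme), ρ.SameOrbit v w → ∀ t : T, v t ∈ Z ↔ w t ∈ Z

/-- `π : O ⟶ X` is a good quotient of the open subset `O` of `V` by `𝒢` (in the sense of Seshadri):
it is invariant, affine and surjective, the functions on `X` are the invariant functions on `O`, and
images of closed invariant subsets are closed and compatible with intersections. -/
structure IsGoodQuotient {O : V.Opens} {X : Scheme.{0}} (π : O.toScheme ⟶ X) : Prop where
  invariant : ∀ (T : Scheme.{0}) (v w : T ⟶ O.toScheme), ρ.SameOrbit v w → v ≫ π = w ≫ π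
  affine : IsAffineHom π
  surjective : Surjective π
  functions : ∀ (W : X.Opens) (f : Γ(O.toScheme, π ⁻¹ᵁ W)), ρ.IsInvariantFunction f →
    ∃! h : Γ(X, W), π.app W h = f
  isClosed_image : ∀ Z : Set O.toScheme, IsClosed Z → ρ.IsInvariantSet Z → IsClosed (π '' Z)
  image_iInter : ∀ (J : Type) (Z : J → Set O.toScheme), (∀ j, IsClosed (Z j)) →
    (∀ j, ρ.IsInvariantSet (Z j)) → π '' (⋂ j, Z j) = ⋂ j, π '' (Z j)

end RightAction

/-- A GIT quotient `V ⫽_θ 𝒢` (relative to `B`): a good quotient of the semistable locus. It is unique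
up to a unique isomorphism; here it is a scheme `X` with its quotient morphism `π`. -/
structure GITQuotient (θ : 𝒢 ⟶ Gm) where
  X : Scheme.{0}
  π : (ρ.semistableLocus θ).toScheme ⟶ X
  isGoodQuotient : ρ.IsGoodQuotient π

namespace GITQuotient

variable {ρ} {θ : 𝒢 ⟶ Gm}

/-- The morphism `f : Q.X ⟶ Y` is induced by `φ : V ⟶ Y`. -/
def IsInducedTo (Q : GITQuotient ρ θ) {Y : Scheme.{0}} (φ : V ⟶ Y) (f : Q.X ⟶ Y) : Prop :=
  Q.π ≫ f = (ρ.semistableLocus θ).ι ≫ φ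

/-- The morphism `f : Q.X ⟶ Q'.X` is induced by `φ : V ⟶ V'`: the morphism `φ` maps the semistable
locus to the semistable locus, and `f` is the morphism between the quotients given by it. -/
def IsInduced {𝒢' : GroupFunctor} {V' B' : Scheme.{0}} {p' : V' ⟶ B'} {ρ' : RightAction 𝒢' p'}
    {θ' : 𝒢' ⟶ Gm} (Q : GITQuotient ρ θ) (Q' : GITQuotient ρ' θ') (φ : V ⟶ V')
    (f : Q.X ⟶ Q'.X) : Prop :=
  ∃ s : (ρ.semistableLocus θ).toScheme ⟶ (ρ'.semistableLocus θ').toScheme,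
    s ≫ (ρ'.semistableLocus θ').ι = (ρ.semistableLocus θ).ι ≫ φ ∧ Q.π ≫ f = s ≫ Q'.π

end GITQuotient

end GIT

/-! ### Matrices of sections and the Grassmann flop -/

section Matrices

variable {B : Scheme.{0}} {ι : Type} {U : ι → B.Opens}

namespace Sec

variable {K K' K'' : LineCocycle U} {T T' : Scheme.{0}} {q : T ⟶ B}

theorem sec_ext {x y : Sec K q} (h : ∀ i, x.1 i = y.1 i) : x = y := Subtype.ext (funext h)

theorem val_sum {J : Type} (s : Finset J) (x : J → Sec K q) (i : ι) :
    (∑ j ∈ s, x j).1 i = ∑ j ∈ s, (x j).1 i := by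
  rw [AddSubgroup.val_finsetSum, Finset.sum_apply]

theorem smul_val (c : Γ(T, ⊤)) (x : Sec K q) (i : ι) :
    (smul c x).1 i = T.presheaf.map (homOfLE le_top).op c * x.1 i := rfl

theorem mul_val (h : K * K' = K'') (x : Sec K q) (y : Sec K' q) (i : ι) :
    (mul h x y).1 i = x.1 i * y.1 i := rfl

variable {r : ℕ}

/-- The product of a matrix of functions and a column of sections. -/
def mulVec (P : Matrix (Fin r) (Fin r) Γ(T, ⊤)) (x : Fin r → Sec K q) : Fin r → Sec K q :=
  fun a => ∑ b, smul (P a b) (x b)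

/-- The product of a row of sections and a matrix of functions. -/
def vecMul (x : Fin r → Sec K q) (P : Matrix (Fin r) (Fin r) Γ(T, ⊤)) : Fin r → Sec K q :=
  fun a => ∑ b, smul (P b a) (x b)

/-- The product of a row of sections and a column of sections. -/
def dot (h : K * K' = K'') (x : Fin r → Sec K q) (y : Fin r → Sec K' q) : Sec K'' q :=
  ∑ b, mul h (x b) (y b)

theorem mulVec_one (x : Fin r → Sec K q) : mulVec 1 x = x := by
  funext a
  apply sec_ext
  intro i
  rw [mulVec, val_sum, Finset.sum_eq_single a]
  · simp [smul_val]
  · intro b _ hb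
    simp [smul_val, Matrix.one_apply_ne hb.symm]
  · simp

theorem vecMul_eq (x : Fin r → Sec K q) (P : Matrix (Fin r) (Fin r) Γ(T, ⊤)) :
    vecMul x P = mulVec P.transpose x := rfl

theorem vecMul_one (x : Fin r → Sec K q) : vecMul x 1 = x := by
  rw [vecMul_eq, Matrix.transpose_one, mulVec_one]

theorem mulVec_mul (P Q : Matrix (Fin r) (Fin r) Γ(T, ⊤)) (x : Fin r → Sec K q) :
    mulVec (P * Q) x = mulVec P (mulVec Q x) := by
  funext a
  apply sec_ext
  intro i
  simp only [mulVec, val_sum, smul_val, Matrix.mul_apply, map_sum, map_mul, Finset.sum_mul,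
    Finset.mul_sum]
  rw [Finset.sum_comm]
  simp only [mul_assoc]

theorem vecMul_mul (P Q : Matrix (Fin r) (Fin r) Γ(T, ⊤)) (x : Fin r → Sec K q) :
    vecMul x (P * Q) = vecMul (vecMul x P) Q := by
  simp only [vecMul_eq, Matrix.transpose_mul, mulVec_mul]

theorem vecMul_mulVec (P Q : Matrix (Fin r) (Fin r) Γ(T, ⊤)) (x : Fin r → Fin r → Sec K q)
    (a b : Fin r) :
    vecMul (fun d => mulVec P (fun c => x c d) a) Q b =
      mulVec P (fun c => vecMul (x c) Q b) a := by
  apply sec_ext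
  intro i
  simp only [mulVec, vecMul, val_sum, smul_val, Finset.mul_sum]
  rw [Finset.sum_comm]
  exact Finset.sum_congr rfl fun _ _ => Finset.sum_congr rfl fun _ _ => mul_left_comm _ _ _

theorem pull_sum (u : T' ⟶ T) {J : Type} (s : Finset J) (x : J → Sec K q) :
    pull u (∑ j ∈ s, x j) = ∑ j ∈ s, pull u (x j) := by
  apply sec_ext
  intro i
  rw [val_sum]
  refine (congrArg (u.appLE (q ⁻¹ᵁ U i) ((u ≫ q) ⁻¹ᵁ U i) le_rfl) (val_sum s x i)).trans ?_
  exact map_sum _ _ _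

theorem pull_smul (u : T' ⟶ T) (c : Γ(T, ⊤)) (x : Sec K q) :
    pull u (smul c x) = smul (u.appTop c) (pull u x) := by
  apply sec_ext
  intro i
  refine (map_mul _ _ _).trans (congrArg₂ _ ?_ rfl)
  exact (map_appLE_apply _ _ _ _ _ _ _).trans rfl

theorem pull_mulVec (u : T' ⟶ T) (P : Matrix (Fin r) (Fin r) Γ(T, ⊤)) (x : Fin r → Sec K q)
    (a : Fin r) :
    pull u (mulVec P x a) = mulVec (P.map u.appTop) (fun b => pull u (x b)) a := by
  rw [mulVec, pull_sum]
  exact Finset.sum_congr rfl fun _ _ => pull_smul _ _ _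

theorem pull_vecMul (u : T' ⟶ T) (P : Matrix (Fin r) (Fin r) Γ(T, ⊤)) (x : Fin r → Sec K q)
    (a : Fin r) :
    pull u (vecMul x P a) = vecMul (fun b => pull u (x b)) (P.map u.appTop) a :=
  pull_mulVec u P.transpose x a

end Sec

/-- The action on a total space given by an action on families of sections. -/
def RightAction.ofSec {𝒢 : GroupFunctor} {A : Type} (K : A → LineCocycle U) (hU : ⨆ i, U i = ⊤)
    (φ : ∀ {T : Scheme.{0}} (q : T ⟶ B), 𝒢.obj (op T) → (∀ a, Sec (K a) q) → ∀ a, Sec (K a) q)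
    (φ_one : ∀ {T : Scheme.{0}} (q : T ⟶ B) (x : ∀ a, Sec (K a) q), φ q 1 x = x)
    (φ_mul : ∀ {T : Scheme.{0}} (q : T ⟶ B) (g h : 𝒢.obj (op T)) (x : ∀ a, Sec (K a) q),
      φ q (g * h) x = φ q h (φ q g x))
    (φ_pull : ∀ {T T' : Scheme.{0}} (u : T' ⟶ T) (q : T ⟶ B) (g : 𝒢.obj (op T))
      (x : ∀ a, Sec (K a) q) (a : A),
      Sec.pull u (φ q g x a) = φ (u ≫ q) (𝒢.map u.op g) (fun a => Sec.pull u (x a)) a) :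
    RightAction 𝒢 (toBase K hU) where
  act {T} v g := (homEquiv K hU T).symm
    ⟨(homEquiv K hU T v).1, φ _ g (homEquiv K hU T v).2⟩
  act_toBase v g := by rw [homEquiv_symm_toBase, homEquiv_fst]
  act_one v := by rw [φ_one]; exact Equiv.symm_apply_apply _ _
  act_mul v g h := by rw [φ_mul, Equiv.apply_symm_apply]
  comp_act u v g := by
    rw [homEquiv_symm_comp, homEquiv_comp]
    congr 1
    refine Sigma.ext rfl (heq_of_eq ?_)
    funext a
    exact φ_pull u _ g _ a

end Matrices

/-- The data of a Grassmann flop over `B`: line bundles `L j` and `M i`, so that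
`E = ⨁ j, L j` and `F = ⨁ i, M i` have rank `n`, and a natural number `r`. -/
structure GrassmannFlopData (B : Scheme.{0}) (n r : ℕ) where
  L : Fin n → B.Modules
  M : Fin n → B.Modules
  isLineBundle_L : ∀ j, IsLineBundle (L j)
  isLineBundle_M : ∀ i, IsLineBundle (M i)

namespace GrassmannFlopData

variable {B : Scheme.{0}} {n r : ℕ} (D : GrassmannFlopData B n r)

/-- All line bundles of the data. -/
abbrev bundles : Fin n ⊕ Fin n → B.Modules := Sum.elim D.L D.M

/-- The opens of the simultaneous local frames of all line bundles. -/
abbrev opens : Frame D.bundles → B.Opens := fun i => i.U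

theorem iSup_opens : ⨆ i, D.opens i = ⊤ :=
  iSup_frame D.bundles (Sum.forall.mpr ⟨D.isLineBundle_L, D.isLineBundle_M⟩)

/-- The cocycle of `L j`. -/
abbrev cocycleL (j : Fin n) : LineCocycle D.opens := frameCocycle D.bundles (Sum.inl j)

/-- The cocycle of `M i`. -/
abbrev cocycleM (i : Fin n) : LineCocycle D.opens := frameCocycle D.bundles (Sum.inr i)

/-- The line bundles `(M i)⁻¹ ⊗ L j`, with direct sum `Hom(F, E)`. -/
abbrev kH : Fin n × Fin n → LineCocycle D.opens := fun p => D.cocycleL p.1 * (D.cocycleM p.2)⁻¹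

/-- The line bundles `(M i)⁻¹` and `L j`, `r` times each, with direct sum
`Hom(F, 𝒪 ^ r) × Hom(𝒪 ^ r, E)`. -/
abbrev kV : (Fin r × Fin n) ⊕ (Fin n × Fin r) → LineCocycle D.opens
  | .inl p => (D.cocycleM p.2)⁻¹
  | .inr p => D.cocycleL p.1

/-- The line bundles with direct sum `Hom(F, 𝒪 ^ r) × Hom(𝒪 ^ r, 𝒪 ^ r) × Hom(𝒪 ^ r, E)`. -/
abbrev kVt : (Fin r × Fin n) ⊕ (Fin r × Fin r) ⊕ (Fin n × Fin r) → LineCocycle D.opens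
  | .inl p => (D.cocycleM p.2)⁻¹
  | .inr (.inl _) => 1
  | .inr (.inr p) => D.cocycleL p.1

/-- `H`, the total space of `Hom(F, E)`. -/
def H : Scheme.{0} := totalSpace D.kH D.iSup_opens

/-- `V`, the total space of `Hom(F, 𝒪 ^ r) × Hom(𝒪 ^ r, E)`. -/
def V : Scheme.{0} := totalSpace D.kV D.iSup_opens

/-- `Ṽ`, the total space of `Hom(F, 𝒪 ^ r) × Hom(𝒪 ^ r, 𝒪 ^ r) × Hom(𝒪 ^ r, E)`. -/
def Vt : Scheme.{0} := totalSpace D.kVt D.iSup_opens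

/-- The projection of `V` to `B`. -/
def pV : D.V ⟶ B := toBase D.kV D.iSup_opens

/-- The projection of `Ṽ` to `B`. -/
def pVt : D.Vt ⟶ B := toBase D.kVt D.iSup_opens

/-- `(M, N) · g = (g⁻¹ M, N g)`. -/
def actSecV {T : Scheme.{0}} (q : T ⟶ B) (g : GL (Fin r) Γ(T, ⊤)) (x : ∀ a, Sec (D.kV a) q) :
    ∀ a, Sec (D.kV a) q
  | .inl (a, i) => Sec.mulVec (g⁻¹ : GL (Fin r) Γ(T, ⊤)).val (fun b => x (.inl (b, i))) a
  | .inr (j, a) => Sec.vecMul (fun b => x (.inr (j, b))) g.val a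

theorem actSecV_one {T : Scheme.{0}} (q : T ⟶ B) (x : ∀ a, Sec (D.kV a) q) :
    D.actSecV q 1 x = x := by
  funext a
  rcases a with ⟨a, i⟩ | ⟨j, a⟩
  · simp only [actSecV, inv_one, Units.val_one, Sec.mulVec_one]
  · simp only [actSecV, Units.val_one, Sec.vecMul_one]

theorem actSecV_mul {T : Scheme.{0}} (q : T ⟶ B) (g h : GL (Fin r) Γ(T, ⊤))
    (x : ∀ a, Sec (D.kV a) q) : D.actSecV q (g * h) x = D.actSecV q h (D.actSecV q g x) := by
  funext a
  rcases a with ⟨a, i⟩ | ⟨j, a⟩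
  · simp only [actSecV, mul_inv_rev, Units.val_mul, Sec.mulVec_mul]
  · simp only [actSecV, Units.val_mul, Sec.vecMul_mul]

theorem map_val {R S : Type} [CommRing R] [CommRing S] (f : R →+* S) (g : GL (Fin r) R) :
    (Matrix.GeneralLinearGroup.map f g).val = g.val.map f := rfl

theorem map_inv_val {R S : Type} [CommRing R] [CommRing S] (f : R →+* S) (g : GL (Fin r) R) :
    ((Matrix.GeneralLinearGroup.map f g)⁻¹).val = (g⁻¹).val.map f := rfl

theorem pull_actSecV {T T' : Scheme.{0}} (u : T' ⟶ T) (q : T ⟶ B) (g : GL (Fin r) Γ(T, ⊤))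
    (x : ∀ a, Sec (D.kV a) q) (a) :
    Sec.pull u (D.actSecV q g x a) =
      D.actSecV (u ≫ q) (Matrix.GeneralLinearGroup.map u.appTop.hom g)
        (fun a => Sec.pull u (x a)) a := by
  rcases a with ⟨a, i⟩ | ⟨j, a⟩
  · exact Sec.pull_mulVec _ _ _ _
  · exact Sec.pull_vecMul _ _ _ _

/-- The action of `GL_r` on `V`. -/
def actV : RightAction (GLr r) D.pV :=
  RightAction.ofSec D.kV D.iSup_opens (fun q g x => D.actSecV q g x)
    D.actSecV_one D.actSecV_mul D.pull_actSecV

/-- `(M, D, N) · (g₁, g₂) = (g₁⁻¹ M, g₂⁻¹ D g₁, N g₂)`. -/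
def actSecVt {T : Scheme.{0}} (q : T ⟶ B) (g : GL (Fin r) Γ(T, ⊤) × GL (Fin r) Γ(T, ⊤))
    (x : ∀ a, Sec (D.kVt a) q) : ∀ a, Sec (D.kVt a) q
  | .inl (a, i) => Sec.mulVec (g.1⁻¹ : GL (Fin r) Γ(T, ⊤)).val (fun b => x (.inl (b, i))) a
  | .inr (.inl (a, b)) => Sec.mulVec (g.2⁻¹ : GL (Fin r) Γ(T, ⊤)).val
      (fun c => Sec.vecMul (fun d => x (.inr (.inl (c, d)))) g.1.val b) a
  | .inr (.inr (j, a)) => Sec.vecMul (fun b => x (.inr (.inr (j, b)))) g.2.val a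

theorem actSecVt_one {T : Scheme.{0}} (q : T ⟶ B) (x : ∀ a, Sec (D.kVt a) q) :
    D.actSecVt q 1 x = x := by
  funext a
  rcases a with ⟨a, i⟩ | ⟨a, b⟩ | ⟨j, a⟩
  · simp only [actSecVt, Prod.fst_one, inv_one, Units.val_one, Sec.mulVec_one]
  · simp only [actSecVt, Prod.fst_one, Prod.snd_one, inv_one, Units.val_one, Sec.vecMul_one,
      Sec.mulVec_one]
  · simp only [actSecVt, Prod.snd_one, Units.val_one, Sec.vecMul_one]

theorem actSecVt_mul {T : Scheme.{0}} (q : T ⟶ B) (g h : GL (Fin r) Γ(T, ⊤) × GL (Fin r) Γ(T, ⊤))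
    (x : ∀ a, Sec (D.kVt a) q) : D.actSecVt q (g * h) x = D.actSecVt q h (D.actSecVt q g x) := by
  funext a
  rcases a with ⟨a, i⟩ | ⟨a, b⟩ | ⟨j, a⟩
  · simp only [actSecVt, Prod.fst_mul, mul_inv_rev, Units.val_mul, Sec.mulVec_mul]
  · simp only [actSecVt, Prod.fst_mul, Prod.snd_mul, mul_inv_rev, Units.val_mul, Sec.mulVec_mul,
      Sec.vecMul_mul, Sec.vecMul_mulVec]
  · simp only [actSecVt, Prod.snd_mul, Units.val_mul, Sec.vecMul_mul]

theorem pull_actSecVt {T T' : Scheme.{0}} (u : T' ⟶ T) (q : T ⟶ B)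
    (g : GL (Fin r) Γ(T, ⊤) × GL (Fin r) Γ(T, ⊤)) (x : ∀ a, Sec (D.kVt a) q) (a) :
    Sec.pull u (D.actSecVt q g x a) =
      D.actSecVt (u ≫ q) (Matrix.GeneralLinearGroup.map u.appTop.hom g.1,
        Matrix.GeneralLinearGroup.map u.appTop.hom g.2) (fun a => Sec.pull u (x a)) a := by
  rcases a with ⟨a, i⟩ | ⟨a, b⟩ | ⟨j, a⟩
  · exact Sec.pull_mulVec _ _ _ _
  · refine (Sec.pull_mulVec _ _ _ _).trans ?_
    exact congrFun (congrArg _ (funext fun c => Sec.pull_vecMul _ _ _ _)) _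
  · exact Sec.pull_vecMul _ _ _ _

/-- The action of `GL_r × GL_r` on `Ṽ`. -/
def actVt : RightAction (GLrGLr r) D.pVt :=
  RightAction.ofSec D.kVt D.iSup_opens (fun q g x => D.actSecVt q g x)
    D.actSecVt_one D.actSecVt_mul D.pull_actSecVt

/-- The morphism `V ⟶ H`, `(M, N) ↦ N M`. -/
def toH : D.V ⟶ D.H :=
  totalSpaceMap D.kV D.iSup_opens D.kH fun _ x => fun (j, i) =>
    Sec.dot rfl (fun b => x (.inr (j, b))) (fun b => x (.inl (b, i)))

/-- The morphism `Ṽ ⟶ V`, `(M, D, N) ↦ (M, N D)`. -/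
def toVMinus : D.Vt ⟶ D.V :=
  totalSpaceMap D.kVt D.iSup_opens D.kV fun _ x => fun
    | .inl (a, i) => x (.inl (a, i))
    | .inr (j, a) => Sec.dot (mul_one _) (fun b => x (.inr (.inr (j, b))))
        (fun b => x (.inr (.inl (b, a))))

/-- The morphism `Ṽ ⟶ V`, `(M, D, N) ↦ (D M, N)`. -/
def toVPlus : D.Vt ⟶ D.V :=
  totalSpaceMap D.kVt D.iSup_opens D.kV fun _ x => fun
    | .inl (a, i) => Sec.dot (one_mul _) (fun b => x (.inr (.inl (a, b))))
        (fun b => x (.inl (b, i)))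
    | .inr (j, a) => x (.inr (.inr (j, a)))

end GrassmannFlopData

end GrassmannFlop

end

/-!
The total spaces are handled through their points with values in a scheme `T`: over a simultaneous
local frame of the line bundles, a `T`-point of `V` is a pair of matrices `(M, N)` of functions on
`T`, a `T`-point of `Ṽ` is a triple `(M, D, N)`, and all actions and maps are matrix products.

**Semistable points.** The semistable loci of `V` for `det` and `det⁻¹` and of `Ṽ` are the loci where
`N` is injective, where `M` is surjective, and where both hold. The maximal minors of `N` or `M`, or
products of two such minors, are semi-invariant of weight one (`chartsPlus`, `chartsMinus`,
`chartsTilde`), so these loci are semistable. Conversely, if all minors of `N` vanish at a point with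
values in a field, then `N` has a kernel vector `x`, and scaling `x` by the coordinate of `𝔾ₘ` is a
one-parameter subgroup that moves the point along a curve which extends over the origin of `𝔸¹`,
while its character is not bounded there; hence every semi-invariant function of positive weight
vanishes (`IsSemiInvariant.appLE_eq_zero`, `vanish_plus`, `vanish_minus`, `vanish_tilde`).

**Quotients.** Where a maximal minor of `N` is invertible, that square submatrix of `N` is an
equivariant map to `GL_r`, and its fibre over the unit is a slice: each point has a unique translate
in it, by a unique group element (`nonempty_slice_of_equivariant`). These slices glue to a quotient
with local sections, such that two points with the same image are locally in the same orbit
(`IsPrincipalQuotient`, `exists_isPrincipalQuotient`). It is both a good quotient and a categorical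
one. Any other good quotient of the same open subset is isomorphic to it
(`IsGoodQuotient.isPrincipalQuotient`), so that every GIT quotient in question is principal. In
particular equivariant morphisms descend.

**The square.** Since points of principal quotients lift locally, and uniquely up to the group, the
square is cartesian as soon as two statements about matrices hold (`isPullback_of_local`). If
`N₁ M₁ = N₂ M₂`, where the rows of `N₁` in `I` and the columns of `M₂` in `J` form invertible square
matrices, then `E = (N₁)_I⁻¹ (N₂)_I` satisfies `E M₂ = M₁` and `N₁ E = N₂`, so that `(M₂, E, N₁)` is
a semistable point of `Ṽ` over the pair (`exists_point_tilde`). And if elements `g₁` and `g₂` of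
`GL_r` move the two images in `V` of a semistable point of `Ṽ` to those of another, then `(g₁, g₂)`
moves the first point to the second (`actPoint'_eq_of_actPoint_eq`).
-/

noncomputable section
namespace GrassmannFlop

/-! ### Gluing and local equality -/

section Gluing

/-- The open cover of a scheme by a covering family of open subsets. -/
def coverOfOpens {X : Scheme.{0}} {J : Type} (W : J → X.Opens) (hW : ∀ x, ∃ j, x ∈ W j) :
    X.OpenCover where
  I₀ := J
  X j := (W j).toScheme
  f j := (W j).ι
  mem₀ := by
    rw [Scheme.presieve₀_mem_precoverage_iff]
    exact ⟨fun x => ⟨(hW x).choose, by simpa using (hW x).choose_spec⟩, inferInstance⟩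

/-- Morphisms on the members of an open cover glue if they agree on common points. -/
theorem exists_glue {X Y : Scheme.{0}} {J : Type} (W : J → X.Opens) (hW : ∀ x, ∃ j, x ∈ W j)
    (f : ∀ j, (W j).toScheme ⟶ Y)
    (hf : ∀ i j (T : Scheme.{0}) (a : T ⟶ (W i).toScheme) (b : T ⟶ (W j).toScheme),
      a ≫ (W i).ι = b ≫ (W j).ι → a ≫ f i = b ≫ f j) :
    ∃ g : X ⟶ Y, ∀ j, (W j).ι ≫ g = f j :=
  ⟨(coverOfOpens W hW).glueMorphisms f fun i j => hf i j _ _ _ Limits.pullback.condition,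
    fun j => (coverOfOpens W hW).ι_glueMorphisms _ _ j⟩

/-- Functions are equal if they agree near each point. -/
theorem section_ext {X : Scheme.{0}} {O : X.Opens} {a b : Γ(X, O)}
    (h : ∀ x ∈ O, ∃ (W : X.Opens) (hW : W ≤ O), x ∈ W ∧
      X.presheaf.map (homOfLE hW).op a = X.presheaf.map (homOfLE hW).op b) : a = b := by
  choose W hW hx e using h
  refine X.sheaf.eq_of_locally_eq' (fun x : O => W x.1 x.2) O (fun x => homOfLE (hW x.1 x.2))
    ?_ a b fun x => e x.1 x.2
  exact fun x hxO => Opens.mem_iSup.mpr ⟨⟨x, hxO⟩, hx x hxO⟩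

theorem ι_appLE_injective {X : Scheme.{0}} (W : X.Opens) (e : ⊤ ≤ W.ι ⁻¹ᵁ W) :
    Function.Injective (W.ι.appLE W ⊤ e) :=
  (LocalModel.appLE_bijective W.ι W ⊤ (by simp) (by simp)).1

theorem ι_appLE_surjective {X : Scheme.{0}} (W : X.Opens) (e : ⊤ ≤ W.ι ⁻¹ᵁ W) :
    Function.Surjective (W.ι.appLE W ⊤ e) :=
  (LocalModel.appLE_bijective W.ι W ⊤ (by simp) (by simp)).2

theorem appTop_appLE_apply {X T T' : Scheme.{0}} (u : T' ⟶ T) (v : T ⟶ X) (O : X.Opens)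
    (hv : ⊤ ≤ v ⁻¹ᵁ O) (huv : ⊤ ≤ (u ≫ v) ⁻¹ᵁ O) (s : Γ(X, O)) :
    u.appTop (v.appLE O ⊤ hv s) = (u ≫ v).appLE O ⊤ huv s := by
  refine Eq.trans ?_ (appLE_appLE_apply u v O ⊤ ⊤ hv (fun _ _ => trivial) huv s)
  exact (ConcreteCategory.congr_hom (u.appLE_eq_app (U := ⊤)) _).symm

/-- Functions are equal if their pullbacks to a neighbourhood of each point are. -/
theorem function_ext {X : Scheme.{0}} {O : X.Opens} {a b : Γ(X, O)}
    (h : ∀ x ∈ O, ∃ (W : X.Opens) (hW : ⊤ ≤ W.ι ⁻¹ᵁ O), x ∈ W ∧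
      W.ι.appLE O ⊤ hW a = W.ι.appLE O ⊤ hW b) : a = b := by
  refine section_ext fun x hx => ?_
  obtain ⟨W, hW, hxW, e⟩ := h x hx
  have hWO : W ≤ O := fun y hy => hW (x := (⟨y, hy⟩ : W)) trivial
  refine ⟨W, hWO, hxW, ι_appLE_injective W (by simp) ?_⟩
  rwa [map_appLE_apply, map_appLE_apply]

/-- The morphism to an open subset given by a morphism with image in it. -/
def liftOpen {X T : Scheme.{0}} (O : X.Opens) (v : T ⟶ X) (h : ∀ t, v t ∈ O) : T ⟶ O.toScheme :=
  IsOpenImmersion.lift O.ι v (by rintro _ ⟨t, rfl⟩; simpa using h t)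

@[simp]
theorem liftOpen_ι {X T : Scheme.{0}} (O : X.Opens) (v : T ⟶ X) (h : ∀ t, v t ∈ O) :
    liftOpen O v h ≫ O.ι = v := IsOpenImmersion.lift_fac _ _ _

theorem liftOpen_ι_assoc {X T Y : Scheme.{0}} (O : X.Opens) (v : T ⟶ X) (h : ∀ t, v t ∈ O)
    (u : X ⟶ Y) : liftOpen O v h ≫ O.ι ≫ u = v ≫ u := by
  rw [← Category.assoc, liftOpen_ι]

theorem ι_apply_mem {X : Scheme.{0}} {W : X.Opens} (t : W.toScheme) : W.ι t ∈ W := t.2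

theorem exists_ι_apply {X : Scheme.{0}} {W : X.Opens} {x : X} (h : x ∈ W) :
    ∃ y : W.toScheme, W.ι y = x := ⟨⟨x, h⟩, rfl⟩

theorem mem_of_top_le_preimage {X T : Scheme.{0}} {v : T ⟶ X} {O : X.Opens}
    (h : ⊤ ≤ v ⁻¹ᵁ O) (t : T) : v t ∈ O := h (x := t) trivial

theorem top_le_comp_preimage {X T T' : Scheme.{0}} {v : T ⟶ X} {O : X.Opens}
    (h : ⊤ ≤ v ⁻¹ᵁ O) (u : T' ⟶ T) : ⊤ ≤ (u ≫ v) ⁻¹ᵁ O := fun t _ => h (x := u t) trivial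

theorem top_le_ι_preimage {X : Scheme.{0}} {W O : X.Opens} (h : W ≤ O) : ⊤ ≤ W.ι ⁻¹ᵁ O :=
  fun t _ => h t.2

end Gluing

/-! ### Orbits -/

section Orbits

variable {𝒢 : GroupFunctor} {V B : Scheme.{0}} {p : V ⟶ B} (ρ : RightAction 𝒢 p)

namespace RightAction

variable {ρ} {O : V.Opens} {T T' : Scheme.{0}}

theorem SameOrbit.symm {v w : T ⟶ O.toScheme} (h : ρ.SameOrbit v w) : ρ.SameOrbit w v := by
  obtain ⟨g, hg⟩ := h
  exact ⟨g⁻¹, by rw [← hg, ← ρ.act_mul, mul_inv_cancel, ρ.act_one]⟩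

theorem SameOrbit.trans {u v w : T ⟶ O.toScheme} (h : ρ.SameOrbit u v) (h' : ρ.SameOrbit v w) :
    ρ.SameOrbit u w := by
  obtain ⟨g, hg⟩ := h
  obtain ⟨g', hg'⟩ := h'
  exact ⟨g * g', by rw [ρ.act_mul, hg, hg']⟩

theorem SameOrbit.precomp {v w : T ⟶ O.toScheme} (h : ρ.SameOrbit v w) (u : T' ⟶ T) :
    ρ.SameOrbit (u ≫ v) (u ≫ w) := by
  obtain ⟨g, hg⟩ := h
  exact ⟨𝒢.map u.op g, by rw [Category.assoc, ← ρ.comp_act, hg, Category.assoc]⟩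

/-- Being in the same orbit does not depend on the ambient open subset. -/
theorem SameOrbit.of_eq {O' : V.Opens} {v w : T ⟶ O.toScheme} {v' w' : T ⟶ O'.toScheme}
    (h : ρ.SameOrbit v w) (hv : v ≫ O.ι = v' ≫ O'.ι) (hw : w ≫ O.ι = w' ≫ O'.ι) :
    ρ.SameOrbit v' w' := by
  obtain ⟨g, hg⟩ := h
  exact ⟨g, by rw [← hv, ← hw, hg]⟩

/-- `π : O ⟶ X` is a principal quotient: it is invariant, has sections locally on `X`, and
`T`-points of `O` with the same image are, locally on `T`, in the same orbit. -/
structure IsPrincipalQuotient (ρ : RightAction 𝒢 p) {O : V.Opens} {X : Scheme.{0}}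
    (π : O.toScheme ⟶ X) : Prop where
  invariant : ∀ (T : Scheme.{0}) (v w : T ⟶ O.toScheme), ρ.SameOrbit v w → v ≫ π = w ≫ π
  exists_section : ∀ x : X, ∃ (W : X.Opens) (s : W.toScheme ⟶ O.toScheme), x ∈ W ∧ s ≫ π = W.ι
  sameOrbit : ∀ (T : Scheme.{0}) (v w : T ⟶ O.toScheme), v ≫ π = w ≫ π → ∀ t : T,
    ∃ W : T.Opens, t ∈ W ∧ ρ.SameOrbit (W.ι ≫ v) (W.ι ≫ w)

namespace IsPrincipalQuotient

variable {X Y : Scheme.{0}} {π : O.toScheme ⟶ X}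

/-- Locally, every `T`-point of a principal quotient lifts. -/
theorem exists_lift (h : ρ.IsPrincipalQuotient π) (a : T ⟶ X) (t : T) :
    ∃ (W : T.Opens) (v : W.toScheme ⟶ O.toScheme), t ∈ W ∧ v ≫ π = W.ι ≫ a := by
  obtain ⟨W, s, hW, hs⟩ := h.exists_section (a t)
  refine ⟨a ⁻¹ᵁ W, (a ∣_ W) ≫ s, hW, ?_⟩
  rw [Category.assoc, hs, morphismRestrict_ι]

theorem surjective (h : ρ.IsPrincipalQuotient π) : Surjective π := by
  refine ⟨fun x => ?_⟩
  obtain ⟨W, s, hW, hs⟩ := h.exists_section x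
  obtain ⟨y, rfl⟩ := exists_ι_apply hW
  exact ⟨s y, by rw [← Scheme.Hom.comp_apply, hs]⟩

/-- A principal quotient is a categorical quotient. -/
theorem exists_desc (h : ρ.IsPrincipalQuotient π) (φ : O.toScheme ⟶ Y)
    (hφ : ∀ (T : Scheme.{0}) (v w : T ⟶ O.toScheme), ρ.SameOrbit v w → v ≫ φ = w ≫ φ) :
    ∃ f : X ⟶ Y, π ≫ f = φ := by
  have key : ∀ (T : Scheme.{0}) (v w : T ⟶ O.toScheme), v ≫ π = w ≫ π → v ≫ φ = w ≫ φ := by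
    intro T v w e
    refine Scheme.hom_ext_of_forall _ _ fun t => ?_
    obtain ⟨W, ht, hW⟩ := h.sameOrbit T v w e t
    exact ⟨W, ht, by simpa using hφ _ _ _ hW⟩
  choose W s hx hs using h.exists_section
  obtain ⟨f, hf⟩ := exists_glue W (fun x => ⟨x, hx x⟩) (fun x => s x ≫ φ) (by
    intro i j T a b hab
    rw [← Category.assoc, ← Category.assoc]
    apply key
    rw [Category.assoc, Category.assoc, hs, hs, hab])
  refine ⟨f, Scheme.hom_ext_of_forall _ _ fun t => ?_⟩
  refine ⟨π ⁻¹ᵁ W (π t), hx _, ?_⟩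
  rw [← morphismRestrict_ι_assoc, hf, ← Category.assoc]
  apply key
  rw [Category.assoc, hs, morphismRestrict_ι]

/-- An invariant function takes the same value at points with the same image in the quotient. -/
theorem appLE_eq (h : ρ.IsPrincipalQuotient π) {O' : O.toScheme.Opens} {f : Γ(O.toScheme, O')}
    (hf : ρ.IsInvariantFunction f) (v w : T ⟶ O.toScheme) (e : v ≫ π = w ≫ π)
    (hv : ⊤ ≤ v ⁻¹ᵁ O') (hw : ⊤ ≤ w ⁻¹ᵁ O') : v.appLE O' ⊤ hv f = w.appLE O' ⊤ hw f := by
  refine function_ext fun t _ => ?_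
  obtain ⟨W, ht, hW⟩ := h.sameOrbit T v w e t
  refine ⟨W, top_le_ι_preimage le_top, ht, ?_⟩
  have hv' : ⊤ ≤ (W.ι ≫ v) ⁻¹ᵁ O' := top_le_comp_preimage hv _
  have hw' : ⊤ ≤ (W.ι ≫ w) ⁻¹ᵁ O' := top_le_comp_preimage hw _
  rw [appLE_appLE_apply _ _ _ _ _ _ _ hv', appLE_appLE_apply _ _ _ _ _ _ _ hw']
  exact (hf _ _ _ hv' hw' hW).symm

/-- An invariant function descends along a local section, compatibly with all points. -/
theorem exists_local_function (h : ρ.IsPrincipalQuotient π) {W : X.Opens}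
    {f : Γ(O.toScheme, π ⁻¹ᵁ W)} (hf : ρ.IsInvariantFunction f) (x : X) (hx : x ∈ W) :
    ∃ (N : X.Opens) (_ : x ∈ N) (_ : N ≤ W) (s : N.toScheme ⟶ O.toScheme) (_ : s ≫ π = N.ι)
      (k : Γ(X, N)), ∀ (T : Scheme.{0}) (v : T ⟶ O.toScheme) (hv : ⊤ ≤ v ⁻¹ᵁ (π ⁻¹ᵁ W))
      (hv' : ⊤ ≤ (v ≫ π) ⁻¹ᵁ N), (v ≫ π).appLE N ⊤ hv' k = v.appLE (π ⁻¹ᵁ W) ⊤ hv f := by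
  obtain ⟨N', s', hx', hs'⟩ := h.exists_section x
  let N : X.Opens := N' ⊓ W
  let s : N.toScheme ⟶ O.toScheme := X.homOfLE (inf_le_left : N ≤ N') ≫ s'
  have hs : s ≫ π = N.ι := by simp [s, hs']
  have hsW : ⊤ ≤ s ⁻¹ᵁ (π ⁻¹ᵁ W) := by
    change ⊤ ≤ (s ≫ π) ⁻¹ᵁ W
    rw [hs]
    exact top_le_ι_preimage inf_le_right
  obtain ⟨k, hk⟩ := ι_appLE_surjective N (top_le_ι_preimage le_rfl) (s.appLE _ ⊤ hsW f)
  refine ⟨N, ⟨hx', hx⟩, inf_le_right, s, hs, k, fun T v hv hv' => ?_⟩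
  let u : T ⟶ N.toScheme := liftOpen _ (v ≫ π) (mem_of_top_le_preimage hv')
  have hu : u ≫ N.ι = v ≫ π := liftOpen_ι _ _ _
  have hu' : ⊤ ≤ (u ≫ N.ι) ⁻¹ᵁ N := hu ▸ hv'
  have h2 : ⊤ ≤ (u ≫ s) ⁻¹ᵁ (π ⁻¹ᵁ W) := top_le_comp_preimage hsW u
  refine (LocalModel.appLE_congr_apply hu.symm N ⊤ hv' hu' k).trans ?_
  refine (appLE_appLE_apply u N.ι N ⊤ ⊤ (top_le_ι_preimage le_rfl) (fun _ _ => trivial)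
    hu' k).symm.trans ?_
  rw [hk]
  refine (appLE_appLE_apply _ _ _ _ _ _ _ h2 _).trans ?_
  exact h.appLE_eq hf _ _ (by rw [Category.assoc, hs, hu]) _ _

/-- The functions on a principal quotient are the invariant functions. -/
theorem existsUnique_function (h : ρ.IsPrincipalQuotient π) (W : X.Opens)
    (f : Γ(O.toScheme, π ⁻¹ᵁ W)) (hf : ρ.IsInvariantFunction f) : ∃! k : Γ(X, W), π.app W k = f := by
  -- The functions on the domains of local sections have the right values at all points, so they
  -- agree on overlaps.
  choose N hx hNW s hs k key using fun x : W => h.exists_local_function hf x.1 x.2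
  have hcov : W ≤ ⨆ x, N x := fun x hxW => Opens.mem_iSup.mpr ⟨⟨x, hxW⟩, hx ⟨x, hxW⟩⟩
  have hsW : ∀ x, ⊤ ≤ s x ⁻¹ᵁ (π ⁻¹ᵁ W) := by
    intro x
    change ⊤ ≤ (s x ≫ π) ⁻¹ᵁ W
    rw [hs]
    exact top_le_ι_preimage (hNW x)
  have compat : ∀ x y, X.presheaf.map (homOfLE (inf_le_left : N x ⊓ N y ≤ N x)).op (k x) =
      X.presheaf.map (homOfLE (inf_le_right : N x ⊓ N y ≤ N y)).op (k y) := by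
    intro x y
    apply ι_appLE_injective (N x ⊓ N y) (top_le_ι_preimage le_rfl)
    rw [map_appLE_apply, map_appLE_apply]
    let v := X.homOfLE (inf_le_left : N x ⊓ N y ≤ N x) ≫ s x
    have hv : v ≫ π = (N x ⊓ N y).ι := by simp [v, hs]
    have hvW : ⊤ ≤ v ⁻¹ᵁ (π ⁻¹ᵁ W) := top_le_comp_preimage (hsW x) _
    have hx1 : ⊤ ≤ (v ≫ π) ⁻¹ᵁ N x := by rw [hv]; exact top_le_ι_preimage inf_le_left
    have hy1 : ⊤ ≤ (v ≫ π) ⁻¹ᵁ N y := by rw [hv]; exact top_le_ι_preimage inf_le_right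
    rw [LocalModel.appLE_congr_apply hv.symm (N x) ⊤ _ hx1,
      LocalModel.appLE_congr_apply hv.symm (N y) ⊤ _ hy1, key x _ v hvW hx1, key y _ v hvW hy1]
  obtain ⟨K, hK'⟩ : ∃ K : Γ(X, W), ∀ x, X.presheaf.map (homOfLE (hNW x)).op K = k x :=
    (X.sheaf.existsUnique_gluing' N W (fun x => homOfLE (hNW x)) hcov k
      (fun x y => compat x y)).exists
  refine ⟨K, ?_, ?_⟩
  · refine function_ext fun t ht => ?_
    obtain ⟨x, hxt⟩ : ∃ x : W, x.1 = π t := ⟨⟨π t, ht⟩, rfl⟩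
    have hle : π ⁻¹ᵁ N x ≤ π ⁻¹ᵁ W := π.preimage_mono (hNW _)
    have h1 : ⊤ ≤ (π ⁻¹ᵁ N x).ι ⁻¹ᵁ (π ⁻¹ᵁ W) := top_le_ι_preimage hle
    have h2 : ⊤ ≤ ((π ⁻¹ᵁ N x).ι ≫ π) ⁻¹ᵁ N x :=
      top_le_ι_preimage (W := π ⁻¹ᵁ N x) le_rfl
    refine ⟨π ⁻¹ᵁ N x, h1, ?_, ?_⟩
    · change π t ∈ N x
      rw [← hxt]
      exact hx x
    refine Eq.trans ?_ (key x _ (π ⁻¹ᵁ N x).ι h1 h2)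
    rw [← hK' x, map_appLE_apply, ← π.appLE_eq_app]
    exact appLE_appLE_apply _ _ _ _ _ _ _ h1 _
  · intro K' e
    refine section_ext fun y hy => ⟨N ⟨y, hy⟩, hNW _, hx ⟨y, hy⟩, ?_⟩
    refine Eq.trans ?_ (hK' ⟨y, hy⟩).symm
    apply ι_appLE_injective (N ⟨y, hy⟩) (top_le_ι_preimage le_rfl)
    have h1 : ⊤ ≤ (s ⟨y, hy⟩ ≫ π) ⁻¹ᵁ N ⟨y, hy⟩ := by rw [hs]; exact top_le_ι_preimage le_rfl
    have h2 : ⊤ ≤ (s ⟨y, hy⟩ ≫ π) ⁻¹ᵁ W := hsW _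
    refine Eq.trans ?_ (LocalModel.appLE_congr_apply (hs _) _ _ h1 _ _)
    rw [key ⟨y, hy⟩ _ _ (hsW _) h1, map_appLE_apply, ← e, ← π.appLE_eq_app]
    refine Eq.trans ?_ (appLE_appLE_apply _ _ _ _ _ _ _ h2 _).symm
    exact LocalModel.appLE_congr_apply (hs _).symm _ _ _ _ _

/-- An invariant set contains a point if and only if it contains the value of a local section at the
image of the point. -/
theorem mem_iff_section_mem (h : ρ.IsPrincipalQuotient π) {Z : Set O.toScheme}
    (hZ : ρ.IsInvariantSet Z) {W : X.Opens} {s : W.toScheme ⟶ O.toScheme} (hs : s ≫ π = W.ι)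
    {x : W.toScheme} {z : O.toScheme} (hz : π z = W.ι x) : z ∈ Z ↔ s x ∈ Z := by
  have hzW : z ∈ π ⁻¹ᵁ W := by change π z ∈ W; rw [hz]; exact x.2
  have e : (π ⁻¹ᵁ W).ι ≫ π = ((π ∣_ W) ≫ s) ≫ π := by
    rw [Category.assoc, hs, morphismRestrict_ι]
  obtain ⟨y, rfl⟩ := exists_ι_apply hzW
  obtain ⟨N, hN, ho⟩ := h.sameOrbit _ _ _ e y
  obtain ⟨y, rfl⟩ := exists_ι_apply hN
  have h1 := hZ _ _ _ ho y
  have h3 : (π ∣_ W) (N.ι y) = x := by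
    apply W.ι.isOpenEmbedding.injective
    rw [← hz, ← Scheme.Hom.comp_apply, morphismRestrict_ι, Scheme.Hom.comp_apply]
  rwa [Scheme.Hom.comp_apply, Scheme.Hom.comp_apply, Scheme.Hom.comp_apply, h3] at h1

/-- Over the domain of a local section `s`, the image of an invariant set is its preimage under `s`;
this makes images of closed invariant sets closed and compatible with intersections. -/
theorem mem_image_iff (h : ρ.IsPrincipalQuotient π) {Z : Set O.toScheme}
    (hZ : ρ.IsInvariantSet Z) {W : X.Opens} {s : W.toScheme ⟶ O.toScheme} (hs : s ≫ π = W.ι)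
    (x : W.toScheme) : W.ι x ∈ π '' Z ↔ s x ∈ Z := by
  constructor
  · rintro ⟨z, hzZ, hz⟩
    exact (h.mem_iff_section_mem hZ hs hz).mp hzZ
  · intro hx
    exact ⟨s x, hx, by rw [← Scheme.Hom.comp_apply, hs]⟩

theorem isClosed_image (h : ρ.IsPrincipalQuotient π) {Z : Set O.toScheme} (hc : IsClosed Z)
    (hZ : ρ.IsInvariantSet Z) : IsClosed (π '' Z) := by
  rw [← isOpen_compl_iff, isOpen_iff_forall_mem_open]
  intro x hx
  obtain ⟨W, s, hW, hs⟩ := h.exists_section x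
  obtain ⟨y, rfl⟩ := exists_ι_apply hW
  refine ⟨W.ι '' (s ⁻¹' Zᶜ), ?_, ?_, ?_⟩
  · rintro _ ⟨y, hy, rfl⟩ hy'
    exact hy ((h.mem_image_iff hZ hs y).mp hy')
  · exact W.ι.isOpenEmbedding.isOpenMap _ (hc.isOpen_compl.preimage s.continuous)
  · exact ⟨y, fun hsx => hx ((h.mem_image_iff hZ hs y).mpr hsx), rfl⟩

theorem image_iInter (h : ρ.IsPrincipalQuotient π) (J : Type) (Z : J → Set O.toScheme)
    (hZ : ∀ j, ρ.IsInvariantSet (Z j)) : π '' (⋂ j, Z j) = ⋂ j, π '' (Z j) := by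
  have hZ' : ρ.IsInvariantSet (⋂ j, Z j) := fun T v w e t => by
    simp only [Set.mem_iInter]
    exact forall_congr' fun j => hZ j T v w e t
  ext x
  obtain ⟨W, s, hW, hs⟩ := h.exists_section x
  obtain ⟨y, rfl⟩ := exists_ι_apply hW
  rw [h.mem_image_iff hZ' hs y, Set.mem_iInter, Set.mem_iInter]
  exact forall_congr' fun j => (h.mem_image_iff (hZ j) hs y).symm

/-- An affine principal quotient is a good quotient. -/
theorem isGoodQuotient (h : ρ.IsPrincipalQuotient π) (ha : IsAffineHom π) :
    ρ.IsGoodQuotient π where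
  invariant := h.invariant
  affine := ha
  surjective := h.surjective
  functions := h.existsUnique_function
  isClosed_image _ hc hZ := h.isClosed_image hc hZ
  image_iInter J Z _ hZ := h.image_iInter J Z hZ

end IsPrincipalQuotient

end RightAction

end Orbits

/-! ### Comparison of good quotients with principal quotients -/

section Comparison

variable {X Y Z : Scheme.{0}}

theorem app_eq_appLE_apply (φ : X ⟶ Y) (W : Y.Opens) (a : Γ(Y, W)) :
    φ.app W a = φ.appLE W (φ ⁻¹ᵁ W) le_rfl a := by rw [φ.appLE_eq_app]

/-- A morphism that is surjective and injective on functions is an epimorphism. -/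
theorem eq_of_surjective_of_injective {φ : X ⟶ Y} (hs : Function.Surjective φ)
    (hi : ∀ W, Function.Injective (φ.app W)) {a b : Y ⟶ Z} (e : φ ≫ a = φ ≫ b) : a = b := by
  have hb : ∀ y, a y = b y := by
    intro y
    obtain ⟨x, rfl⟩ := hs y
    rw [← Scheme.Hom.comp_apply, e, Scheme.Hom.comp_apply]
  have hbase : a.base = b.base := by ext y; exact hb y
  refine Scheme.Hom.ext hbase fun U => ?_
  ext s
  have hab : b ⁻¹ᵁ U ≤ a ⁻¹ᵁ U := fun y hy => by
    change a y ∈ U; rw [hb]; exact hy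
  have h1 : φ ⁻¹ᵁ (b ⁻¹ᵁ U) ≤ (φ ≫ b) ⁻¹ᵁ U := le_rfl
  have h2 : φ ⁻¹ᵁ (b ⁻¹ᵁ U) ≤ (φ ≫ a) ⁻¹ᵁ U := by rw [e]; exact h1
  have h3 : a.appLE U (b ⁻¹ᵁ U) hab s = b.appLE U (b ⁻¹ᵁ U) le_rfl s := by
    apply hi
    rw [app_eq_appLE_apply, app_eq_appLE_apply, appLE_appLE_apply _ _ _ _ _ _ _ h1,
      appLE_appLE_apply _ _ _ _ _ _ _ h2]
    exact LocalModel.appLE_congr_apply e _ _ _ _ _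
  exact h3.trans (by rw [b.appLE_eq_app])

/-- A morphism that is surjective, an isomorphism on functions, and an open immersion followed by a
morphism to an affine scheme, is an isomorphism. -/
theorem isIso_of_isOpenImmersion_to_affine {φ : X ⟶ Y} (hs : Function.Surjective φ)
    (hb : ∀ W, Function.Bijective (φ.app W)) (U : Scheme.{0}) [IsAffine U] (j : X ⟶ U)
    [IsOpenImmersion j] : IsIso φ := by
  have : IsIso φ.appTop := (ConcreteCategory.isIso_iff_bijective _).mpr (hb ⊤)
  let ψ : Y ⟶ U := Y.toSpecΓ ≫ Spec.map (j.appTop ≫ inv φ.appTop) ≫ U.isoSpec.inv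
  have hψ : φ ≫ ψ = j := by
    rw [← cancel_mono U.isoSpec.hom]
    simp only [ψ, Category.assoc, Iso.inv_hom_id, Category.comp_id]
    rw [Scheme.toSpecΓ_naturality_assoc, ← Spec.map_comp]
    simp [Scheme.isoSpec, Scheme.toSpecΓ_naturality]
  have hr : ∀ y, ψ y ∈ j.opensRange := by
    intro y
    obtain ⟨x, rfl⟩ := hs y
    exact ⟨x, by rw [← Scheme.Hom.comp_apply, hψ]⟩
  let ψ' : Y ⟶ X := IsOpenImmersion.lift j ψ (by rintro _ ⟨y, rfl⟩; exact hr y)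
  have hψ' : ψ' ≫ j = ψ := IsOpenImmersion.lift_fac _ _ _
  have h1 : φ ≫ ψ' = 𝟙 X := by
    rw [← cancel_mono j, Category.assoc, hψ', hψ, Category.id_comp]
  refine ⟨ψ', h1, eq_of_surjective_of_injective hs (fun W => (hb W).1) ?_⟩
  rw [← Category.assoc, h1, Category.id_comp, Category.comp_id]

/-- If images of closed sets are closed and compatible with intersections, then each fibre contains
a point that lies in all closed sets meeting the fibre. An affine neighbourhood of this point contains
the fibre, because its complement does not meet the fibre; hence it contains the preimage of a
neighbourhood of `y`. -/
theorem exists_preimage_le_affine {φ : X ⟶ Y}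
    (hc : ∀ Z : Set X, IsClosed Z → IsClosed (φ '' Z))
    (hI : ∀ (J : Type) (Z : J → Set X), (∀ j, IsClosed (Z j)) → φ '' (⋂ j, Z j) = ⋂ j, φ '' Z j)
    (y : Y) : ∃ (W : Y.Opens) (U : X.Opens), y ∈ W ∧ IsAffineOpen U ∧ φ ⁻¹ᵁ W ≤ U := by
  obtain ⟨x, hx, hxy⟩ : y ∈ φ '' ⋂ Z : {Z : Set X // IsClosed Z ∧ y ∈ φ '' Z}, Z.1 := by
    rw [hI _ _ fun Z => Z.2.1]
    exact Set.mem_iInter.mpr fun Z => Z.2.2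
  obtain ⟨U, hU, hxU, -⟩ := exists_isAffineOpen_mem_and_subset (x := x) (U := ⊤) trivial
  have hy : y ∉ φ '' (U : Set X)ᶜ := fun h =>
    Set.mem_iInter.mp hx ⟨(U : Set X)ᶜ, U.isOpen.isClosed_compl, h⟩ hxU
  refine ⟨⟨(φ '' (U : Set X)ᶜ)ᶜ, (hc _ U.isOpen.isClosed_compl).isOpen_compl⟩, U, hy, hU, ?_⟩
  intro x' hx'
  by_contra h
  exact hx' ⟨x', h, rfl⟩

/-- A morphism is an isomorphism if it is surjective and bijective on functions, and images of closed
sets are closed and compatible with intersections. No separation hypothesis is needed. -/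
theorem isIso_of_isClosed_image {φ : X ⟶ Y} (hs : Function.Surjective φ)
    (hb : ∀ W, Function.Bijective (φ.app W))
    (hc : ∀ Z : Set X, IsClosed Z → IsClosed (φ '' Z))
    (hI : ∀ (J : Type) (Z : J → Set X), (∀ j, IsClosed (Z j)) → φ '' (⋂ j, Z j) = ⋂ j, φ '' Z j) :
    IsIso φ := by
  choose W U hyW hU hWU using exists_preimage_le_affine hc hI
  have hcov : ⨆ y, W y = ⊤ := top_le_iff.mp fun y _ => Opens.mem_iSup.mpr ⟨y, hyW y⟩
  refine (IsZariskiLocalAtTarget.iff_of_iSup_eq_top (P := .isomorphisms Scheme) W hcov).mpr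
    fun y => ?_
  have : IsAffine (U y).toScheme := hU y
  have hs' : Function.Surjective (φ ∣_ W y) := by
    intro z
    obtain ⟨x, hx⟩ := hs ((W y).ι z)
    have hx' : x ∈ φ ⁻¹ᵁ W y := by
      change φ x ∈ W y
      rw [hx]; exact z.2
    obtain ⟨x, rfl⟩ := exists_ι_apply hx'
    refine ⟨x, (W y).ι.isOpenEmbedding.injective ?_⟩
    rw [← Scheme.Hom.comp_apply, morphismRestrict_ι, Scheme.Hom.comp_apply, hx]
  refine isIso_of_isOpenImmersion_to_affine hs' (fun O => ?_) (U y).toScheme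
    (X.homOfLE (hWU y))
  have key : ∀ (N : Y.Opens) (N' : X.Opens) (h : N' = φ ⁻¹ᵁ N),
      Function.Bijective (φ.appLE N N' h.le) := by
    rintro N _ rfl
    rw [φ.appLE_eq_app]
    exact hb N
  rw [morphismRestrict_app']
  exact key _ _ (image_morphismRestrict_preimage φ (W y) O)

end Comparison

section Orbits

variable {𝒢 : GroupFunctor} {V B : Scheme.{0}} {p : V ⟶ B} {ρ : RightAction 𝒢 p}
  {O : V.Opens} {X Y : Scheme.{0}}

namespace RightAction

theorem isInvariantSet_preimage {π : O.toScheme ⟶ X}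
    (h : ∀ (T : Scheme.{0}) (v w : T ⟶ O.toScheme), ρ.SameOrbit v w → v ≫ π = w ≫ π) (Z : Set X) :
    ρ.IsInvariantSet (π ⁻¹' Z) := by
  intro T v w e t
  rw [Set.mem_preimage, Set.mem_preimage, ← Scheme.Hom.comp_apply, h T v w e,
    Scheme.Hom.comp_apply]

theorem isInvariantFunction_app {π : O.toScheme ⟶ X}
    (h : ∀ (T : Scheme.{0}) (v w : T ⟶ O.toScheme), ρ.SameOrbit v w → v ≫ π = w ≫ π)
    {W : X.Opens} (k : Γ(X, W)) : ρ.IsInvariantFunction (π.app W k) := by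
  intro T v w hv hw e
  have hv' : ⊤ ≤ (v ≫ π) ⁻¹ᵁ W := hv
  have hw' : ⊤ ≤ (w ≫ π) ⁻¹ᵁ W := hw
  rw [app_eq_appLE_apply, appLE_appLE_apply _ _ _ _ _ _ _ hv', appLE_appLE_apply _ _ _ _ _ _ _ hw']
  exact LocalModel.appLE_congr_apply (h T v w e).symm _ _ _ _ _

theorem IsGoodQuotient.app_injective {π : O.toScheme ⟶ X} (h : ρ.IsGoodQuotient π) (W : X.Opens) :
    Function.Injective (π.app W) := fun k _ e =>
  (h.functions W (π.app W k) (isInvariantFunction_app h.invariant k)).unique rfl e.symm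

/-- A good quotient is an epimorphism. -/
theorem IsGoodQuotient.hom_ext {π : O.toScheme ⟶ X} (h : ρ.IsGoodQuotient π) {a b : X ⟶ Y}
    (e : π ≫ a = π ≫ b) : a = b :=
  eq_of_surjective_of_injective h.surjective.surj h.app_injective e

theorem IsPrincipalQuotient.comp_iso {π : O.toScheme ⟶ X} (h : ρ.IsPrincipalQuotient π)
    (φ : X ⟶ Y) [IsIso φ] : ρ.IsPrincipalQuotient (π ≫ φ) where
  invariant T v w e := by rw [← Category.assoc, h.invariant T v w e, Category.assoc]
  exists_section y := by
    obtain ⟨N, v, hN, hv⟩ := h.exists_lift (inv φ) y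
    exact ⟨N, v, hN, by rw [← Category.assoc, hv, Category.assoc, IsIso.inv_hom_id,
      Category.comp_id]⟩
  sameOrbit T v w e := h.sameOrbit T v w (by
    rwa [← Category.assoc, ← Category.assoc, cancel_mono] at e)

/-- If an open subset has a principal quotient, then all its good quotients are principal. -/
theorem IsGoodQuotient.isPrincipalQuotient {π : O.toScheme ⟶ X} {π' : O.toScheme ⟶ Y}
    (h' : ρ.IsGoodQuotient π') (h : ρ.IsPrincipalQuotient π) : ρ.IsPrincipalQuotient π' := by
  -- The comparison `φ` of the two quotients inherits from `π'` the conditions on functions and on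
  -- closed sets, since all closed sets below have invariant preimages.
  obtain ⟨φ, rfl⟩ := h.exists_desc π' h'.invariant
  have hsπ : Function.Surjective π := h.surjective.surj
  have himage : ∀ Z : Set X, (π ≫ φ) '' (π ⁻¹' Z) = φ '' Z := by
    intro Z
    ext y
    constructor
    · rintro ⟨z, hz, rfl⟩
      exact ⟨π z, hz, by rw [Scheme.Hom.comp_apply]⟩
    · rintro ⟨x, hx, rfl⟩
      obtain ⟨z, rfl⟩ := hsπ x
      exact ⟨z, hx, by rw [Scheme.Hom.comp_apply]⟩
  have hcl : ∀ Z : Set X, IsClosed Z → IsClosed (π ⁻¹' Z) := fun Z hZ =>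
    hZ.preimage π.continuous
  have : IsIso φ := by
    refine isIso_of_isClosed_image ?_ ?_ ?_ ?_
    · intro y
      obtain ⟨z, rfl⟩ := h'.surjective.surj y
      exact ⟨π z, by rw [Scheme.Hom.comp_apply]⟩
    · intro W
      refine ⟨fun k k' e => h'.app_injective W ?_, fun k => ?_⟩
      · rw [Scheme.Hom.comp_app]
        exact congrArg (π.app (φ ⁻¹ᵁ W)) e
      · have hk := isInvariantFunction_app (ρ := ρ) h.invariant k
        obtain ⟨k', hk', -⟩ := h'.functions W (π.app _ k) hk
        refine ⟨k', (h.existsUnique_function _ _ hk).unique ?_ rfl⟩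
        rw [Scheme.Hom.comp_app] at hk'
        exact hk'
    · intro Z hZ
      rw [← himage]
      exact h'.isClosed_image _ (hcl Z hZ) (isInvariantSet_preimage h.invariant Z)
    · intro J Z hZ
      simp_rw [← himage]
      rw [Set.preimage_iInter]
      exact h'.image_iInter J _ (fun j => hcl _ (hZ j))
        fun j => isInvariantSet_preimage h.invariant _
  exact h.comp_iso φ

end RightAction

end Orbits

/-! ### Gluing of local slices to a principal quotient -/

theorem isAffine_of_retract {X Y : Scheme.{0}} [IsAffine Y] (s : X ⟶ Y) (π : Y ⟶ X)
    (h : s ≫ π = 𝟙 X) : IsAffine X := by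
  refine ⟨Spec.map s.appTop ≫ Y.isoSpec.inv ≫ π, ?_, ?_⟩
  · rw [← Scheme.toSpecΓ_naturality_assoc, Scheme.toSpecΓ_isoSpec_inv_assoc, h]
  · rw [Category.assoc, Category.assoc, Scheme.toSpecΓ_naturality,
      Scheme.isoSpec_inv_toSpecΓ_assoc, ← Spec.map_comp, ← Scheme.Hom.comp_appTop, h]
    simp

section Slices

variable {𝒢 : GroupFunctor} {V B : Scheme.{0}} {p : V ⟶ B} (ρ : RightAction 𝒢 p)

namespace RightAction

/-- The open subset `P` of `V` is stable under the action. -/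
def IsInvariantOpen (P : V.Opens) : Prop :=
  ∀ (T : Scheme.{0}) (v : T ⟶ V) (g : 𝒢.obj (op T)), (∀ t, v t ∈ P) → ∀ t, ρ.act v g t ∈ P

/-- A slice for the action on the open subset `P`: an invariant morphism `π : P ⟶ X` with a section
`s` such that `s (π v)` is in the orbit of `v`. -/
structure Slice (P : V.Opens) where
  X : Scheme.{0}
  π : P.toScheme ⟶ X
  s : X ⟶ P.toScheme
  s_π : s ≫ π = 𝟙 X
  sameOrbit : ρ.SameOrbit (𝟙 P.toScheme) (π ≫ s)
  invariant : ∀ (T : Scheme.{0}) (v w : T ⟶ P.toScheme), ρ.SameOrbit v w → v ≫ π = w ≫ π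

variable {ρ}

theorem IsInvariantOpen.mem {P O : V.Opens} (hP : ρ.IsInvariantOpen P) {T : Scheme.{0}}
    {v w : T ⟶ O.toScheme} (h : ρ.SameOrbit v w) {t : T} (ht : O.ι (v t) ∈ P) : O.ι (w t) ∈ P := by
  obtain ⟨g, hg⟩ := h
  let W : T.Opens := (v ≫ O.ι) ⁻¹ᵁ P
  have htW : t ∈ W := by
    change (v ≫ O.ι) t ∈ P
    rwa [Scheme.Hom.comp_apply]
  obtain ⟨y, rfl⟩ := exists_ι_apply htW
  have h1 := hP _ (W.ι ≫ v ≫ O.ι) (𝒢.map W.ι.op g) (fun t => by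
    rw [Scheme.Hom.comp_apply]; exact t.2) y
  rw [← ρ.comp_act, hg] at h1
  simpa only [Scheme.Hom.comp_apply] using h1

theorem IsInvariantOpen.inf {P Q : V.Opens} (hP : ρ.IsInvariantOpen P)
    (hQ : ρ.IsInvariantOpen Q) : ρ.IsInvariantOpen (P ⊓ Q) := fun T v g h t =>
  ⟨hP T v g (fun t => (h t).1) t, hQ T v g (fun t => (h t).2) t⟩

namespace Slice

variable {P Q R : V.Opens}

@[simp]
theorem s_comp_π (S : ρ.Slice P) : S.s ≫ S.π = 𝟙 S.X := S.s_π

theorem isAffine (S : ρ.Slice P) (hP : IsAffineOpen P) : IsAffine S.X :=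
  have : IsAffine P.toScheme := hP
  isAffine_of_retract S.s S.π S.s_π

/-- Points with the same image in the quotient by a slice are in the same orbit, even globally. -/
theorem sameOrbit_of_eq (S : ρ.Slice P) {T : Scheme.{0}} {v w : T ⟶ P.toScheme}
    (h : v ≫ S.π = w ≫ S.π) : ρ.SameOrbit v w := by
  have h1 := S.sameOrbit.precomp v
  have h2 := (S.sameOrbit.precomp w).symm
  rw [Category.comp_id] at h1 h2
  refine h1.trans ?_
  rwa [← Category.assoc, h, Category.assoc]

theorem mem_of_π_eq (S : ρ.Slice P) (hQ : ρ.IsInvariantOpen Q) {x y : P.toScheme}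
    (h : S.π x = S.π y) (hx : P.ι x ∈ Q) : P.ι y ∈ Q := by
  have h1 := hQ.mem S.sameOrbit (t := x) (by simpa using hx)
  rw [Scheme.Hom.comp_apply, h, ← Scheme.Hom.comp_apply] at h1
  have h2 := hQ.mem S.sameOrbit.symm h1
  simpa using h2

theorem homOfLE_π_mem (S : ρ.Slice P) (h : Q ≤ P) (hQ : ρ.IsInvariantOpen Q) (t : Q.toScheme) :
    (V.homOfLE h ≫ S.π) t ∈ (S.s ≫ P.ι) ⁻¹ᵁ Q := by
  change (S.s ≫ P.ι) _ ∈ Q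
  have h2 := hQ.mem S.sameOrbit (t := V.homOfLE h t) (by
    change P.ι (V.homOfLE h t) ∈ Q
    rw [← Scheme.Hom.comp_apply, V.homOfLE_ι]; exact ι_apply_mem t)
  simpa only [Scheme.Hom.comp_apply] using h2

theorem s_mem (S : ρ.Slice P) (Q : V.Opens) (t : ((S.s ≫ P.ι) ⁻¹ᵁ Q).toScheme) :
    (((S.s ≫ P.ι) ⁻¹ᵁ Q).ι ≫ S.s ≫ P.ι) t ∈ Q := by
  rw [Scheme.Hom.comp_apply]; exact ι_apply_mem t

/-- The slice for an invariant open subset `Q` of `P`; its quotient is the open subset of the quotient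
of `P` over which the section `s` has values in `Q`. -/
def restrict (S : ρ.Slice P) (h : Q ≤ P) (hQ : ρ.IsInvariantOpen Q) : ρ.Slice Q where
  X := ((S.s ≫ P.ι) ⁻¹ᵁ Q).toScheme
  π := liftOpen _ (V.homOfLE h ≫ S.π) (S.homOfLE_π_mem h hQ)
  s := liftOpen Q (((S.s ≫ P.ι) ⁻¹ᵁ Q).ι ≫ S.s ≫ P.ι) (S.s_mem Q)
  s_π := by
    rw [← cancel_mono (Scheme.Opens.ι _), Category.assoc, liftOpen_ι]
    have e : liftOpen Q (((S.s ≫ P.ι) ⁻¹ᵁ Q).ι ≫ S.s ≫ P.ι) (S.s_mem Q) ≫ V.homOfLE h =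
        ((S.s ≫ P.ι) ⁻¹ᵁ Q).ι ≫ S.s := by
      rw [← cancel_mono P.ι, Category.assoc, V.homOfLE_ι, liftOpen_ι, Category.assoc]
    rw [reassoc_of% e, S.s_π, Category.comp_id, Category.id_comp]
  sameOrbit := by
    refine (S.sameOrbit.precomp (V.homOfLE h)).of_eq (by simp) ?_
    rw [Category.assoc, Category.assoc, Category.assoc, liftOpen_ι, liftOpen_ι_assoc,
      Category.assoc]
  invariant T v w e := by
    rw [← cancel_mono (Scheme.Opens.ι _), Category.assoc, Category.assoc, liftOpen_ι,
      ← Category.assoc, ← Category.assoc]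
    exact S.invariant _ _ _ (e.of_eq (by simp) (by simp))

/-- The morphism between the quotients induced by an inclusion. -/
def map (S : ρ.Slice P) (S' : ρ.Slice Q) (h : P ≤ Q) : S.X ⟶ S'.X :=
  S.s ≫ V.homOfLE h ≫ S'.π

theorem π_map (S : ρ.Slice P) (S' : ρ.Slice Q) (h : P ≤ Q) :
    S.π ≫ S.map S' h = V.homOfLE h ≫ S'.π := by
  have h1 : ρ.SameOrbit (V.homOfLE h) ((S.π ≫ S.s) ≫ V.homOfLE h) :=
    S.sameOrbit.of_eq (by simp) (by simp)
  rw [S'.invariant _ _ _ h1, map, Category.assoc, Category.assoc]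

theorem map_id (S : ρ.Slice P) (h : P ≤ P) : S.map S h = 𝟙 _ := by
  simp [map]

theorem map_comp (S : ρ.Slice P) (S' : ρ.Slice Q) (S'' : ρ.Slice R) (h : P ≤ Q) (h' : Q ≤ R)
    (h'' : P ≤ R) : S.map S'' h'' = S.map S' h ≫ S'.map S'' h' := by
  rw [map, map, Category.assoc, Category.assoc, π_map, Scheme.homOfLE_homOfLE_assoc]

theorem isOpenImmersion_map (S : ρ.Slice P) (S' : ρ.Slice Q) (h : P ≤ Q)
    (hP : ρ.IsInvariantOpen P) : IsOpenImmersion (S.map S' h) := by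
  -- The image is the quotient of the restriction of the bigger slice.
  let S₀ := S'.restrict h hP
  let a : S.X ⟶ S₀.X := S.s ≫ S₀.π
  let b : S₀.X ⟶ S.X := S₀.s ≫ S.π
  have hab : a ≫ b = 𝟙 _ := by
    have e : ρ.SameOrbit S.s (S.s ≫ S₀.π ≫ S₀.s) := by
      simpa using S₀.sameOrbit.precomp S.s
    have := S.invariant _ _ _ e
    simp only [a, b, Category.assoc]
    simp only [Category.assoc] at this
    rw [← this, S.s_π]
  have hba : b ≫ a = 𝟙 _ := by
    have e : ρ.SameOrbit S₀.s (S₀.s ≫ S.π ≫ S.s) := by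
      simpa using S.sameOrbit.precomp S₀.s
    have := S₀.invariant _ _ _ e
    simp only [a, b, Category.assoc]
    simp only [Category.assoc] at this
    rw [← this, S₀.s_π]
  have : IsIso a := ⟨b, hab, hba⟩
  let j : S₀.X ⟶ S'.X := ((S'.s ≫ Q.ι) ⁻¹ᵁ P).ι
  have : IsOpenImmersion j := inferInstanceAs (IsOpenImmersion ((S'.s ≫ Q.ι) ⁻¹ᵁ P).ι)
  have hj : S₀.π ≫ j = V.homOfLE h ≫ S'.π :=
    liftOpen_ι _ _ (S'.homOfLE_π_mem h hP)
  have e : S.map S' h = a ≫ j := by rw [map, Category.assoc, hj]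
  rw [e]
  infer_instance

end Slice

end RightAction

end Slices

section Slices

variable {𝒢 : GroupFunctor} {V B : Scheme.{0}} {p : V ⟶ B} (ρ : RightAction 𝒢 p) (O : V.Opens)

namespace RightAction

/-- The invariant open subsets of `O` for which there is a slice. They are preordered by inclusion; the
quotient of `O` is the colimit of their quotients. -/
structure SliceOpen where
  U : V.Opens
  le : U ≤ O
  isInvariantOpen : ρ.IsInvariantOpen U
  nonempty_slice : Nonempty (ρ.Slice U)

namespace SliceOpen

instance : Preorder (SliceOpen ρ O) := Preorder.lift SliceOpen.U

variable {ρ O} (P Q R : SliceOpen ρ O)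

theorem U_le {P Q : SliceOpen ρ O} (h : P ≤ Q) : P.U ≤ Q.U := h

/-- A chosen slice; the quotients of two slices for the same open subset are isomorphic. -/
def slice : ρ.Slice P.U := P.nonempty_slice.some

/-- The intersection of two such open subsets. -/
def inf : SliceOpen ρ O where
  U := P.U ⊓ Q.U
  le := inf_le_left.trans P.le
  isInvariantOpen := P.isInvariantOpen.inf Q.isInvariantOpen
  nonempty_slice :=
    ⟨P.slice.restrict inf_le_left (P.isInvariantOpen.inf Q.isInvariantOpen)⟩

theorem inf_le_left' : P.inf Q ≤ P := (inf_le_left : P.U ⊓ Q.U ≤ P.U)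

theorem inf_le_right' : P.inf Q ≤ Q := (inf_le_right : P.U ⊓ Q.U ≤ Q.U)

theorem s_π_apply (x : P.slice.X) : P.slice.π (P.slice.s x) = x := by
  rw [← Scheme.Hom.comp_apply, P.slice.s_π]
  rfl

/-- The morphism between quotients induced by an inclusion. -/
def trans {P Q : SliceOpen ρ O} (h : P ≤ Q) : P.slice.X ⟶ Q.slice.X := P.slice.map Q.slice (U_le h)

theorem π_trans {P Q : SliceOpen ρ O} (h : P ≤ Q) :
    P.slice.π ≫ trans h = V.homOfLE (U_le h) ≫ Q.slice.π := P.slice.π_map Q.slice (U_le h)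

theorem trans_comp {P Q R : SliceOpen ρ O} (h : P ≤ Q) (h' : Q ≤ R) (h'' : P ≤ R) :
    trans h'' = trans h ≫ trans h' :=
  P.slice.map_comp Q.slice R.slice _ _ _

instance {P Q : SliceOpen ρ O} (h : P ≤ Q) : IsOpenImmersion (trans h) :=
  P.slice.isOpenImmersion_map Q.slice (U_le h) P.isInvariantOpen

variable (ρ O) in
/-- The diagram of the quotients of these open subsets. -/
def diagram : SliceOpen ρ O ⥤ Scheme.{0} where
  obj P := P.slice.X
  map f := trans (leOfHom f)
  map_id P := P.slice.map_id _
  map_comp f g := trans_comp (leOfHom f) (leOfHom g) _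

instance {P Q : SliceOpen ρ O} (f : P ⟶ Q) : IsOpenImmersion ((diagram ρ O).map f) :=
  inferInstanceAs (IsOpenImmersion (trans (leOfHom f)))

/-- An open subset contains the points of a bigger one whose image comes from its quotient. -/
theorem mem_of_trans_eq {P R : SliceOpen ρ O} (h : R ≤ P) (z : R.slice.X) (y : P.U.toScheme)
    (e : trans h z = P.slice.π y) : P.U.ι y ∈ R.U := by
  obtain ⟨z, rfl⟩ : ∃ z', R.slice.π z' = z := ⟨R.slice.s z, R.s_π_apply z⟩
  rw [← Scheme.Hom.comp_apply, π_trans, Scheme.Hom.comp_apply] at e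
  refine P.slice.mem_of_π_eq R.isInvariantOpen e ?_
  rw [← Scheme.Hom.comp_apply, V.homOfLE_ι]
  exact ι_apply_mem z

theorem exists_of_trans_eq {P Q R : SliceOpen ρ O} (hP : P ≤ R) (hQ : Q ≤ R) (x : P.slice.X)
    (y : Q.slice.X) (h : trans hP x = trans hQ y) :
    ∃ z : (P.inf Q).slice.X, trans (P.inf_le_left' Q) z = x ∧ trans (P.inf_le_right' Q) z = y := by
  obtain ⟨x, rfl⟩ : ∃ x', P.slice.π x' = x := ⟨P.slice.s x, P.s_π_apply x⟩
  have hx : P.U.ι x ∈ Q.U := by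
    have h1 : trans hQ y = R.slice.π (V.homOfLE (U_le hP) x) := by
      rw [← h, ← Scheme.Hom.comp_apply, π_trans, Scheme.Hom.comp_apply]
    have := mem_of_trans_eq hQ y _ h1
    rwa [← Scheme.Hom.comp_apply, V.homOfLE_ι] at this
  obtain ⟨z, hz⟩ := exists_ι_apply (W := (P.inf Q).U) ⟨ι_apply_mem x, hx⟩
  have hzx : V.homOfLE (U_le (P.inf_le_left' Q)) z = x := by
    apply P.U.ι.isOpenEmbedding.injective
    rw [← Scheme.Hom.comp_apply, V.homOfLE_ι, hz]
  have h1 : trans (P.inf_le_left' Q) ((P.inf Q).slice.π z) = P.slice.π x := by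
    rw [← Scheme.Hom.comp_apply, π_trans, Scheme.Hom.comp_apply, hzx]
  refine ⟨(P.inf Q).slice.π z, h1, (trans hQ).isOpenEmbedding.injective ?_⟩
  rw [← h, ← h1, ← Scheme.Hom.comp_apply (trans (P.inf_le_left' Q)),
    ← Scheme.Hom.comp_apply (trans (P.inf_le_right' Q)),
    ← trans_comp _ _ ((P.inf_le_left' Q).trans hP), ← trans_comp]

/-- Locally directed diagrams of open immersions have colimits that are unions of their members, and
this one is locally directed because intersections of slice opens are slice opens. -/
instance : (diagram ρ O ⋙ Scheme.forget).IsLocallyDirected where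
  cond {P Q R} fP fQ x y h := by
    obtain ⟨z, h1, h2⟩ := exists_of_trans_eq (leOfHom fP) (leOfHom fQ) x y h
    exact ⟨P.inf Q, homOfLE (P.inf_le_left' Q), homOfLE (P.inf_le_right' Q), z, h1, h2⟩

variable (ρ O) in
/-- The scheme glued from the quotients. -/
def glued : Scheme.{0} := Limits.colimit (diagram ρ O)

/-- The inclusion of the quotient of an open subset. -/
def incl : P.slice.X ⟶ glued ρ O := Limits.colimit.ι (diagram ρ O) P

instance : IsOpenImmersion P.incl :=
  inferInstanceAs (IsOpenImmersion (Limits.colimit.ι (diagram ρ O) P))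

theorem trans_incl {P Q : SliceOpen ρ O} (h : P ≤ Q) : trans h ≫ Q.incl = P.incl :=
  Limits.colimit.w (diagram ρ O) (homOfLE h)

theorem exists_of_incl_eq {P Q : SliceOpen ρ O} {x : P.slice.X} {y : Q.slice.X}
    (h : P.incl x = Q.incl y) : ∃ (R : SliceOpen ρ O) (hP : R ≤ P) (hQ : R ≤ Q) (z : R.slice.X),
      trans hP z = x ∧ trans hQ z = y := by
  obtain ⟨R, fP, fQ, z, h1, h2⟩ := (Scheme.IsLocallyDirected.ι_eq_ι_iff (diagram ρ O)).mp h
  exact ⟨R, leOfHom fP, leOfHom fQ, z, h1, h2⟩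

theorem exists_incl_eq (x : glued ρ O) : ∃ (P : SliceOpen ρ O) (y : P.slice.X), P.incl y = x :=
  Scheme.IsLocallyDirected.ι_jointly_surjective (diagram ρ O) x

theorem homOfLE_π_incl {P Q : SliceOpen ρ O} (h : P ≤ Q) :
    V.homOfLE (U_le h) ≫ Q.slice.π ≫ Q.incl = P.slice.π ≫ P.incl := by
  rw [← trans_incl h, ← Category.assoc, ← π_trans h, Category.assoc]

theorem π_incl_eq {T : Scheme.{0}} (a : T ⟶ P.U.toScheme) (b : T ⟶ Q.U.toScheme)
    (e : a ≫ P.U.ι = b ≫ Q.U.ι) : a ≫ P.slice.π ≫ P.incl = b ≫ Q.slice.π ≫ Q.incl := by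
  let c : T ⟶ (P.inf Q).U.toScheme := liftOpen _ (a ≫ P.U.ι) fun t => by
    refine ⟨?_, ?_⟩
    · rw [Scheme.Hom.comp_apply]; exact ι_apply_mem _
    · rw [e, Scheme.Hom.comp_apply]; exact ι_apply_mem _
  have hc : c ≫ (P.inf Q).U.ι = a ≫ P.U.ι := liftOpen_ι _ _ _
  have ha : c ≫ V.homOfLE (U_le (P.inf_le_left' Q)) = a := by
    rw [← cancel_mono P.U.ι, Category.assoc, V.homOfLE_ι, hc]
  have hb : c ≫ V.homOfLE (U_le (P.inf_le_right' Q)) = b := by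
    rw [← cancel_mono Q.U.ι, Category.assoc, V.homOfLE_ι, hc, e]
  rw [← ha, ← hb, Category.assoc, Category.assoc, homOfLE_π_incl (P.inf_le_left' Q),
    homOfLE_π_incl (P.inf_le_right' Q)]

theorem ι_ι_mem (t : (O.ι ⁻¹ᵁ P.U).toScheme) : ((O.ι ⁻¹ᵁ P.U).ι ≫ O.ι) t ∈ P.U := by
  rw [Scheme.Hom.comp_apply]
  exact ι_apply_mem t

theorem homOfLE_mem (t : P.U.toScheme) : V.homOfLE P.le t ∈ O.ι ⁻¹ᵁ P.U := by
  change O.ι _ ∈ P.U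
  rw [← Scheme.Hom.comp_apply, V.homOfLE_ι]
  exact ι_apply_mem t

/-- The morphism from `P` as an open subscheme of `O` to `P` as an open subscheme of `V`. -/
def fromPreimage : (O.ι ⁻¹ᵁ P.U).toScheme ⟶ P.U.toScheme :=
  liftOpen _ ((O.ι ⁻¹ᵁ P.U).ι ≫ O.ι) P.ι_ι_mem

theorem fromPreimage_ι : P.fromPreimage ≫ P.U.ι = (O.ι ⁻¹ᵁ P.U).ι ≫ O.ι := liftOpen_ι _ _ _

/-- The morphism from `P` as an open subscheme of `V` to `P` as an open subscheme of `O`. -/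
def toPreimage : P.U.toScheme ⟶ (O.ι ⁻¹ᵁ P.U).toScheme :=
  liftOpen _ (V.homOfLE P.le) P.homOfLE_mem

theorem toPreimage_ι : P.toPreimage ≫ (O.ι ⁻¹ᵁ P.U).ι = V.homOfLE P.le := liftOpen_ι _ _ _

theorem toPreimage_fromPreimage : P.toPreimage ≫ P.fromPreimage = 𝟙 _ := by
  rw [← cancel_mono P.U.ι, Category.assoc, fromPreimage_ι, ← Category.assoc, toPreimage_ι,
    V.homOfLE_ι, Category.id_comp]

/-- The quotient morphisms of the slices glue. -/
theorem exists_quotient (hO : ∀ x ∈ O, ∃ P : SliceOpen ρ O, x ∈ P.U) :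
    ∃ π : O.toScheme ⟶ glued ρ O,
      ∀ P : SliceOpen ρ O, V.homOfLE P.le ≫ π = P.slice.π ≫ P.incl := by
  have hcov : ∀ x : O.toScheme, ∃ P : SliceOpen ρ O, x ∈ O.ι ⁻¹ᵁ P.U := fun x =>
    hO (O.ι x) (ι_apply_mem x)
  have key : ∀ (P Q : SliceOpen ρ O) (T : Scheme.{0}) (a : T ⟶ (O.ι ⁻¹ᵁ P.U).toScheme)
      (b : T ⟶ (O.ι ⁻¹ᵁ Q.U).toScheme), a ≫ (O.ι ⁻¹ᵁ P.U).ι = b ≫ (O.ι ⁻¹ᵁ Q.U).ι →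
      a ≫ P.fromPreimage ≫ P.slice.π ≫ P.incl = b ≫ Q.fromPreimage ≫ Q.slice.π ≫ Q.incl := by
    intro P Q T a b e
    have h : (a ≫ P.fromPreimage) ≫ P.U.ι = (b ≫ Q.fromPreimage) ≫ Q.U.ι := by
      rw [Category.assoc, Category.assoc, fromPreimage_ι, fromPreimage_ι, ← Category.assoc, e,
        Category.assoc]
    have h' := π_incl_eq P Q (a ≫ P.fromPreimage) (b ≫ Q.fromPreimage) h
    rwa [Category.assoc, Category.assoc] at h'
  obtain ⟨π, hπ⟩ := exists_glue (fun P : SliceOpen ρ O => O.ι ⁻¹ᵁ P.U) hcov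
    (fun P => P.fromPreimage ≫ P.slice.π ≫ P.incl) key
  refine ⟨π, fun P => ?_⟩
  have h : P.toPreimage ≫ (O.ι ⁻¹ᵁ P.U).ι ≫ π =
      P.toPreimage ≫ P.fromPreimage ≫ P.slice.π ≫ P.incl := by rw [hπ P]
  rwa [← Category.assoc, toPreimage_ι, ← Category.assoc, toPreimage_fromPreimage,
    Category.id_comp] at h

section Quotient

variable {π : O.toScheme ⟶ glued ρ O}

theorem comp_π (hπ : ∀ P : SliceOpen ρ O, V.homOfLE P.le ≫ π = P.slice.π ≫ P.incl)
    {T : Scheme.{0}} (v : T ⟶ O.toScheme) (w : T ⟶ P.U.toScheme)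
    (h : w ≫ P.U.ι = v ≫ O.ι) : v ≫ π = w ≫ P.slice.π ≫ P.incl := by
  have : w ≫ V.homOfLE P.le = v := by
    rw [← cancel_mono O.ι, Category.assoc, V.homOfLE_ι, h]
  rw [← this, Category.assoc, hπ]

/-- Two points with the same image lie in a common member of the diagram. -/
theorem exists_mem_of_eq (hO : ∀ x ∈ O, ∃ P : SliceOpen ρ O, x ∈ P.U)
    (hπ : ∀ P : SliceOpen ρ O, V.homOfLE P.le ≫ π = P.slice.π ≫ P.incl)
    {x y : O.toScheme} (h : π x = π y) :
    ∃ P : SliceOpen ρ O, O.ι x ∈ P.U ∧ O.ι y ∈ P.U := by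
  obtain ⟨P, hP⟩ := hO _ (ι_apply_mem x)
  obtain ⟨Q, hQ⟩ := hO _ (ι_apply_mem y)
  obtain ⟨x', hx'⟩ := exists_ι_apply hP
  obtain ⟨y', hy'⟩ := exists_ι_apply hQ
  have hx : V.homOfLE P.le x' = x := by
    apply O.ι.isOpenEmbedding.injective
    rw [← Scheme.Hom.comp_apply, V.homOfLE_ι, hx']
  have hy : V.homOfLE Q.le y' = y := by
    apply O.ι.isOpenEmbedding.injective
    rw [← Scheme.Hom.comp_apply, V.homOfLE_ι, hy']
  rw [← hx, ← hy, ← Scheme.Hom.comp_apply, ← Scheme.Hom.comp_apply, hπ, hπ, Scheme.Hom.comp_apply,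
    Scheme.Hom.comp_apply] at h
  obtain ⟨R, hRP, hRQ, z, h1, h2⟩ := exists_of_incl_eq h
  refine ⟨R, ?_, ?_⟩
  · rw [← hx']; exact mem_of_trans_eq hRP z x' h1
  · rw [← hy']; exact mem_of_trans_eq hRQ z y' h2

theorem isPrincipalQuotient (hO : ∀ x ∈ O, ∃ P : SliceOpen ρ O, x ∈ P.U)
    (hπ : ∀ P : SliceOpen ρ O, V.homOfLE P.le ≫ π = P.slice.π ≫ P.incl) :
    ρ.IsPrincipalQuotient π where
  invariant T v w e := by
    refine Scheme.hom_ext_of_forall _ _ fun t => ?_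
    obtain ⟨P, hP⟩ := hO _ (ι_apply_mem (v t))
    let W : T.Opens := v ⁻¹ᵁ (O.ι ⁻¹ᵁ P.U)
    have hv : ∀ t, ((W.ι ≫ v) ≫ O.ι) t ∈ P.U := fun t => by
      rw [Scheme.Hom.comp_apply, Scheme.Hom.comp_apply]; exact ι_apply_mem t
    have hw : ∀ t, ((W.ι ≫ w) ≫ O.ι) t ∈ P.U := fun t => by
      rw [Scheme.Hom.comp_apply]
      refine P.isInvariantOpen.mem (e.precomp W.ι) ?_
      rw [← Scheme.Hom.comp_apply]
      exact hv t
    refine ⟨W, hP, ?_⟩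
    rw [← Category.assoc, ← Category.assoc, P.comp_π hπ (W.ι ≫ v) (liftOpen _ _ hv)
      (liftOpen_ι _ _ _), P.comp_π hπ (W.ι ≫ w) (liftOpen _ _ hw) (liftOpen_ι _ _ _),
      ← Category.assoc, ← Category.assoc]
    congr 1
    exact P.slice.invariant _ _ _ ((e.precomp W.ι).of_eq (liftOpen_ι _ _ _).symm
      (liftOpen_ι _ _ _).symm)
  exists_section x := by
    obtain ⟨P, y, rfl⟩ := exists_incl_eq x
    refine ⟨P.incl.opensRange, P.incl.isoOpensRange.inv ≫ P.slice.s ≫ V.homOfLE P.le, ⟨y, rfl⟩, ?_⟩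
    rw [Category.assoc, Category.assoc, hπ, reassoc_of% P.slice.s_π,
      Scheme.Hom.isoOpensRange_inv_comp]
  sameOrbit T v w e t := by
    obtain ⟨P, hvP, hwP⟩ := exists_mem_of_eq hO hπ (x := v t) (y := w t) (by
      rw [← Scheme.Hom.comp_apply, e, Scheme.Hom.comp_apply])
    let W : T.Opens := v ⁻¹ᵁ (O.ι ⁻¹ᵁ P.U) ⊓ w ⁻¹ᵁ (O.ι ⁻¹ᵁ P.U)
    have hv : ∀ t, ((W.ι ≫ v) ≫ O.ι) t ∈ P.U := fun t => by
      rw [Scheme.Hom.comp_apply, Scheme.Hom.comp_apply]; exact (ι_apply_mem t).1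
    have hw : ∀ t, ((W.ι ≫ w) ≫ O.ι) t ∈ P.U := fun t => by
      rw [Scheme.Hom.comp_apply, Scheme.Hom.comp_apply]; exact (ι_apply_mem t).2
    refine ⟨W, ⟨hvP, hwP⟩, ?_⟩
    have h1 : (W.ι ≫ v) ≫ π = (W.ι ≫ w) ≫ π := by rw [Category.assoc, e, Category.assoc]
    rw [P.comp_π hπ (W.ι ≫ v) (liftOpen _ _ hv) (liftOpen_ι _ _ _),
      P.comp_π hπ (W.ι ≫ w) (liftOpen _ _ hw) (liftOpen_ι _ _ _),
      ← Category.assoc, ← Category.assoc, cancel_mono] at h1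
    exact (P.slice.sameOrbit_of_eq h1).of_eq (liftOpen_ι _ _ _) (liftOpen_ι _ _ _)

/-- The quotient of `P` is an open subset of the glued scheme with preimage `P`; this makes the
quotient morphism affine. -/
theorem preimage_opensRange (hO : ∀ x ∈ O, ∃ P : SliceOpen ρ O, x ∈ P.U)
    (hπ : ∀ P : SliceOpen ρ O, V.homOfLE P.le ≫ π = P.slice.π ≫ P.incl) :
    π ⁻¹ᵁ P.incl.opensRange = O.ι ⁻¹ᵁ P.U := by
  ext x
  constructor
  · rintro ⟨y, hy⟩
    have h1 : π x = π (V.homOfLE P.le (P.slice.s y)) := by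
      rw [← hy, ← Scheme.Hom.comp_apply, hπ, ← Scheme.Hom.comp_apply, reassoc_of% P.slice.s_π]
    have hp : O.ι (V.homOfLE P.le (P.slice.s y)) ∈ P.U := by
      rw [← Scheme.Hom.comp_apply, V.homOfLE_ι]
      exact ι_apply_mem _
    have hP := (isPrincipalQuotient hO hπ)
    obtain ⟨W, s, hW, hs⟩ := hP.exists_section (π x)
    obtain ⟨z, hz⟩ := exists_ι_apply hW
    have hI : ρ.IsInvariantSet {x : O.toScheme | O.ι x ∈ P.U} := fun T v w e t =>
      ⟨fun h => P.isInvariantOpen.mem e h, fun h => P.isInvariantOpen.mem e.symm h⟩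
    exact (hP.mem_iff_section_mem hI hs hz.symm).mpr
      ((hP.mem_iff_section_mem hI hs (h1.symm.trans hz.symm)).mp hp)
  · intro hx
    obtain ⟨y, hy⟩ := exists_ι_apply (show O.ι x ∈ P.U from hx)
    have : V.homOfLE P.le y = x := by
      apply O.ι.isOpenEmbedding.injective
      rw [← Scheme.Hom.comp_apply, V.homOfLE_ι, hy]
    refine ⟨P.slice.π y, ?_⟩
    rw [← this, ← Scheme.Hom.comp_apply, ← Scheme.Hom.comp_apply, hπ]

end Quotient

end SliceOpen

/-- An open subset covered by invariant affine open subsets with slices has an affine principal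
quotient. -/
theorem exists_isPrincipalQuotient {ρ : RightAction 𝒢 p} {O : V.Opens}
    (h : ∀ x ∈ O, ∃ P : V.Opens, x ∈ P ∧ P ≤ O ∧ IsAffineOpen P ∧ ρ.IsInvariantOpen P ∧
      Nonempty (ρ.Slice P)) :
    ∃ (X : Scheme.{0}) (π : O.toScheme ⟶ X), IsAffineHom π ∧ ρ.IsPrincipalQuotient π := by
  have hO : ∀ x ∈ O, ∃ P : SliceOpen ρ O, x ∈ P.U := by
    intro x hx
    obtain ⟨P, hxP, h1, -, h2⟩ := h x hx
    exact ⟨⟨P, h1, h2.1, h2.2⟩, hxP⟩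
  obtain ⟨π, hπ⟩ := SliceOpen.exists_quotient hO
  have hpr := SliceOpen.isPrincipalQuotient hO hπ
  refine ⟨_, π, isAffineHom_of_forall_exists_isAffineOpen _ fun x => ?_, hpr⟩
  obtain ⟨z, rfl⟩ := hpr.surjective.surj x
  obtain ⟨P, hxP, h1, hP, h2⟩ := h _ (ι_apply_mem z)
  let Q : SliceOpen ρ O := ⟨P, h1, h2.1, h2.2⟩
  have hQ : π ⁻¹ᵁ Q.incl.opensRange = O.ι ⁻¹ᵁ P := Q.preimage_opensRange hO hπ
  have : IsAffine Q.slice.X := Q.slice.isAffine hP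
  refine ⟨Q.incl.opensRange, ?_, isAffineOpen_opensRange _, ?_⟩
  · change z ∈ π ⁻¹ᵁ Q.incl.opensRange
    rw [hQ]
    exact hxP
  · rw [hQ]
    exact hP.preimage_of_isOpenImmersion O.ι (by simpa using h1)

end RightAction

end Slices

/-! ### Charts given by semi-invariant functions -/

theorem isUnit_appLE_of_mem_basicOpen {X T : Scheme.{0}} {O : X.Opens} {d : Γ(X, O)} {v : T ⟶ X}
    (hv : ⊤ ≤ v ⁻¹ᵁ O) (h : ∀ t, v t ∈ X.basicOpen d) : IsUnit (v.appLE O ⊤ hv d) := by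
  let u := liftOpen _ v h
  have hu : u ≫ (X.basicOpen d).ι = v := liftOpen_ι _ _ _
  have h1 : ⊤ ≤ (u ≫ (X.basicOpen d).ι) ⁻¹ᵁ O := by rw [hu]; exact hv
  have hle := X.basicOpen_le d
  have h2 : IsUnit (X.presheaf.map (homOfLE hle).op d) := X.toRingedSpace.isUnit_res_basicOpen d
  have h3 := (h2.map ((X.basicOpen d).ι.appLE _ ⊤ (top_le_ι_preimage le_rfl)).hom).map
    u.appTop.hom
  have h4 : u.appTop ((X.basicOpen d).ι.appLE _ ⊤ (top_le_ι_preimage le_rfl)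
      (X.presheaf.map (homOfLE hle).op d)) = v.appLE O ⊤ hv d := by
    rw [map_appLE_apply, appTop_appLE_apply _ _ _ _ h1]
    exact LocalModel.appLE_congr_apply hu _ _ _ _ _
  rw [← h4]
  exact h3

theorem mem_basicOpen_of_isUnit_appLE {X T : Scheme.{0}} {O : X.Opens} {d : Γ(X, O)} {v : T ⟶ X}
    {hv : ⊤ ≤ v ⁻¹ᵁ O} (h : IsUnit (v.appLE O ⊤ hv d)) (t : T) : v t ∈ X.basicOpen d := by
  have h1 : t ∈ T.basicOpen (v.appLE O ⊤ hv d) := by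
    rw [T.basicOpen_of_isUnit h]; trivial
  rw [Scheme.Hom.appLE, CommRingCat.comp_apply, Scheme.basicOpen_res] at h1
  have h2 : t ∈ v ⁻¹ᵁ X.basicOpen d := by
    rw [Scheme.preimage_basicOpen]; exact h1.2
  exact h2

section Charts

variable {𝒢 : GroupFunctor} {V B : Scheme.{0}} {p : V ⟶ B} {ρ : RightAction 𝒢 p}

namespace RightAction

/-- An equivariant morphism from an invariant open subset to the group gives a slice: the slice is
its fibre over the unit. -/
theorem nonempty_slice_of_equivariant {P : V.Opens} (hP : ρ.IsInvariantOpen P)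
    (γ : 𝒢.obj (op P.toScheme))
    (hγ : ∀ (T : Scheme.{0}) (v w : T ⟶ P.toScheme) (g : 𝒢.obj (op T)),
      ρ.act (v ≫ P.ι) g = w ≫ P.ι → 𝒢.map w.op γ = 𝒢.map v.op γ * g) : Nonempty (ρ.Slice P) := by
  -- The idempotent `v ↦ v · γ(v)⁻¹` retracts `P` onto the slice, and idempotents split.
  let e : P.toScheme ⟶ P.toScheme := liftOpen P (ρ.act P.ι γ⁻¹)
    (hP _ _ _ fun t => ι_apply_mem t)
  have he : e ≫ P.ι = ρ.act P.ι γ⁻¹ := liftOpen_ι _ _ _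
  have he' : ρ.SameOrbit (𝟙 _) e := ⟨γ⁻¹, by rw [Category.id_comp, he]⟩
  have inv : ∀ (T : Scheme.{0}) (v w : T ⟶ P.toScheme), ρ.SameOrbit v w → v ≫ e = w ≫ e := by
    rintro T v w ⟨g, hg⟩
    rw [← cancel_mono P.ι, Category.assoc, Category.assoc, he, ρ.comp_act, ρ.comp_act, ← hg,
      ← ρ.act_mul, map_inv, map_inv, hγ T v w g hg, mul_inv_rev, mul_inv_cancel_left]
  have hee : e ≫ e = e := by
    have := inv _ _ _ he'
    rwa [Category.id_comp, eq_comm] at this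
  obtain ⟨X, i, q, h1, h2⟩ := (Idempotents.isIdempotentComplete_iff_hasEqualizer_of_id_and_idempotent
    Scheme.{0}).mpr (fun _ _ _ => inferInstance) |>.idempotents_split P.toScheme e hee
  refine ⟨⟨X, q, i, h1, by rwa [h2], fun T v w h => ?_⟩⟩
  have : Mono i := mono_of_mono_fac h1
  rw [← cancel_mono i, Category.assoc, Category.assoc, h2]
  exact inv T v w h

variable (ρ) in
/-- A function `d` over an affine open subset of the base that is semi-invariant of weight `θ` and
whose non-vanishing locus is affine and has a slice. -/
structure IsChart (θ : 𝒢 ⟶ Gm) {W : B.Opens} (d : Γ(V, p ⁻¹ᵁ W)) : Prop where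
  isAffineOpen_base : IsAffineOpen W
  isAffineOpen : IsAffineOpen (p ⁻¹ᵁ W)
  isSemiInvariant : ρ.IsSemiInvariant θ 1 d
  nonempty_slice : Nonempty (ρ.Slice (V.basicOpen d))

theorem isUnit_charValue (θ : 𝒢 ⟶ Gm) {T : Scheme.{0}} (g : 𝒢.obj (op T)) :
    IsUnit (charValue θ g) := Units.isUnit _

theorem IsSemiInvariant.isInvariantOpen {θ : 𝒢 ⟶ Gm} {k : ℕ} {W : B.Opens} {d : Γ(V, p ⁻¹ᵁ W)}
    (hd : ρ.IsSemiInvariant θ k d) : ρ.IsInvariantOpen (V.basicOpen d) := by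
  intro T v g hv
  have h1 : ⊤ ≤ v ⁻¹ᵁ (p ⁻¹ᵁ W) := fun t _ => V.basicOpen_le d (hv t)
  have h2 : ⊤ ≤ ρ.act v g ⁻¹ᵁ (p ⁻¹ᵁ W) := by
    change ⊤ ≤ (ρ.act v g ≫ p) ⁻¹ᵁ W
    rw [ρ.act_toBase]
    exact h1
  apply mem_basicOpen_of_isUnit_appLE (hv := h2)
  rw [hd T v g h1 h2]
  exact ((isUnit_charValue θ g).pow k).mul (isUnit_appLE_of_mem_basicOpen h1 hv)

theorem IsChart.le_semistableLocus {θ : 𝒢 ⟶ Gm} {W : B.Opens} {d : Γ(V, p ⁻¹ᵁ W)}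
    (h : ρ.IsChart θ d) : V.basicOpen d ≤ ρ.semistableLocus θ :=
  le_sSup ⟨W, h.isAffineOpen_base, 1, one_pos, d, h.isSemiInvariant, rfl⟩

/-- If charts cover the semistable locus, then there is a GIT quotient, and it is principal. -/
theorem exists_gitQuotient {θ : 𝒢 ⟶ Gm}
    (h : ∀ y ∈ ρ.semistableLocus θ, ∃ (W : B.Opens) (d : Γ(V, p ⁻¹ᵁ W)), ρ.IsChart θ d ∧
      y ∈ V.basicOpen d) :
    ∃ Q : GITQuotient ρ θ, ρ.IsPrincipalQuotient Q.π := by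
  obtain ⟨X, π, ha, hπ⟩ := exists_isPrincipalQuotient (ρ := ρ) (O := ρ.semistableLocus θ) (by
    intro y hy
    obtain ⟨W, d, hd, hyd⟩ := h y hy
    exact ⟨_, hyd, hd.le_semistableLocus, hd.isAffineOpen.basicOpen d,
      hd.isSemiInvariant.isInvariantOpen, hd.nonempty_slice⟩)
  exact ⟨⟨X, π, hπ.isGoodQuotient ha⟩, hπ⟩

/-- A semi-invariant function of positive weight vanishes at a `T`-point `y` if the translate of `y`
by an element of the group over `𝔾ₘ × T` with character the inverse of the coordinate extends over
`𝔸¹ × T`. Here `i : A' ⟶ A` stands for `𝔾ₘ × T ⟶ 𝔸¹ × T`, and `o` for the zero section. -/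
theorem IsSemiInvariant.appLE_eq_zero {θ : 𝒢 ⟶ Gm} {k : ℕ} (hk : 0 < k) {W : B.Opens}
    {f : Γ(V, p ⁻¹ᵁ W)} (hf : ρ.IsSemiInvariant θ k f) {T A A' : Scheme.{0}} {c : A ⟶ T} {o : T ⟶ A}
    {i : A' ⟶ A} (hi : Function.Injective i.appTop) (hoc : o ≫ c = 𝟙 T) {S : Γ(A, ⊤)}
    (hS : o.appTop S = 0) (y : T ⟶ V) (z : A ⟶ V) (hz : z ≫ p = c ≫ y ≫ p) (g : 𝒢.obj (op A'))
    (hg : i ≫ z = ρ.act (i ≫ c ≫ y) g) (hθ : charValue θ g * i.appTop S = 1)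
    (hy : ⊤ ≤ y ⁻¹ᵁ (p ⁻¹ᵁ W)) : y.appLE (p ⁻¹ᵁ W) ⊤ hy f = 0 := by
  have hcy : ⊤ ≤ (c ≫ y) ⁻¹ᵁ (p ⁻¹ᵁ W) := top_le_comp_preimage hy c
  have hzW : ⊤ ≤ z ⁻¹ᵁ (p ⁻¹ᵁ W) := by
    change ⊤ ≤ (z ≫ p) ⁻¹ᵁ W
    rw [hz]
    exact hcy
  have h1 : ⊤ ≤ (i ≫ z) ⁻¹ᵁ (p ⁻¹ᵁ W) := top_le_comp_preimage hzW i
  have h2 : ⊤ ≤ ρ.act (i ≫ c ≫ y) g ⁻¹ᵁ (p ⁻¹ᵁ W) := hg ▸ h1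
  have h3 : ⊤ ≤ (i ≫ c ≫ y) ⁻¹ᵁ (p ⁻¹ᵁ W) := top_le_comp_preimage hcy i
  -- On `𝔾ₘ × T`, the value of `f` at `z` is `S⁻ᵏ` times its value at `y`; cleared of denominators,
  -- this holds on `𝔸¹ × T`, and it can be evaluated at `S = 0`.
  have e1 := hf _ _ g h3 h2
  rw [← LocalModel.appLE_congr_apply hg _ _ h1 h2,
    ← appTop_appLE_apply i z _ hzW, ← appTop_appLE_apply i (c ≫ y) _ hcy] at e1
  have e2 : S ^ k * z.appLE (p ⁻¹ᵁ W) ⊤ hzW f = (c ≫ y).appLE (p ⁻¹ᵁ W) ⊤ hcy f := by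
    apply hi
    rw [map_mul, e1, map_pow, ← mul_assoc, ← mul_pow, mul_comm (i.appTop S), hθ, one_pow, one_mul]
  have e4 := congrArg o.appTop e2
  rw [map_mul, map_pow, hS, zero_pow hk.ne', zero_mul] at e4
  have h5 : ⊤ ≤ (o ≫ c ≫ y) ⁻¹ᵁ (p ⁻¹ᵁ W) := top_le_comp_preimage hcy o
  have e5 := appTop_appLE_apply o (c ≫ y) _ hcy h5 f
  rw [e5] at e4
  rw [e4]
  exact LocalModel.appLE_congr_apply (by rw [reassoc_of% hoc]) _ _ _ _ _

end RightAction

end Charts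

/-! ### Coordinates on total spaces -/

section Coordinates

variable {B : Scheme.{0}} {ι : Type} {U : ι → B.Opens}

/-- The coordinate of a section with respect to a local frame that is defined everywhere. -/
def Sec.coord {K : LineCocycle U} {T : Scheme.{0}} {q : T ⟶ B} (x : Sec K q) (i : ι)
    (h : ⊤ ≤ q ⁻¹ᵁ U i) : Γ(T, ⊤) :=
  T.presheaf.map (homOfLE h).op (x.1 i)

namespace Sec

variable {K K' K'' : LineCocycle U} {T : Scheme.{0}} {q : T ⟶ B} {i : ι}

theorem map_top (c : Γ(T, ⊤)) : T.presheaf.map (homOfLE (le_refl (⊤ : T.Opens))).op c = c :=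
  ConcreteCategory.congr_hom (T.presheaf.map_id _) c

theorem coord_sum {J : Type} (s : Finset J) (x : J → Sec K q) (h : ⊤ ≤ q ⁻¹ᵁ U i) :
    coord (∑ j ∈ s, x j) i h = ∑ j ∈ s, coord (x j) i h := by
  rw [coord, val_sum]
  exact map_sum _ _ _

theorem coord_smul (c : Γ(T, ⊤)) (x : Sec K q) (h : ⊤ ≤ q ⁻¹ᵁ U i) :
    coord (smul c x) i h = c * coord x i h := by
  rw [coord, smul_val, map_mul, map_map_fun, map_top]
  rfl

theorem coord_mulVec {r : ℕ} (P : Matrix (Fin r) (Fin r) Γ(T, ⊤)) (x : Fin r → Sec K q)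
    (h : ⊤ ≤ q ⁻¹ᵁ U i) (a : Fin r) :
    coord (mulVec P x a) i h = ∑ b, P a b * coord (x b) i h := by
  rw [mulVec, coord_sum]
  simp only [coord_smul]

theorem coord_vecMul {r : ℕ} (P : Matrix (Fin r) (Fin r) Γ(T, ⊤)) (x : Fin r → Sec K q)
    (h : ⊤ ≤ q ⁻¹ᵁ U i) (a : Fin r) :
    coord (vecMul x P a) i h = ∑ b, coord (x b) i h * P b a := by
  rw [vecMul_eq, coord_mulVec]
  exact Finset.sum_congr rfl fun _ _ => mul_comm _ _

end Sec

variable {A : Type} {K : A → LineCocycle U} {hU : ⨆ i, U i = ⊤} {T T' : Scheme.{0}}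

/-- The coordinates of a `T`-point of a total space with respect to a local frame. -/
def coord (v : T ⟶ totalSpace K hU) (i : ι) (h : ⊤ ≤ (v ≫ toBase K hU) ⁻¹ᵁ U i) (a : A) :
    Γ(T, ⊤) :=
  Sec.coord ((homEquiv K hU T v).2 a) i h

theorem coord_eq_appLE (v : T ⟶ totalSpace K hU) (i : ι) (h : ⊤ ≤ (v ≫ toBase K hU) ⁻¹ᵁ U i)
    (a : A) : coord v i h a = v.appLE (toBase K hU ⁻¹ᵁ U i) ⊤ h (((tautPoint K hU).2 a).1 i) :=
  Sec.map_pull _ _ _ _ _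

theorem coord_comp (u : T' ⟶ T) (v : T ⟶ totalSpace K hU) (i : ι)
    (h : ⊤ ≤ (v ≫ toBase K hU) ⁻¹ᵁ U i) (h' : ⊤ ≤ ((u ≫ v) ≫ toBase K hU) ⁻¹ᵁ U i) (a : A) :
    coord (u ≫ v) i h' a = u.appTop (coord v i h a) := by
  rw [coord_eq_appLE, coord_eq_appLE]
  exact (appTop_appLE_apply u v _ _ _ _).symm

theorem coord_of_homEquiv {v : T ⟶ totalSpace K hU} {q : T ⟶ B} {x : ∀ a, Sec (K a) q}
    (e : homEquiv K hU T v = ⟨q, x⟩) (i : ι) (h : ⊤ ≤ (v ≫ toBase K hU) ⁻¹ᵁ U i)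
    (h' : ⊤ ≤ q ⁻¹ᵁ U i) (a : A) : coord v i h a = Sec.coord (x a) i h' :=
  LocalModel.point_eq K e a i ⊤ h h'

/-- A point of a total space with prescribed image in the base and prescribed coordinates. -/
theorem exists_coord (q : T ⟶ B) (i : ι) (h : ⊤ ≤ q ⁻¹ᵁ U i) (x : A → Γ(T, ⊤)) :
    ∃ (v : T ⟶ totalSpace K hU) (e : v ≫ toBase K hU = q), coord v i (e ▸ h) = x := by
  let k : LocalModel.Ix U := ⟨i, U i, le_rfl⟩
  let b : T ⟶ (U i).toScheme := liftOpen _ q (mem_of_top_le_preimage h)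
  have hb : b ≫ (U i).ι = q := liftOpen_ι _ _ _
  let v : T ⟶ LocalModel.space A k := AffineSpace.homOfVector b x
  have hv : v ≫ LocalModel.proj A k = q := by simp [v, hb, LocalModel.proj, k]
  let j : LocalModel.space A k ⟶ totalSpace K hU := LocalModel.incl K hU k
  have hj : j ≫ toBase K hU = LocalModel.proj A k := LocalModel.incl_toBase K hU k
  have hj' : homEquiv K hU _ j = LocalModel.taut K k := LocalModel.pull_incl K hU k
  have e : (v ≫ j) ≫ toBase K hU = q := by rw [Category.assoc, hj, hv]
  refine ⟨v ≫ j, e, ?_⟩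
  funext a
  have h1 : ⊤ ≤ (v ≫ LocalModel.proj A k) ⁻¹ᵁ U i := by rw [hv]; exact h
  have e1 : homEquiv K hU T (v ≫ j) = (LocalModel.taut K k).pull v := by
    rw [homEquiv_comp, hj']
  refine (LocalModel.point_eq K e1 a i ⊤ _ h1).trans ?_
  have h2 : ⊤ ≤ (v ≫ LocalModel.proj A k) ⁻¹ᵁ (U i ⊓ U i) := fun t ht => ⟨h1 ht, h1 ht⟩
  refine (Sec.map_pull _ _ _ _ _).trans ((LocalModel.appLE_taut K k v a i ⊤ h1 h2).trans ?_)
  rw [LocalModel.g_self]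
  refine (congrArg₂ _ (map_one _) ?_).trans (one_mul _)
  refine (Sec.map_top _).trans ?_
  simp only [v, AffineSpace.homOfVector_appTop_coord]

theorem hom_ext_of_coord {v w : T ⟶ totalSpace K hU} (e : v ≫ toBase K hU = w ≫ toBase K hU)
    (i : ι) (hv : ⊤ ≤ (v ≫ toBase K hU) ⁻¹ᵁ U i) (hw : ⊤ ≤ (w ≫ toBase K hU) ⁻¹ᵁ U i)
    (h : ∀ a, coord v i hv a = coord w i hw a) : v = w := by
  apply (homEquiv K hU T).injective
  refine Point.ext' e fun a j W hx hy => ?_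
  have hi : W ≤ (v ≫ toBase K hU) ⁻¹ᵁ U i := fun t _ => hv (x := t) trivial
  have hi' : W ≤ (w ≫ toBase K hU) ⁻¹ᵁ U i := fun t _ => hw (x := t) trivial
  refine (((homEquiv K hU T v).2 a).2 j i W hx hi).trans
    (Eq.trans ?_ (((homEquiv K hU T w).2 a).2 j i W hy hi').symm)
  refine congrArg₂ _ (LocalModel.appLE_congr_apply e _ _ _ _ _) ?_
  have h1 := congrArg (T.presheaf.map (homOfLE (le_top : W ≤ ⊤)).op) (h a)
  exact (map_map_fun _ _ _).symm.trans (h1.trans (map_map_fun _ _ _))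

theorem isAffineOpen_preimage_toBase (k : LocalModel.Ix U) (hk : IsAffineOpen k.W) :
    IsAffineOpen (toBase K hU ⁻¹ᵁ k.W) := by
  have : IsAffine k.W.toScheme := hk
  have h := isAffineOpen_opensRange (LocalModel.incl K hU k)
  rwa [LocalModel.opensRange_incl] at h

theorem exists_affine_frame (hU : ⨆ i, U i = ⊤) (x : B) :
    ∃ k : LocalModel.Ix U, IsAffineOpen k.W ∧ x ∈ k.W := by
  obtain ⟨i, hi⟩ := Opens.mem_iSup.mp (hU ▸ Opens.mem_top x : x ∈ ⨆ i, U i)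
  obtain ⟨W, hW, hxW, hle⟩ := exists_isAffineOpen_mem_and_subset hi
  exact ⟨⟨i, W, hle⟩, hW, hxW⟩

theorem coord_totalSpaceMap {A' : Type} {K' : A' → LineCocycle U}
    (φ : ∀ {T : Scheme.{0}} (q : T ⟶ B), (∀ a, Sec (K a) q) → ∀ a, Sec (K' a) q)
    (v : T ⟶ totalSpace K hU) (i : ι) (h : ⊤ ≤ ((v ≫ totalSpaceMap K hU K' φ) ≫ toBase K' hU) ⁻¹ᵁ U i)
    (h' : ⊤ ≤ (v ≫ toBase K hU) ⁻¹ᵁ U i) (a : A') :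
    coord (v ≫ totalSpaceMap K hU K' φ) i h a =
      v.appLE (toBase K hU ⁻¹ᵁ U i) ⊤ h' ((φ _ (tautPoint K hU).2 a).1 i) := by
  have e : homEquiv K' hU T (v ≫ totalSpaceMap K hU K' φ) =
      Point.pull v ⟨(tautPoint K hU).1, φ _ (tautPoint K hU).2⟩ := by
    rw [homEquiv_comp, totalSpaceMap, Equiv.apply_symm_apply]
  exact (LocalModel.point_eq K' e a i ⊤ h h').trans (Sec.map_pull _ _ _ _ _)

theorem totalSpaceMap_toBase {A' : Type} {K' : A' → LineCocycle U}
    (φ : ∀ {T : Scheme.{0}} (q : T ⟶ B), (∀ a, Sec (K a) q) → ∀ a, Sec (K' a) q) :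
    totalSpaceMap K hU K' φ ≫ toBase K' hU = toBase K hU :=
  homEquiv_symm_toBase K' hU _

end Coordinates

/-! ### Matrices of coordinates -/

namespace GrassmannFlopData

variable {B : Scheme.{0}} {n r : ℕ} (D : GrassmannFlopData B n r) {T T' : Scheme.{0}}

section V

variable (v : T ⟶ D.V) (i : Frame D.bundles) (h : ⊤ ≤ (v ≫ D.pV) ⁻¹ᵁ i.U)

/-- The matrix of `M` at a `T`-point `(M, N)` of `V`, with respect to local frames. -/
def matM : Matrix (Fin r) (Fin n) Γ(T, ⊤) :=
  fun a j => coord (hU := D.iSup_opens) v i h (.inl (a, j))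

/-- The matrix of `N` at a `T`-point `(M, N)` of `V`, with respect to local frames. -/
def matN : Matrix (Fin n) (Fin r) Γ(T, ⊤) :=
  fun j a => coord (hU := D.iSup_opens) v i h (.inr (j, a))

theorem matM_comp (u : T' ⟶ T) (h' : ⊤ ≤ ((u ≫ v) ≫ D.pV) ⁻¹ᵁ i.U) :
    D.matM (u ≫ v) i h' = (D.matM v i h).map u.appTop := by
  ext a j
  exact coord_comp (hU := D.iSup_opens) u v i h h' _

theorem matN_comp (u : T' ⟶ T) (h' : ⊤ ≤ ((u ≫ v) ≫ D.pV) ⁻¹ᵁ i.U) :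
    D.matN (u ≫ v) i h' = (D.matN v i h).map u.appTop := by
  ext a j
  exact coord_comp (hU := D.iSup_opens) u v i h h' _

theorem matM_congr {v w : T ⟶ D.V} (e : v = w) (i : Frame D.bundles)
    (h : ⊤ ≤ (v ≫ D.pV) ⁻¹ᵁ i.U) (h' : ⊤ ≤ (w ≫ D.pV) ⁻¹ᵁ i.U) :
    D.matM v i h = D.matM w i h' := by subst e; rfl

theorem matN_congr {v w : T ⟶ D.V} (e : v = w) (i : Frame D.bundles)
    (h : ⊤ ≤ (v ≫ D.pV) ⁻¹ᵁ i.U) (h' : ⊤ ≤ (w ≫ D.pV) ⁻¹ᵁ i.U) :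
    D.matN v i h = D.matN w i h' := by subst e; rfl

/-- The point `v · g` of `V`. -/
def actPoint (g : GL (Fin r) Γ(T, ⊤)) : T ⟶ D.V := D.actV.act v g

theorem actPoint_pV (g : GL (Fin r) Γ(T, ⊤)) : D.actPoint v g ≫ D.pV = v ≫ D.pV :=
  D.actV.act_toBase v g

theorem homEquiv_actPoint (g : GL (Fin r) Γ(T, ⊤)) :
    homEquiv D.kV D.iSup_opens T (D.actPoint v g) =
      ⟨v ≫ D.pV, D.actSecV _ g (homEquiv D.kV D.iSup_opens T v).2⟩ :=
  Equiv.apply_symm_apply _ _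

theorem matM_act (g : GL (Fin r) Γ(T, ⊤)) (h' : ⊤ ≤ (D.actPoint v g ≫ D.pV) ⁻¹ᵁ i.U) :
    D.matM (D.actPoint v g) i h' = (g⁻¹).val * D.matM v i h := by
  ext a j
  refine (coord_of_homEquiv (hU := D.iSup_opens) (D.homEquiv_actPoint v g) i h' h _).trans ?_
  exact Sec.coord_mulVec _ _ _ _

theorem matN_act (g : GL (Fin r) Γ(T, ⊤)) (h' : ⊤ ≤ (D.actPoint v g ≫ D.pV) ⁻¹ᵁ i.U) :
    D.matN (D.actPoint v g) i h' = D.matN v i h * g.val := by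
  ext j a
  refine (coord_of_homEquiv (hU := D.iSup_opens) (D.homEquiv_actPoint v g) i h' h _).trans ?_
  exact Sec.coord_vecMul _ _ _ _

theorem V_hom_ext {v w : T ⟶ D.V} (e : v ≫ D.pV = w ≫ D.pV) (i : Frame D.bundles)
    (hv : ⊤ ≤ (v ≫ D.pV) ⁻¹ᵁ i.U) (hw : ⊤ ≤ (w ≫ D.pV) ⁻¹ᵁ i.U)
    (hM : D.matM v i hv = D.matM w i hw) (hN : D.matN v i hv = D.matN w i hw) : v = w := by
  refine hom_ext_of_coord (hU := D.iSup_opens) e i hv hw ?_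
  rintro (⟨a, j⟩ | ⟨j, a⟩)
  · exact congrFun (congrFun hM a) j
  · exact congrFun (congrFun hN j) a

theorem exists_point_V (q : T ⟶ B) (i : Frame D.bundles) (h : ⊤ ≤ q ⁻¹ᵁ i.U)
    (M : Matrix (Fin r) (Fin n) Γ(T, ⊤)) (N : Matrix (Fin n) (Fin r) Γ(T, ⊤)) :
    ∃ v : T ⟶ D.V, v ≫ D.pV = q ∧ (∀ h', D.matM v i h' = M) ∧ ∀ h', D.matN v i h' = N := by
  obtain ⟨v, e, hx⟩ := exists_coord (K := D.kV) (hU := D.iSup_opens) q i h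
    (Sum.elim (fun x => M x.1 x.2) (fun x => N x.1 x.2))
  refine ⟨v, e, fun h' => ?_, fun h' => ?_⟩
  · ext a j
    exact congrFun hx (.inl (a, j))
  · ext j a
    exact congrFun hx (.inr (j, a))

end V

section H

/-- The projection of `H` to `B`. -/
def pH : D.H ⟶ B := toBase D.kH D.iSup_opens

/-- The matrix of a `T`-point of `H`, with respect to local frames. -/
def matH (v : T ⟶ D.H) (i : Frame D.bundles)
    (h : ⊤ ≤ (v ≫ D.pH) ⁻¹ᵁ i.U) : Matrix (Fin n) (Fin n) Γ(T, ⊤) :=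
  fun j l => coord (hU := D.iSup_opens) v i h (j, l)

theorem toH_pH : D.toH ≫ D.pH = D.pV := totalSpaceMap_toBase _

theorem matH_toH (v : T ⟶ D.V) (i : Frame D.bundles) (h : ⊤ ≤ (v ≫ D.pV) ⁻¹ᵁ i.U)
    (h' : ⊤ ≤ ((v ≫ D.toH) ≫ D.pH) ⁻¹ᵁ i.U) :
    D.matH (v ≫ D.toH) i h' = D.matN v i h * D.matM v i h := by
  ext j l
  refine (coord_totalSpaceMap (hU := D.iSup_opens) _ v i h' h _).trans ?_
  dsimp only [Sec.dot]
  rw [Sec.val_sum]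
  refine (map_sum _ _ _).trans (Finset.sum_congr rfl fun b _ => ?_)
  rw [Sec.mul_val]
  refine (map_mul _ _ _).trans (congrArg₂ _ ?_ ?_)
  · exact (coord_eq_appLE (hU := D.iSup_opens) v i h _).symm
  · exact (coord_eq_appLE (hU := D.iSup_opens) v i h _).symm

theorem H_hom_ext {v w : T ⟶ D.H}
    (e : v ≫ D.pH = w ≫ D.pH) (i : Frame D.bundles)
    (hv : ⊤ ≤ (v ≫ D.pH) ⁻¹ᵁ i.U)
    (hw : ⊤ ≤ (w ≫ D.pH) ⁻¹ᵁ i.U)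
    (h : D.matH v i hv = D.matH w i hw) : v = w :=
  hom_ext_of_coord (hU := D.iSup_opens) e i hv hw fun a => congrFun (congrFun h a.1) a.2

theorem matH_congr {v w : T ⟶ D.H} (e : v = w) (i : Frame D.bundles)
    (hv : ⊤ ≤ (v ≫ D.pH) ⁻¹ᵁ i.U)
    (hw : ⊤ ≤ (w ≫ D.pH) ⁻¹ᵁ i.U) :
    D.matH v i hv = D.matH w i hw := by subst e; rfl

end H

section Vt

variable (v : T ⟶ D.Vt) (i : Frame D.bundles) (h : ⊤ ≤ (v ≫ D.pVt) ⁻¹ᵁ i.U)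

/-- The matrix of `M` at a `T`-point `(M, D, N)` of `Ṽ`, with respect to local frames. -/
def matM' : Matrix (Fin r) (Fin n) Γ(T, ⊤) :=
  fun a j => coord (hU := D.iSup_opens) v i h (.inl (a, j))

/-- The matrix of `D` at a `T`-point `(M, D, N)` of `Ṽ`. -/
def matD' : Matrix (Fin r) (Fin r) Γ(T, ⊤) :=
  fun a b => coord (hU := D.iSup_opens) v i h (.inr (.inl (a, b)))

/-- The matrix of `N` at a `T`-point `(M, D, N)` of `Ṽ`, with respect to local frames. -/
def matN' : Matrix (Fin n) (Fin r) Γ(T, ⊤) :=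
  fun j a => coord (hU := D.iSup_opens) v i h (.inr (.inr (j, a)))

theorem matM'_comp (u : T' ⟶ T) (h' : ⊤ ≤ ((u ≫ v) ≫ D.pVt) ⁻¹ᵁ i.U) :
    D.matM' (u ≫ v) i h' = (D.matM' v i h).map u.appTop := by
  ext a j
  exact coord_comp (hU := D.iSup_opens) u v i h h' _

theorem matD'_comp (u : T' ⟶ T) (h' : ⊤ ≤ ((u ≫ v) ≫ D.pVt) ⁻¹ᵁ i.U) :
    D.matD' (u ≫ v) i h' = (D.matD' v i h).map u.appTop := by
  ext a j
  exact coord_comp (hU := D.iSup_opens) u v i h h' _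

theorem matN'_comp (u : T' ⟶ T) (h' : ⊤ ≤ ((u ≫ v) ≫ D.pVt) ⁻¹ᵁ i.U) :
    D.matN' (u ≫ v) i h' = (D.matN' v i h).map u.appTop := by
  ext a j
  exact coord_comp (hU := D.iSup_opens) u v i h h' _

theorem matM'_congr {v w : T ⟶ D.Vt} (e : v = w) (i : Frame D.bundles)
    (h : ⊤ ≤ (v ≫ D.pVt) ⁻¹ᵁ i.U) (h' : ⊤ ≤ (w ≫ D.pVt) ⁻¹ᵁ i.U) :
    D.matM' v i h = D.matM' w i h' := by subst e; rfl

theorem matN'_congr {v w : T ⟶ D.Vt} (e : v = w) (i : Frame D.bundles)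
    (h : ⊤ ≤ (v ≫ D.pVt) ⁻¹ᵁ i.U) (h' : ⊤ ≤ (w ≫ D.pVt) ⁻¹ᵁ i.U) :
    D.matN' v i h = D.matN' w i h' := by subst e; rfl

/-- The point `v · (g₁, g₂)` of `Ṽ`. -/
def actPoint' (g₁ g₂ : GL (Fin r) Γ(T, ⊤)) : T ⟶ D.Vt := D.actVt.act v (g₁, g₂)

theorem actPoint'_pVt (g₁ g₂ : GL (Fin r) Γ(T, ⊤)) : D.actPoint' v g₁ g₂ ≫ D.pVt = v ≫ D.pVt :=
  D.actVt.act_toBase v (g₁, g₂)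

theorem homEquiv_actPoint' (g₁ g₂ : GL (Fin r) Γ(T, ⊤)) :
    homEquiv D.kVt D.iSup_opens T (D.actPoint' v g₁ g₂) =
      ⟨v ≫ D.pVt, D.actSecVt _ (g₁, g₂) (homEquiv D.kVt D.iSup_opens T v).2⟩ :=
  Equiv.apply_symm_apply _ _

theorem matM'_act (g₁ g₂ : GL (Fin r) Γ(T, ⊤))
    (h' : ⊤ ≤ (D.actPoint' v g₁ g₂ ≫ D.pVt) ⁻¹ᵁ i.U) :
    D.matM' (D.actPoint' v g₁ g₂) i h' = (g₁⁻¹).val * D.matM' v i h := by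
  ext a j
  refine (coord_of_homEquiv (hU := D.iSup_opens) (D.homEquiv_actPoint' v g₁ g₂) i h' h _).trans ?_
  exact Sec.coord_mulVec _ _ _ _

theorem matD'_act (g₁ g₂ : GL (Fin r) Γ(T, ⊤))
    (h' : ⊤ ≤ (D.actPoint' v g₁ g₂ ≫ D.pVt) ⁻¹ᵁ i.U) :
    D.matD' (D.actPoint' v g₁ g₂) i h' = (g₂⁻¹).val * (D.matD' v i h * g₁.val) := by
  ext a b
  refine (coord_of_homEquiv (hU := D.iSup_opens) (D.homEquiv_actPoint' v g₁ g₂) i h' h _).trans ?_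
  refine (Sec.coord_mulVec _ _ _ _).trans ?_
  rw [Matrix.mul_apply]
  refine Finset.sum_congr rfl fun c _ => congrArg _ ?_
  exact Sec.coord_vecMul _ _ _ _

theorem matN'_act (g₁ g₂ : GL (Fin r) Γ(T, ⊤))
    (h' : ⊤ ≤ (D.actPoint' v g₁ g₂ ≫ D.pVt) ⁻¹ᵁ i.U) :
    D.matN' (D.actPoint' v g₁ g₂) i h' = D.matN' v i h * g₂.val := by
  ext j a
  refine (coord_of_homEquiv (hU := D.iSup_opens) (D.homEquiv_actPoint' v g₁ g₂) i h' h _).trans ?_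
  exact Sec.coord_vecMul _ _ _ _

theorem Vt_hom_ext {v w : T ⟶ D.Vt} (e : v ≫ D.pVt = w ≫ D.pVt) (i : Frame D.bundles)
    (hv : ⊤ ≤ (v ≫ D.pVt) ⁻¹ᵁ i.U) (hw : ⊤ ≤ (w ≫ D.pVt) ⁻¹ᵁ i.U)
    (hM : D.matM' v i hv = D.matM' w i hw) (hD : D.matD' v i hv = D.matD' w i hw)
    (hN : D.matN' v i hv = D.matN' w i hw) : v = w := by
  refine hom_ext_of_coord (hU := D.iSup_opens) e i hv hw ?_
  rintro (⟨a, j⟩ | ⟨a, b⟩ | ⟨j, a⟩)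
  · exact congrFun (congrFun hM a) j
  · exact congrFun (congrFun hD a) b
  · exact congrFun (congrFun hN j) a

theorem exists_point_Vt (q : T ⟶ B) (i : Frame D.bundles) (h : ⊤ ≤ q ⁻¹ᵁ i.U)
    (M : Matrix (Fin r) (Fin n) Γ(T, ⊤)) (E : Matrix (Fin r) (Fin r) Γ(T, ⊤))
    (N : Matrix (Fin n) (Fin r) Γ(T, ⊤)) :
    ∃ v : T ⟶ D.Vt, v ≫ D.pVt = q ∧ (∀ h', D.matM' v i h' = M) ∧ (∀ h', D.matD' v i h' = E) ∧
      ∀ h', D.matN' v i h' = N := by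
  obtain ⟨v, e, hx⟩ := exists_coord (K := D.kVt) (hU := D.iSup_opens) q i h
    (Sum.elim (fun x => M x.1 x.2) (Sum.elim (fun x => E x.1 x.2) (fun x => N x.1 x.2)))
  refine ⟨v, e, fun h' => ?_, fun h' => ?_, fun h' => ?_⟩
  · ext a j
    exact congrFun hx (.inl (a, j))
  · ext a b
    exact congrFun hx (.inr (.inl (a, b)))
  · ext j a
    exact congrFun hx (.inr (.inr (j, a)))

theorem toVPlus_pV : D.toVPlus ≫ D.pV = D.pVt := totalSpaceMap_toBase _

theorem toVMinus_pV : D.toVMinus ≫ D.pV = D.pVt := totalSpaceMap_toBase _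

theorem matM_toVPlus (h' : ⊤ ≤ ((v ≫ D.toVPlus) ≫ D.pV) ⁻¹ᵁ i.U) :
    D.matM (v ≫ D.toVPlus) i h' = D.matD' v i h * D.matM' v i h := by
  ext a j
  refine (coord_totalSpaceMap (hU := D.iSup_opens) _ v i h' h _).trans ?_
  dsimp only [Sec.dot]
  rw [Sec.val_sum]
  refine (map_sum _ _ _).trans (Finset.sum_congr rfl fun b _ => ?_)
  rw [Sec.mul_val]
  refine (map_mul _ _ _).trans (congrArg₂ _ ?_ ?_)
  · exact (coord_eq_appLE (hU := D.iSup_opens) v i h _).symm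
  · exact (coord_eq_appLE (hU := D.iSup_opens) v i h _).symm

theorem matN_toVPlus (h' : ⊤ ≤ ((v ≫ D.toVPlus) ≫ D.pV) ⁻¹ᵁ i.U) :
    D.matN (v ≫ D.toVPlus) i h' = D.matN' v i h := by
  ext j a
  refine (coord_totalSpaceMap (hU := D.iSup_opens) _ v i h' h _).trans ?_
  exact (coord_eq_appLE (hU := D.iSup_opens) v i h _).symm

theorem matM_toVMinus (h' : ⊤ ≤ ((v ≫ D.toVMinus) ≫ D.pV) ⁻¹ᵁ i.U) :
    D.matM (v ≫ D.toVMinus) i h' = D.matM' v i h := by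
  ext a j
  refine (coord_totalSpaceMap (hU := D.iSup_opens) _ v i h' h _).trans ?_
  exact (coord_eq_appLE (hU := D.iSup_opens) v i h _).symm

theorem matN_toVMinus (h' : ⊤ ≤ ((v ≫ D.toVMinus) ≫ D.pV) ⁻¹ᵁ i.U) :
    D.matN (v ≫ D.toVMinus) i h' = D.matN' v i h * D.matD' v i h := by
  ext j a
  refine (coord_totalSpaceMap (hU := D.iSup_opens) _ v i h' h _).trans ?_
  dsimp only [Sec.dot]
  rw [Sec.val_sum]
  refine (map_sum _ _ _).trans (Finset.sum_congr rfl fun b _ => ?_)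
  rw [Sec.mul_val]
  refine (map_mul _ _ _).trans (congrArg₂ _ ?_ ?_)
  · exact (coord_eq_appLE (hU := D.iSup_opens) v i h _).symm
  · exact (coord_eq_appLE (hU := D.iSup_opens) v i h _).symm

end Vt

end GrassmannFlopData

/-! ### Matrices over a field and one-parameter subgroups -/

section LinearAlgebra

open Matrix

variable {m r : ℕ}

/-- A matrix all of whose maximal minors vanish has a nonzero kernel vector. -/
theorem exists_mulVec_eq_zero_of_minors {F : Type} [CommRing F] (hF : IsField F)
    (N : Matrix (Fin m) (Fin r) F) (h : ∀ I : Fin r → Fin m, (N.submatrix I id).det = 0) :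
    ∃ x y : Fin r → F, N *ᵥ x = 0 ∧ y ⬝ᵥ x = 1 := by
  let := hF.toField
  by_cases hN : ∃ x, x ≠ 0 ∧ N *ᵥ x = 0
  · obtain ⟨x, hx, hNx⟩ := hN
    obtain ⟨a, ha⟩ := Function.ne_iff.mp hx
    exact ⟨x, Pi.single a (x a)⁻¹, hNx, by
      rw [single_dotProduct]; exact inv_mul_cancel₀ ha⟩
  · exfalso
    push Not at hN
    have hker : LinearMap.ker N.mulVecLin = ⊥ := LinearMap.ker_eq_bot'.mpr fun x hx => by
      by_contra hx'
      exact hN x hx' hx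
    -- An injective matrix has rank `r`, hence `r` linearly independent rows, and their minor is not zero.
    have hrank : N.rank = r := by
      rw [rank, LinearMap.finrank_range_of_inj (LinearMap.ker_eq_bot.mp hker), Module.finrank_fin_fun]
    rw [rank_eq_finrank_span_row] at hrank
    obtain ⟨κ, a, ha, hspan, hli⟩ := exists_linearIndependent' F N.row
    have : Finite κ := Finite.of_injective a ha
    have := Fintype.ofFinite κ
    have hcard : Fintype.card κ = r := by
      rw [linearIndependent_iff_card_eq_finrank_span.mp hli, Set.finrank, hspan, hrank]
    let e : Fin r ≃ κ := (Fintype.equivFinOfCardEq hcard).symm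
    have hu : IsUnit (N.submatrix (a ∘ e) id) := by
      rw [← linearIndependent_rows_iff_isUnit]
      exact hli.comp e e.injective
    exact ((isUnit_iff_isUnit_det _).mp hu).ne_zero (h _)

/-- A matrix all of whose maximal minors vanish has a nonzero cokernel vector. -/
theorem exists_vecMul_eq_zero_of_minors {F : Type} [CommRing F] (hF : IsField F)
    (M : Matrix (Fin r) (Fin m) F) (h : ∀ I : Fin r → Fin m, (M.submatrix id I).det = 0) :
    ∃ x y : Fin r → F, y ᵥ* M = 0 ∧ y ⬝ᵥ x = 1 := by
  obtain ⟨y, x, h1, h2⟩ := exists_mulVec_eq_zero_of_minors hF Mᵀ fun I => by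
    rw [← h I, ← det_transpose, transpose_submatrix, transpose_transpose]
  exact ⟨x, y, by rwa [mulVec_transpose] at h1, by rwa [dotProduct_comm]⟩

variable {R : Type} [CommRing R] (x y : Fin r → R)

/-- The endomorphism that scales `x` by `t` and is the identity on the kernel of the linear form
`y`, where `y ⬝ᵥ x = 1`. -/
def dilation (t : R) : Matrix (Fin r) (Fin r) R := 1 + (t - 1) • vecMulVec x y

variable {x y}

theorem dilation_mul (h : y ⬝ᵥ x = 1) (t s : R) :
    dilation x y t * dilation x y s = dilation x y (t * s) := by
  simp only [dilation, mul_add, add_mul, one_mul, mul_one, smul_mul_smul, vecMulVec_mul_vecMulVec,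
    h, one_smul]
  module

theorem dilation_one : dilation x y 1 = 1 := by simp [dilation]

theorem det_dilation (h : y ⬝ᵥ x = 1) (t : R) : (dilation x y t).det = t := by
  rw [dilation, vecMulVec_eq Unit, ← smul_mul, ← replicateCol_smul,
    det_one_add_replicateCol_mul_replicateRow, dotProduct_smul, h]
  simp

theorem mul_dilation {N : Matrix (Fin m) (Fin r) R} (h : N *ᵥ x = 0) (t : R) :
    N * dilation x y t = N := by
  rw [dilation, Matrix.mul_add, Matrix.mul_one, Matrix.mul_smul, mul_vecMulVec, h]
  simp

theorem dilation_mul_eq {M : Matrix (Fin r) (Fin m) R} (h : y ᵥ* M = 0) (t : R) :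
    dilation x y t * M = M := by
  rw [dilation, Matrix.add_mul, Matrix.one_mul, Matrix.smul_mul, vecMulVec_mul, h]
  ext a b
  simp [vecMulVec_apply]

variable {S : Type} [CommRing S] (f : R →+* S)

theorem dilation_map (t : R) : (dilation x y t).map f = dilation (f ∘ x) (f ∘ y) (f t) := by
  ext a b
  simp [dilation, vecMulVec_apply, one_apply, apply_ite f]

/-- The dilation by an invertible factor as an element of the general linear group. -/
def dilationUnit (h : y ⬝ᵥ x = 1) (t : Rˣ) : GL (Fin r) R :=
  ⟨dilation x y t, dilation x y t⁻¹.val, by rw [dilation_mul h]; simp [dilation_one],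
    by rw [dilation_mul h]; simp [dilation_one]⟩

end LinearAlgebra

/-- A model of `𝔾ₘ × T ⟶ 𝔸¹ × T` for an affine scheme `T`, with its coordinate `S`. -/
theorem exists_affineLine (R : CommRingCat.{0}) :
    ∃ (A A' : Scheme.{0}) (c : A ⟶ Spec R) (o : Spec R ⟶ A) (i : A' ⟶ A) (S : Γ(A, ⊤)),
      Function.Injective i.appTop ∧ o ≫ c = 𝟙 _ ∧ o.appTop S = 0 ∧ IsUnit (i.appTop S) := by
  let P := CommRingCat.of (Polynomial R)
  let P' := CommRingCat.of (LaurentPolynomial R)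
  let f : R ⟶ P := CommRingCat.ofHom Polynomial.C
  let e : P ⟶ R := CommRingCat.ofHom (Polynomial.evalRingHom 0)
  let l : P ⟶ P' := CommRingCat.ofHom Polynomial.toLaurent
  have key : ∀ {R R' : CommRingCat.{0}} (φ : R ⟶ R') (x : R), (Spec.map φ).appTop
      ((Scheme.ΓSpecIso R).inv x) = (Scheme.ΓSpecIso R').inv (φ x) := fun φ x =>
    (ConcreteCategory.congr_hom (Scheme.ΓSpecIso_inv_naturality φ) x).symm
  refine ⟨Spec P, Spec P', Spec.map f, Spec.map e, Spec.map l,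
    (Scheme.ΓSpecIso P).inv (Polynomial.X : Polynomial R), ?_, ?_, ?_, ?_⟩
  · intro a b hab
    have hs : ∀ a, (Scheme.ΓSpecIso P).inv ((Scheme.ΓSpecIso P).hom a) = a := fun a =>
      ConcreteCategory.congr_hom (Scheme.ΓSpecIso P).hom_inv_id a
    rw [← hs a, ← hs b, key, key] at hab
    have h1 := (ConcreteCategory.bijective_of_isIso (Scheme.ΓSpecIso P').inv).1 hab
    have h2 := Polynomial.toLaurent_injective h1
    rw [← hs a, ← hs b]
    exact congrArg _ h2
  · rw [← Spec.map_comp, ← Spec.map_id]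
    congr 1
    ext x
    exact Polynomial.eval_C
  · rw [key]
    refine Eq.trans (congrArg _ ?_) (map_zero _)
    exact Polynomial.eval_X
  · rw [key]
    refine IsUnit.map (Scheme.ΓSpecIso P').inv.hom ?_
    change IsUnit (Polynomial.toLaurent (Polynomial.X : Polynomial R))
    rw [Polynomial.toLaurent_X]
    exact LaurentPolynomial.isUnit_T 1

/-! ### Charts of the semistable locus -/

section ChartSystems

variable {𝒢 : GroupFunctor} {V B : Scheme.{0}} {p : V ⟶ B} {ι : Type}

/-- A family of semi-invariant functions `δ j` of weight `θ`, given on `T`-points over each member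
of the family `U` of open subsets of the base, such that the locus where `δ j` is invertible has an
equivariant morphism to the group, and such that every semi-invariant function of positive weight
vanishes at the points with values in a field where all `δ j` do. -/
structure ChartSystem (ρ : RightAction 𝒢 p) (U : ι → B.Opens) (θ : 𝒢 ⟶ Gm) (J : Type) where
  δ : ∀ {T : Scheme.{0}} (v : T ⟶ V) (i : ι), ⊤ ≤ (v ≫ p) ⁻¹ᵁ U i → J → Γ(T, ⊤)
  δ_comp : ∀ {T T' : Scheme.{0}} (u : T' ⟶ T) (v : T ⟶ V) (i : ι) (h : ⊤ ≤ (v ≫ p) ⁻¹ᵁ U i)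
    (h' : ⊤ ≤ ((u ≫ v) ≫ p) ⁻¹ᵁ U i) (j : J), δ (u ≫ v) i h' j = u.appTop (δ v i h j)
  δ_act : ∀ {T : Scheme.{0}} (v : T ⟶ V) (g : 𝒢.obj (op T)) (i : ι) (h : ⊤ ≤ (v ≫ p) ⁻¹ᵁ U i)
    (h' : ⊤ ≤ (ρ.act v g ≫ p) ⁻¹ᵁ U i) (j : J), δ (ρ.act v g) i h' j = charValue θ g * δ v i h j
  exists_equivariant : ∀ {P : Scheme.{0}} (w : P ⟶ V) (i : ι) (h : ⊤ ≤ (w ≫ p) ⁻¹ᵁ U i) (j : J),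
    IsUnit (δ w i h j) → ∃ γ : 𝒢.obj (op P), ∀ (T : Scheme.{0}) (u v : T ⟶ P) (g : 𝒢.obj (op T)),
      ρ.act (u ≫ w) g = v ≫ w → 𝒢.map v.op γ = 𝒢.map u.op γ * g
  vanish : ∀ (R : CommRingCat.{0}), IsField Γ(Spec R, ⊤) → ∀ (y : Spec R ⟶ V) (i : ι)
    (h : ⊤ ≤ (y ≫ p) ⁻¹ᵁ U i), (∀ j, δ y i h j = 0) → ∀ (k : ℕ), 0 < k → ∀ (W : B.Opens)
    (f : Γ(V, p ⁻¹ᵁ W)), ρ.IsSemiInvariant θ k f → ∀ hy : ⊤ ≤ y ⁻¹ᵁ (p ⁻¹ᵁ W),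
      y.appLE (p ⁻¹ᵁ W) ⊤ hy f = 0

namespace ChartSystem

variable {ρ : RightAction 𝒢 p} {U : ι → B.Opens} {θ : 𝒢 ⟶ Gm} {J : Type}
  (C : ChartSystem ρ U θ J)

theorem δ_congr {T : Scheme.{0}} {v w : T ⟶ V} (e : v = w) (i : ι) (h : ⊤ ≤ (v ≫ p) ⁻¹ᵁ U i)
    (h' : ⊤ ≤ (w ≫ p) ⁻¹ᵁ U i) (j : J) : C.δ v i h j = C.δ w i h' j := by
  subst e; rfl

/-- By Yoneda, `δ j` is given by a function on the preimage of each open subset with a frame. -/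
theorem exists_function (k : LocalModel.Ix U) (j : J) : ∃ d : Γ(V, p ⁻¹ᵁ k.W),
    ∀ (T : Scheme.{0}) (v : T ⟶ V) (hv : ⊤ ≤ v ⁻¹ᵁ (p ⁻¹ᵁ k.W)) (h : ⊤ ≤ (v ≫ p) ⁻¹ᵁ U k.i),
      v.appLE (p ⁻¹ᵁ k.W) ⊤ hv d = C.δ v k.i h j := by
  have h0 : ⊤ ≤ ((p ⁻¹ᵁ k.W).ι ≫ p) ⁻¹ᵁ U k.i :=
    top_le_ι_preimage (p.preimage_mono k.le)
  obtain ⟨d, hd⟩ := ι_appLE_surjective (p ⁻¹ᵁ k.W) (top_le_ι_preimage le_rfl)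
    (C.δ (p ⁻¹ᵁ k.W).ι k.i h0 j)
  refine ⟨d, fun T v hv h => ?_⟩
  let u : T ⟶ (p ⁻¹ᵁ k.W).toScheme := liftOpen _ v (mem_of_top_le_preimage hv)
  have hu : u ≫ (p ⁻¹ᵁ k.W).ι = v := liftOpen_ι _ _ _
  have h1 : ⊤ ≤ (u ≫ (p ⁻¹ᵁ k.W).ι) ⁻¹ᵁ (p ⁻¹ᵁ k.W) := hu ▸ hv
  have h2 : ⊤ ≤ ((u ≫ (p ⁻¹ᵁ k.W).ι) ≫ p) ⁻¹ᵁ U k.i := by rw [hu]; exact h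
  rw [← LocalModel.appLE_congr_apply hu _ _ h1,
    ← appTop_appLE_apply _ _ _ (top_le_ι_preimage le_rfl), hd, ← C.δ_comp _ _ _ _ h2]
  exact C.δ_congr hu _ _ _ _

/-- The function on the preimage of an open subset of the base given by `δ j`. -/
def fn (k : LocalModel.Ix U) (j : J) : Γ(V, p ⁻¹ᵁ k.W) := (C.exists_function k j).choose

theorem appLE_fn (k : LocalModel.Ix U) (j : J) {T : Scheme.{0}} (v : T ⟶ V)
    (hv : ⊤ ≤ v ⁻¹ᵁ (p ⁻¹ᵁ k.W)) (h : ⊤ ≤ (v ≫ p) ⁻¹ᵁ U k.i) :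
    v.appLE (p ⁻¹ᵁ k.W) ⊤ hv (C.fn k j) = C.δ v k.i h j :=
  (C.exists_function k j).choose_spec T v hv h

theorem top_le_preimage (k : LocalModel.Ix U) {T : Scheme.{0}} {v : T ⟶ V}
    (hv : ⊤ ≤ v ⁻¹ᵁ (p ⁻¹ᵁ k.W)) : ⊤ ≤ (v ≫ p) ⁻¹ᵁ U k.i := fun _ ht => k.le (hv ht)

theorem isSemiInvariant_fn (k : LocalModel.Ix U) (j : J) : ρ.IsSemiInvariant θ 1 (C.fn k j) := by
  intro T v g hv hvg
  rw [C.appLE_fn k j v hv (top_le_preimage k hv), C.appLE_fn k j _ hvg (top_le_preimage k hvg),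
    pow_one]
  exact C.δ_act _ _ _ _ _ _

theorem isChart_fn (k : LocalModel.Ix U) (hk : IsAffineOpen k.W) (hk' : IsAffineOpen (p ⁻¹ᵁ k.W))
    (j : J) : ρ.IsChart θ (C.fn k j) := by
  refine ⟨hk, hk', C.isSemiInvariant_fn k j, ?_⟩
  have h1 : ⊤ ≤ (V.basicOpen (C.fn k j)).ι ⁻¹ᵁ (p ⁻¹ᵁ k.W) :=
    top_le_ι_preimage (V.basicOpen_le _)
  have hu := isUnit_appLE_of_mem_basicOpen h1 fun t => ι_apply_mem t
  rw [C.appLE_fn k j _ h1 (top_le_preimage k h1)] at hu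
  obtain ⟨γ, hγ⟩ := C.exists_equivariant _ _ _ _ hu
  exact RightAction.nonempty_slice_of_equivariant (C.isSemiInvariant_fn k j).isInvariantOpen γ hγ

/-- The functions `δ j` have no common zero in the semistable locus: otherwise `vanish`, applied to the
point with values in the residue field, shows that all semi-invariant functions vanish there. -/
theorem exists_mem_basicOpen_fn (k : LocalModel.Ix U) {y : V} (hy : y ∈ ρ.semistableLocus θ)
    (hk : p y ∈ k.W) : ∃ j, y ∈ V.basicOpen (C.fn k j) := by
  obtain ⟨O, ⟨W, -, m, hm, f, hf, rfl⟩, hyf⟩ := Opens.mem_sSup.mp hy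
  by_contra! hj
  have hF : IsField Γ(Spec (V.residueField y), ⊤) :=
    MulEquiv.isField (Field.toIsField (V.residueField y))
      (Scheme.ΓSpecIso (V.residueField y)).commRingCatIsoToRingEquiv.toMulEquiv
  let v := V.fromSpecResidueField y
  have hv : ∀ t, v t = y := fun t => V.fromSpecResidueField_apply y t
  have h1 : ⊤ ≤ v ⁻¹ᵁ (p ⁻¹ᵁ k.W) := by
    intro t _
    change p (v t) ∈ k.W
    rwa [hv]
  have h2 : ⊤ ≤ v ⁻¹ᵁ (p ⁻¹ᵁ W) := by
    intro t _
    change v t ∈ p ⁻¹ᵁ W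
    rw [hv]
    exact V.basicOpen_le f hyf
  have h0 := C.vanish _ hF v k.i (top_le_preimage k h1) (fun j => by
    by_contra hne
    obtain ⟨b, hb⟩ := hF.mul_inv_cancel hne
    have hu : IsUnit (v.appLE _ ⊤ h1 (C.fn k j)) := by
      rw [C.appLE_fn k j v h1 (top_le_preimage k h1)]
      exact IsUnit.of_mul_eq_one b hb
    obtain ⟨t⟩ : Nonempty (Spec (V.residueField y)) := inferInstance
    have := mem_basicOpen_of_isUnit_appLE hu t
    rw [hv] at this
    exact hj j this) m hm W f hf h2
  have hu := isUnit_appLE_of_mem_basicOpen h2 fun t => by rw [hv]; exact hyf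
  rw [h0] at hu
  have := hF.nontrivial
  exact not_isUnit_zero hu

/-- Near a point of the semistable locus, one of the functions `δ j` is invertible. -/
theorem exists_isUnit {T : Scheme.{0}} (v : T ⟶ V) (t : T) (ht : v t ∈ ρ.semistableLocus θ) (i : ι)
    (hi : p (v t) ∈ U i) : ∃ (W : T.Opens) (j : J), t ∈ W ∧
      ∀ (T' : Scheme.{0}) (u : T' ⟶ T), (∀ t', u t' ∈ W) →
        ∃ h : ⊤ ≤ ((u ≫ v) ≫ p) ⁻¹ᵁ U i, IsUnit (C.δ (u ≫ v) i h j) := by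
  let k : LocalModel.Ix U := ⟨i, U i, le_rfl⟩
  obtain ⟨j, hj⟩ := C.exists_mem_basicOpen_fn k ht hi
  refine ⟨v ⁻¹ᵁ V.basicOpen (C.fn k j), j, hj, fun T' u hu => ?_⟩
  have h : ⊤ ≤ (u ≫ v) ⁻¹ᵁ (p ⁻¹ᵁ k.W) := fun t' _ => V.basicOpen_le _ (hu t')
  refine ⟨h, ?_⟩
  rw [← C.appLE_fn k j (u ≫ v) h h]
  exact isUnit_appLE_of_mem_basicOpen _ hu

/-- A point where one of the functions `δ j` is invertible is semistable. -/
theorem mem_semistableLocus (hp : ∀ k : LocalModel.Ix U, IsAffineOpen k.W → IsAffineOpen (p ⁻¹ᵁ k.W))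
    {T : Scheme.{0}} (v : T ⟶ V) (i : ι) (h : ⊤ ≤ (v ≫ p) ⁻¹ᵁ U i) (j : J)
    (hu : IsUnit (C.δ v i h j)) (t : T) : v t ∈ ρ.semistableLocus θ := by
  obtain ⟨W, hW, htW, hle⟩ := exists_isAffineOpen_mem_and_subset
    (show p (v t) ∈ U i from h (x := t) trivial)
  let k : LocalModel.Ix U := ⟨i, W, hle⟩
  obtain ⟨s, hs⟩ := exists_ι_apply (X := T) (W := (v ≫ p) ⁻¹ᵁ W) htW
  let w := ((v ≫ p) ⁻¹ᵁ W).ι ≫ v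
  have h1 : ⊤ ≤ w ⁻¹ᵁ (p ⁻¹ᵁ k.W) := top_le_ι_preimage (W := (v ≫ p) ⁻¹ᵁ W) le_rfl
  have hw : IsUnit (w.appLE _ ⊤ h1 (C.fn k j)) := by
    rw [C.appLE_fn k j w h1 (top_le_preimage k h1), C.δ_comp _ _ _ h]
    exact hu.map _
  have := mem_basicOpen_of_isUnit_appLE hw s
  rw [Scheme.Hom.comp_apply, hs] at this
  exact (C.isChart_fn k hW (hp k hW) j).le_semistableLocus this

theorem exists_gitQuotient (C : ChartSystem ρ U θ J) (hU : ⨆ i, U i = ⊤)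
    (hp : ∀ k : LocalModel.Ix U, IsAffineOpen k.W → IsAffineOpen (p ⁻¹ᵁ k.W)) :
    ∃ Q : GITQuotient ρ θ, ρ.IsPrincipalQuotient Q.π := by
  refine RightAction.exists_gitQuotient fun y hy => ?_
  obtain ⟨k, hk, hyk⟩ := exists_affine_frame hU (p y)
  obtain ⟨j, hj⟩ := C.exists_mem_basicOpen_fn k hy hyk
  exact ⟨k.W, C.fn k j, C.isChart_fn k hk (hp k hk) j, hj⟩

theorem isPrincipalQuotient (C : ChartSystem ρ U θ J) (hU : ⨆ i, U i = ⊤)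
    (hp : ∀ k : LocalModel.Ix U, IsAffineOpen k.W → IsAffineOpen (p ⁻¹ᵁ k.W))
    (Q : GITQuotient ρ θ) : ρ.IsPrincipalQuotient Q.π := by
  obtain ⟨Q', hQ'⟩ := C.exists_gitQuotient hU hp
  exact Q.isGoodQuotient.isPrincipalQuotient hQ'

end ChartSystem

end ChartSystems

/-! ### The semistable loci of the Grassmann flop -/

section MatricesOfFunctions

variable {T T' : Scheme.{0}} (u : T' ⟶ T)

theorem matrix_map_mul {l m k : ℕ} (P : Matrix (Fin l) (Fin m) Γ(T, ⊤))
    (Q : Matrix (Fin m) (Fin k) Γ(T, ⊤)) :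
    (P * Q).map u.appTop = P.map u.appTop * Q.map u.appTop :=
  Matrix.map_mul (f := u.appTop.hom)

theorem det_matrix_map {r : ℕ} (P : Matrix (Fin r) (Fin r) Γ(T, ⊤)) :
    (P.map u.appTop).det = u.appTop P.det :=
  (RingHom.map_det u.appTop.hom P).symm

theorem charValue_detInvDetChar {r : ℕ} (g₁ g₂ : GL (Fin r) Γ(T, ⊤)) :
    charValue (detInvDetChar r) (T := T) (g₁, g₂) = (g₁⁻¹).val.det * g₂.val.det := rfl

theorem det_inv_mul_det {r : ℕ} {R : Type} [CommRing R] (g : GL (Fin r) R) :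
    (g⁻¹).val.det * g.val.det = 1 := by
  rw [← Matrix.det_mul, ← Units.val_mul, inv_mul_cancel, Units.val_one, Matrix.det_one]

/-- A one-parameter family `E` of endomorphisms over `𝔸¹`, with parameter `S` and determinant `S`,
which fixes all matrices `N` with `N x = 0` and all matrices `M` with `y M = 0`. Over `𝔾ₘ` it is an
element `g` of the general linear group. -/
theorem exists_dilation {r : ℕ} (R : CommRingCat.{0}) (x y : Fin r → Γ(Spec R, ⊤))
    (h : dotProduct y x = 1) :
    ∃ (A A' : Scheme.{0}) (c : A ⟶ Spec R) (o : Spec R ⟶ A) (i : A' ⟶ A) (S : Γ(A, ⊤))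
      (E : Matrix (Fin r) (Fin r) Γ(A, ⊤)) (g : GL (Fin r) Γ(A', ⊤)),
      Function.Injective i.appTop ∧ o ≫ c = 𝟙 _ ∧ o.appTop S = 0 ∧
      g.val = E.map i.appTop ∧ g.val.det = i.appTop S ∧
      (∀ (m : ℕ) (N : Matrix (Fin m) (Fin r) Γ(Spec R, ⊤)), N.mulVec x = 0 →
        N.map c.appTop * E = N.map c.appTop) ∧
      ∀ (m : ℕ) (M : Matrix (Fin r) (Fin m) Γ(Spec R, ⊤)), Matrix.vecMul y M = 0 →
        E * M.map c.appTop = M.map c.appTop := by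
  obtain ⟨A, A', c, o, i, S, hi, hoc, hS, hu⟩ := exists_affineLine R
  have h1 : dotProduct (c.appTop.hom ∘ y) (c.appTop.hom ∘ x) = 1 := by
    rw [← RingHom.map_dotProduct, h, map_one]
  have h2 : dotProduct (i.appTop.hom ∘ c.appTop.hom ∘ y) (i.appTop.hom ∘ c.appTop.hom ∘ x) = 1 := by
    rw [← RingHom.map_dotProduct, h1, map_one]
  have hE := dilation_map (x := c.appTop.hom ∘ x) (y := c.appTop.hom ∘ y) i.appTop.hom S
  refine ⟨A, A', c, o, i, S, dilation (c.appTop.hom ∘ x) (c.appTop.hom ∘ y) S,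
    dilationUnit h2 hu.unit, hi, hoc, hS, hE.symm, det_dilation h2 _, fun m N hN => ?_,
    fun m M hM => ?_⟩
  · refine mul_dilation ?_ S
    funext a
    refine (RingHom.map_mulVec c.appTop.hom N x a).symm.trans ?_
    rw [hN]
    exact map_zero _
  · refine dilation_mul_eq ?_ S
    funext a
    refine (RingHom.map_vecMul c.appTop.hom M y a).symm.trans ?_
    rw [hM]
    exact map_zero _

theorem mul_inv_eq_of_mul_eq {r m : ℕ} {R : Type} [CommRing R] {N : Matrix (Fin m) (Fin r) R}
    {g : GL (Fin r) R} (h : N * g.val = N) : N * (g⁻¹).val = N := by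
  conv_lhs => rw [← h]
  rw [Matrix.mul_assoc, ← Units.val_mul, mul_inv_cancel, Units.val_one, Matrix.mul_one]

theorem inv_mul_eq_of_mul_eq {r m : ℕ} {R : Type} [CommRing R] {M : Matrix (Fin r) (Fin m) R}
    {g : GL (Fin r) R} (h : g.val * M = M) : (g⁻¹).val * M = M := by
  conv_lhs => rw [← h]
  rw [← Matrix.mul_assoc, ← Units.val_mul, inv_mul_cancel, Units.val_one, Matrix.one_mul]

theorem map_inv_eq_map_inv_mul {r : ℕ} (u v : T' ⟶ T) (γ : GL (Fin r) Γ(T, ⊤))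
    (g : GL (Fin r) Γ(T', ⊤)) (h : Matrix.GeneralLinearGroup.map v.appTop.hom γ =
      g⁻¹ * Matrix.GeneralLinearGroup.map u.appTop.hom γ) :
    Matrix.GeneralLinearGroup.map v.appTop.hom γ⁻¹ =
      Matrix.GeneralLinearGroup.map u.appTop.hom γ⁻¹ * g := by
  rw [map_inv, map_inv, h, mul_inv_rev, inv_inv]

end MatricesOfFunctions

namespace GrassmannFlopData

variable {B : Scheme.{0}} {n r : ℕ} (D : GrassmannFlopData B n r)

/-- A semi-invariant function of weight a positive power of `det` vanishes at `(M, N)` if `N` is not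
injective: scaling a kernel vector of `N` degenerates the point. -/
theorem vanish_plus (R : CommRingCat.{0}) (hR : IsField Γ(Spec R, ⊤)) (y : Spec R ⟶ D.V)
    (i : Frame D.bundles) (h : ⊤ ≤ (y ≫ D.pV) ⁻¹ᵁ i.U)
    (h0 : ∀ I : Fin r → Fin n, ((D.matN y i h).submatrix I id).det = 0) (k : ℕ) (hk : 0 < k)
    (W : B.Opens) (f : Γ(D.V, D.pV ⁻¹ᵁ W)) (hf : D.actV.IsSemiInvariant (detChar r) k f)
    (hy : ⊤ ≤ y ⁻¹ᵁ (D.pV ⁻¹ᵁ W)) : y.appLE (D.pV ⁻¹ᵁ W) ⊤ hy f = 0 := by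
  obtain ⟨x, x', hx, hxx'⟩ := exists_mulVec_eq_zero_of_minors hR _ h0
  obtain ⟨A, A', c, o, j, S, E, g, hj, hoc, hS, hgE, hg, hN, -⟩ := exists_dilation R x x' hxx'
  have h1 : ⊤ ≤ ((c ≫ y) ≫ D.pV) ⁻¹ᵁ i.U := top_le_comp_preimage h c
  have h2 : ⊤ ≤ ((j ≫ c ≫ y) ≫ D.pV) ⁻¹ᵁ i.U := top_le_comp_preimage h1 j
  -- The translate by `g⁻¹`, whose determinant is `S⁻¹`, is `(g M, N)`, which extends to `S = 0`.
  obtain ⟨z, hz, hzM, hzN⟩ := D.exists_point_V ((c ≫ y) ≫ D.pV) i h1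
    (E * D.matM (c ≫ y) i h1) (D.matN (c ≫ y) i h1)
  have h3 : ⊤ ≤ ((j ≫ z) ≫ D.pV) ⁻¹ᵁ i.U := by rw [Category.assoc, hz]; exact h2
  have h4 : ⊤ ≤ (D.actPoint (j ≫ c ≫ y) g⁻¹ ≫ D.pV) ⁻¹ᵁ i.U := by
    rw [D.actPoint_pV]; exact h2
  refine hf.appLE_eq_zero hk hj hoc hS y z (hz.trans (Category.assoc _ _ _)) g⁻¹ ?_ ?_ hy
  · change j ≫ z = D.actPoint (j ≫ c ≫ y) g⁻¹
    refine D.V_hom_ext ?_ i h3 h4 ?_ ?_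
    · rw [D.actPoint_pV, Category.assoc, hz]; rfl
    · rw [D.matM_act _ i h2, D.matM_comp z i (hz ▸ h1) j, hzM, matrix_map_mul, inv_inv, hgE,
        D.matM_comp (c ≫ y) i h1 j]
    · rw [D.matN_act _ i h2, D.matN_comp z i (hz ▸ h1) j, hzN, D.matN_comp (c ≫ y) i h1 j]
      refine (mul_inv_eq_of_mul_eq ?_).symm
      rw [hgE, ← matrix_map_mul, D.matN_comp y i h c, hN _ _ hx]
  · exact (congrArg _ hg.symm).trans (det_inv_mul_det g)

/-- A semi-invariant function of weight a positive power of `det⁻¹` vanishes at `(M, N)` if `M` is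
not surjective. -/
theorem vanish_minus (R : CommRingCat.{0}) (hR : IsField Γ(Spec R, ⊤)) (y : Spec R ⟶ D.V)
    (i : Frame D.bundles) (h : ⊤ ≤ (y ≫ D.pV) ⁻¹ᵁ i.U)
    (h0 : ∀ I : Fin r → Fin n, ((D.matM y i h).submatrix id I).det = 0) (k : ℕ) (hk : 0 < k)
    (W : B.Opens) (f : Γ(D.V, D.pV ⁻¹ᵁ W)) (hf : D.actV.IsSemiInvariant (detInvChar r) k f)
    (hy : ⊤ ≤ y ⁻¹ᵁ (D.pV ⁻¹ᵁ W)) : y.appLE (D.pV ⁻¹ᵁ W) ⊤ hy f = 0 := by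
  obtain ⟨x, x', hx, hxx'⟩ := exists_vecMul_eq_zero_of_minors hR _ h0
  obtain ⟨A, A', c, o, j, S, E, g, hj, hoc, hS, hgE, hg, -, hM⟩ := exists_dilation R x x' hxx'
  have h1 : ⊤ ≤ ((c ≫ y) ≫ D.pV) ⁻¹ᵁ i.U := top_le_comp_preimage h c
  have h2 : ⊤ ≤ ((j ≫ c ≫ y) ≫ D.pV) ⁻¹ᵁ i.U := top_le_comp_preimage h1 j
  -- The translate by `g`, with `det⁻¹` equal to `S⁻¹`, is `(M, N g)`, which extends to `S = 0`.
  obtain ⟨z, hz, hzM, hzN⟩ := D.exists_point_V ((c ≫ y) ≫ D.pV) i h1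
    (D.matM (c ≫ y) i h1) (D.matN (c ≫ y) i h1 * E)
  have h3 : ⊤ ≤ ((j ≫ z) ≫ D.pV) ⁻¹ᵁ i.U := by rw [Category.assoc, hz]; exact h2
  have h4 : ⊤ ≤ (D.actPoint (j ≫ c ≫ y) g ≫ D.pV) ⁻¹ᵁ i.U := by
    rw [D.actPoint_pV]; exact h2
  refine hf.appLE_eq_zero hk hj hoc hS y z (hz.trans (Category.assoc _ _ _)) g ?_ ?_ hy
  · change j ≫ z = D.actPoint (j ≫ c ≫ y) g
    refine D.V_hom_ext ?_ i h3 h4 ?_ ?_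
    · rw [D.actPoint_pV, Category.assoc, hz]; rfl
    · rw [D.matM_act _ i h2, D.matM_comp z i (hz ▸ h1) j, hzM, D.matM_comp (c ≫ y) i h1 j]
      refine (inv_mul_eq_of_mul_eq ?_).symm
      rw [hgE, ← matrix_map_mul, D.matM_comp y i h c, hM _ _ hx]
    · rw [D.matN_act _ i h2, D.matN_comp z i (hz ▸ h1) j, hzN, matrix_map_mul, hgE,
        D.matN_comp (c ≫ y) i h1 j]
  · exact (congrArg _ hg.symm).trans (det_inv_mul_det g)

/-- A semi-invariant function of weight a positive power of `det(g₁)⁻¹ det(g₂)` vanishes at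
`(M, D, N)` if `N` is not injective or `M` is not surjective. -/
theorem vanish_tilde (R : CommRingCat.{0}) (hR : IsField Γ(Spec R, ⊤)) (y : Spec R ⟶ D.Vt)
    (i : Frame D.bundles) (h : ⊤ ≤ (y ≫ D.pVt) ⁻¹ᵁ i.U)
    (h0 : ∀ I : (Fin r → Fin n) × (Fin r → Fin n), ((D.matM' y i h).submatrix id I.1).det *
      ((D.matN' y i h).submatrix I.2 id).det = 0) (k : ℕ) (hk : 0 < k)
    (W : B.Opens) (f : Γ(D.Vt, D.pVt ⁻¹ᵁ W)) (hf : D.actVt.IsSemiInvariant (detInvDetChar r) k f)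
    (hy : ⊤ ≤ y ⁻¹ᵁ (D.pVt ⁻¹ᵁ W)) : y.appLE (D.pVt ⁻¹ᵁ W) ⊤ hy f = 0 := by
  by_cases h00 : ∀ I : Fin r → Fin n, ((D.matN' y i h).submatrix I id).det = 0
  · obtain ⟨x, x', hx, hxx'⟩ := exists_mulVec_eq_zero_of_minors hR _ h00
    obtain ⟨A, A', c, o, j, S, E, g, hj, hoc, hS, hgE, hg, hN, -⟩ := exists_dilation R x x' hxx'
    have h1 : ⊤ ≤ ((c ≫ y) ≫ D.pVt) ⁻¹ᵁ i.U := top_le_comp_preimage h c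
    have h2 : ⊤ ≤ ((j ≫ c ≫ y) ≫ D.pVt) ⁻¹ᵁ i.U := top_le_comp_preimage h1 j
    -- The translate by `(1, g⁻¹)` is `(M, g D, N)`.
    obtain ⟨z, hz, hzM, hzD, hzN⟩ := D.exists_point_Vt ((c ≫ y) ≫ D.pVt) i h1
      (D.matM' (c ≫ y) i h1) (E * D.matD' (c ≫ y) i h1) (D.matN' (c ≫ y) i h1)
    have h3 : ⊤ ≤ ((j ≫ z) ≫ D.pVt) ⁻¹ᵁ i.U := by rw [Category.assoc, hz]; exact h2
    have h4 : ⊤ ≤ (D.actPoint' (j ≫ c ≫ y) 1 g⁻¹ ≫ D.pVt) ⁻¹ᵁ i.U := by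
      rw [D.actPoint'_pVt]; exact h2
    refine hf.appLE_eq_zero hk hj hoc hS y z (hz.trans (Category.assoc _ _ _)) (1, g⁻¹) ?_ ?_ hy
    · change j ≫ z = D.actPoint' (j ≫ c ≫ y) 1 g⁻¹
      refine D.Vt_hom_ext ?_ i h3 h4 ?_ ?_ ?_
      · rw [D.actPoint'_pVt, Category.assoc, hz]; rfl
      · rw [D.matM'_act _ i h2, D.matM'_comp z i (hz ▸ h1) j, hzM, D.matM'_comp (c ≫ y) i h1 j,
          inv_one, Units.val_one, Matrix.one_mul]
      · rw [D.matD'_act _ i h2, D.matD'_comp z i (hz ▸ h1) j, hzD, matrix_map_mul, inv_inv, hgE,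
          D.matD'_comp (c ≫ y) i h1 j, Units.val_one, Matrix.mul_one]
      · rw [D.matN'_act _ i h2, D.matN'_comp z i (hz ▸ h1) j, hzN, D.matN'_comp (c ≫ y) i h1 j]
        refine (mul_inv_eq_of_mul_eq ?_).symm
        rw [hgE, ← matrix_map_mul, D.matN'_comp y i h c, hN _ _ hx]
    · refine Eq.trans ?_ (det_inv_mul_det g)
      refine congrArg₂ _ ((charValue_detInvDetChar 1 g⁻¹).trans ?_) hg.symm
      rw [inv_one, Units.val_one, Matrix.det_one, one_mul]
  · obtain ⟨I, hI⟩ := not_forall.mp h00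
    obtain ⟨b, hb⟩ := hR.mul_inv_cancel hI
    have h01 : ∀ J : Fin r → Fin n, ((D.matM' y i h).submatrix id J).det = 0 := fun J => by
      rw [← mul_one (Matrix.det _), ← hb, ← mul_assoc, h0 (J, I), zero_mul]
    obtain ⟨x, x', hx, hxx'⟩ := exists_vecMul_eq_zero_of_minors hR _ h01
    obtain ⟨A, A', c, o, j, S, E, g, hj, hoc, hS, hgE, hg, -, hM⟩ := exists_dilation R x x' hxx'
    have h1 : ⊤ ≤ ((c ≫ y) ≫ D.pVt) ⁻¹ᵁ i.U := top_le_comp_preimage h c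
    have h2 : ⊤ ≤ ((j ≫ c ≫ y) ≫ D.pVt) ⁻¹ᵁ i.U := top_le_comp_preimage h1 j
    -- The translate by `(g, 1)` is `(M, D g, N)`.
    obtain ⟨z, hz, hzM, hzD, hzN⟩ := D.exists_point_Vt ((c ≫ y) ≫ D.pVt) i h1
      (D.matM' (c ≫ y) i h1) (D.matD' (c ≫ y) i h1 * E) (D.matN' (c ≫ y) i h1)
    have h3 : ⊤ ≤ ((j ≫ z) ≫ D.pVt) ⁻¹ᵁ i.U := by rw [Category.assoc, hz]; exact h2
    have h4 : ⊤ ≤ (D.actPoint' (j ≫ c ≫ y) g 1 ≫ D.pVt) ⁻¹ᵁ i.U := by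
      rw [D.actPoint'_pVt]; exact h2
    refine hf.appLE_eq_zero hk hj hoc hS y z (hz.trans (Category.assoc _ _ _)) (g, 1) ?_ ?_ hy
    · change j ≫ z = D.actPoint' (j ≫ c ≫ y) g 1
      refine D.Vt_hom_ext ?_ i h3 h4 ?_ ?_ ?_
      · rw [D.actPoint'_pVt, Category.assoc, hz]; rfl
      · rw [D.matM'_act _ i h2, D.matM'_comp z i (hz ▸ h1) j, hzM, D.matM'_comp (c ≫ y) i h1 j]
        refine (inv_mul_eq_of_mul_eq ?_).symm
        rw [hgE, ← matrix_map_mul, D.matM'_comp y i h c, hM _ _ hx]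
      · rw [D.matD'_act _ i h2, D.matD'_comp z i (hz ▸ h1) j, hzD, matrix_map_mul, hgE,
          D.matD'_comp (c ≫ y) i h1 j, inv_one, Units.val_one, Matrix.one_mul]
      · rw [D.matN'_act _ i h2, D.matN'_comp z i (hz ▸ h1) j, hzN, D.matN'_comp (c ≫ y) i h1 j,
          Units.val_one, Matrix.mul_one]
    · refine Eq.trans ?_ (det_inv_mul_det g)
      refine congrArg₂ _ ((charValue_detInvDetChar g 1).trans ?_) hg.symm
      rw [Units.val_one, Matrix.det_one, mul_one]

/-- The charts of the semistable locus of `det`: the maximal minors of `N`. -/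
def chartsPlus : ChartSystem D.actV D.opens (detChar r) (Fin r → Fin n) where
  δ v i h I := ((D.matN v i h).submatrix I id).det
  δ_comp u v i h h' I := by
    rw [D.matN_comp v i h u h', ← det_matrix_map]
    rfl
  δ_act {T} v g i h h' I := by
    let g' : GL (Fin r) Γ(T, ⊤) := g
    have key := congrArg (fun P => (P.submatrix I id).det) (D.matN_act v i h g' h')
    refine key.trans (Eq.trans ?_ (mul_comm _ _))
    exact Matrix.det_mul ((D.matN v i h).submatrix I id) g'.val
  exists_equivariant {P} w i h I hu := by
    let γ : GL (Fin r) Γ(P, ⊤) := Matrix.GeneralLinearGroup.mk'' _ hu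
    refine ⟨γ, fun T u v g e => ?_⟩
    let g' : GL (Fin r) Γ(T, ⊤) := g
    have e' : D.actPoint (u ≫ w) g' = v ≫ w := e
    have h1 : ⊤ ≤ ((u ≫ w) ≫ D.pV) ⁻¹ᵁ i.U := top_le_comp_preimage h u
    have h2 : ⊤ ≤ ((v ≫ w) ≫ D.pV) ⁻¹ᵁ i.U := top_le_comp_preimage h v
    have key := D.matN_congr e' i (e' ▸ h2) h2
    rw [D.matN_act _ i h1, D.matN_comp w i h u, D.matN_comp w i h v] at key
    exact Units.ext (congrArg (fun P => P.submatrix I id) key).symm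
  vanish := D.vanish_plus

/-- The charts of the semistable locus of `det⁻¹`: the maximal minors of `M`. -/
def chartsMinus : ChartSystem D.actV D.opens (detInvChar r) (Fin r → Fin n) where
  δ v i h I := ((D.matM v i h).submatrix id I).det
  δ_comp u v i h h' I := by
    rw [D.matM_comp v i h u h', ← det_matrix_map]
    rfl
  δ_act {T} v g i h h' I := by
    let g' : GL (Fin r) Γ(T, ⊤) := g
    have key := congrArg (fun P => (P.submatrix id I).det) (D.matM_act v i h g' h')
    exact key.trans (Matrix.det_mul (g'⁻¹).val ((D.matM v i h).submatrix id I))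
  exists_equivariant {P} w i h I hu := by
    let γ : GL (Fin r) Γ(P, ⊤) := Matrix.GeneralLinearGroup.mk'' _ hu
    refine ⟨γ⁻¹, fun T u v g e => ?_⟩
    let g' : GL (Fin r) Γ(T, ⊤) := g
    have e' : D.actPoint (u ≫ w) g' = v ≫ w := e
    have h1 : ⊤ ≤ ((u ≫ w) ≫ D.pV) ⁻¹ᵁ i.U := top_le_comp_preimage h u
    have h2 : ⊤ ≤ ((v ≫ w) ≫ D.pV) ⁻¹ᵁ i.U := top_le_comp_preimage h v
    have key := D.matM_congr e' i (e' ▸ h2) h2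
    rw [D.matM_act _ i h1, D.matM_comp w i h u, D.matM_comp w i h v] at key
    exact map_inv_eq_map_inv_mul u v γ g'
      (Units.ext (congrArg (fun P => P.submatrix id I) key).symm)
  vanish := D.vanish_minus

/-- The charts of the semistable locus of `Ṽ`: the products of maximal minors of `M` and `N`. -/
def chartsTilde :
    ChartSystem D.actVt D.opens (detInvDetChar r) ((Fin r → Fin n) × (Fin r → Fin n)) where
  δ v i h I := ((D.matM' v i h).submatrix id I.1).det * ((D.matN' v i h).submatrix I.2 id).det
  δ_comp u v i h h' I := by
    rw [D.matM'_comp v i h u h', D.matN'_comp v i h u h', map_mul, ← det_matrix_map,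
      ← det_matrix_map]
    rfl
  δ_act {T} v g i h h' I := by
    obtain ⟨g₁, g₂, rfl⟩ : ∃ g₁ g₂ : GL (Fin r) Γ(T, ⊤), (g₁, g₂) = g := ⟨g.1, g.2, rfl⟩
    have key := congrArg (fun P => (P.submatrix id I.1).det) (D.matM'_act v i h g₁ g₂ h')
    have key' := congrArg (fun P => (P.submatrix I.2 id).det) (D.matN'_act v i h g₁ g₂ h')
    refine (congrArg₂ _ (key.trans (Matrix.det_mul (g₁⁻¹).val ((D.matM' v i h).submatrix id I.1)))
      ((key'.trans (Matrix.det_mul ((D.matN' v i h).submatrix I.2 id) g₂.val)).trans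
        (mul_comm _ _))).trans ?_
    exact mul_mul_mul_comm _ _ _ _
  exists_equivariant {P} w i h I hu := by
    let γ₁ : GL (Fin r) Γ(P, ⊤) :=
      Matrix.GeneralLinearGroup.mk'' _ (isUnit_of_mul_isUnit_left hu)
    let γ₂ : GL (Fin r) Γ(P, ⊤) :=
      Matrix.GeneralLinearGroup.mk'' _ (isUnit_of_mul_isUnit_right hu)
    refine ⟨(γ₁⁻¹, γ₂), fun T u v g e => ?_⟩
    obtain ⟨g₁, g₂, rfl⟩ : ∃ g₁ g₂ : GL (Fin r) Γ(T, ⊤), (g₁, g₂) = g := ⟨g.1, g.2, rfl⟩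
    have e' : D.actPoint' (u ≫ w) g₁ g₂ = v ≫ w := e
    have h1 : ⊤ ≤ ((u ≫ w) ≫ D.pVt) ⁻¹ᵁ i.U := top_le_comp_preimage h u
    have h2 : ⊤ ≤ ((v ≫ w) ≫ D.pVt) ⁻¹ᵁ i.U := top_le_comp_preimage h v
    have key := D.matM'_congr e' i (e' ▸ h2) h2
    have key' := D.matN'_congr e' i (e' ▸ h2) h2
    rw [D.matM'_act _ i h1, D.matM'_comp w i h u, D.matM'_comp w i h v] at key
    rw [D.matN'_act _ i h1, D.matN'_comp w i h u, D.matN'_comp w i h v] at key'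
    exact Prod.ext (map_inv_eq_map_inv_mul u v γ₁ g₁
        (Units.ext (congrArg (fun P => P.submatrix id I.1) key).symm))
      (Units.ext (congrArg (fun P => P.submatrix I.2 id) key').symm)
  vanish := D.vanish_tilde

theorem isAffineOpen_preimage_pV (k : LocalModel.Ix D.opens) (hk : IsAffineOpen k.W) :
    IsAffineOpen (D.pV ⁻¹ᵁ k.W) := isAffineOpen_preimage_toBase k hk

theorem isAffineOpen_preimage_pVt (k : LocalModel.Ix D.opens) (hk : IsAffineOpen k.W) :
    IsAffineOpen (D.pVt ⁻¹ᵁ k.W) := isAffineOpen_preimage_toBase k hk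

end GrassmannFlopData

/-! ### Morphisms induced on quotients -/

section Induced

variable {𝒢 : GroupFunctor} {V B : Scheme.{0}} {p : V ⟶ B} {ρ : RightAction 𝒢 p} {θ : 𝒢 ⟶ Gm}

namespace GITQuotient

/-- An invariant morphism descends uniquely to a principal GIT quotient. -/
theorem existsUnique_isInducedTo {Q : GITQuotient ρ θ} (hQ : ρ.IsPrincipalQuotient Q.π)
    {Y : Scheme.{0}} (φ : V ⟶ Y)
    (hφ : ∀ (T : Scheme.{0}) (v : T ⟶ V) (g : 𝒢.obj (op T)), ρ.act v g ≫ φ = v ≫ φ) :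
    ∃! f : Q.X ⟶ Y, Q.IsInducedTo φ f := by
  obtain ⟨f, hf⟩ := hQ.exists_desc ((ρ.semistableLocus θ).ι ≫ φ) (by
    rintro T v w ⟨g, hg⟩
    rw [← Category.assoc, ← Category.assoc, ← hg, hφ])
  exact ⟨f, hf, fun f' hf' => Q.isGoodQuotient.hom_ext (hf'.trans hf.symm)⟩

variable {𝒢' : GroupFunctor} {V' B' : Scheme.{0}} {p' : V' ⟶ B'} {ρ' : RightAction 𝒢' p'}
    {θ' : 𝒢' ⟶ Gm}

/-- A morphism that preserves orbits and semistability descends uniquely to the GIT quotients, if the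
first one is principal. -/
theorem existsUnique_isInduced {Q : GITQuotient ρ θ} (hQ : ρ.IsPrincipalQuotient Q.π)
    (Q' : GITQuotient ρ' θ') (φ : V ⟶ V')
    (hs : ∀ x ∈ ρ.semistableLocus θ, φ x ∈ ρ'.semistableLocus θ')
    (hφ : ∀ (T : Scheme.{0}) (v : T ⟶ V) (g : 𝒢.obj (op T)), ∃ g' : 𝒢'.obj (op T),
      ρ'.act (v ≫ φ) g' = ρ.act v g ≫ φ) :
    ∃! f : Q.X ⟶ Q'.X, Q.IsInduced Q' φ f := by
  let s : (ρ.semistableLocus θ).toScheme ⟶ (ρ'.semistableLocus θ').toScheme :=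
    liftOpen _ ((ρ.semistableLocus θ).ι ≫ φ) fun t => hs _ (ι_apply_mem t)
  have hs' : s ≫ (ρ'.semistableLocus θ').ι = (ρ.semistableLocus θ).ι ≫ φ := liftOpen_ι _ _ _
  obtain ⟨f, hf⟩ := hQ.exists_desc (s ≫ Q'.π) (by
    rintro T v w ⟨g, hg⟩
    obtain ⟨g', hg'⟩ := hφ T (v ≫ (ρ.semistableLocus θ).ι) g
    rw [← Category.assoc, ← Category.assoc]
    refine Q'.isGoodQuotient.invariant T _ _ ⟨g', ?_⟩
    rw [Category.assoc, Category.assoc, hs', ← Category.assoc, ← Category.assoc, hg', hg])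
  refine ⟨f, ⟨s, hs', hf⟩, ?_⟩
  rintro f' ⟨s', hs'', hf'⟩
  obtain rfl : s' = s := by rw [← cancel_mono (ρ'.semistableLocus θ').ι, hs', hs'']
  exact Q.isGoodQuotient.hom_ext (hf'.trans hf.symm)

end GITQuotient

end Induced

/-! ### A local criterion for cartesian squares, and cancellation of matrices -/

section Local

/-- A commutative square is cartesian if its universal property holds locally. -/
theorem isPullback_of_local {X Y Z H : Scheme.{0}} {f : X ⟶ Y} {g : X ⟶ Z} {h : Y ⟶ H} {k : Z ⟶ H}
    (w : f ≫ h = g ≫ k)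
    (uniq : ∀ (T : Scheme.{0}) (l l' : T ⟶ X), l ≫ f = l' ≫ f → l ≫ g = l' ≫ g → l = l')
    (ex : ∀ (T : Scheme.{0}) (a : T ⟶ Y) (b : T ⟶ Z), a ≫ h = b ≫ k → ∀ x : T,
      ∃ (T' : Scheme.{0}) (u : T' ⟶ T) (_ : IsOpenImmersion u) (t : T') (l : T' ⟶ X), u t = x ∧
        l ≫ f = u ≫ a ∧ l ≫ g = u ≫ b) : IsPullback f g h k := by
  have key : ∀ (T : Scheme.{0}) (a : T ⟶ Y) (b : T ⟶ Z), a ≫ h = b ≫ k →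
      ∃ l : T ⟶ X, l ≫ f = a ∧ l ≫ g = b := by
    intro T a b e
    have ex' : ∀ x : T, ∃ (W : T.Opens) (l : W.toScheme ⟶ X), x ∈ W ∧ l ≫ f = W.ι ≫ a ∧
        l ≫ g = W.ι ≫ b := by
      intro x
      obtain ⟨T', u, hu, t, l, rfl, hf, hg⟩ := ex T a b e x
      refine ⟨u.opensRange, u.isoOpensRange.inv ≫ l, ⟨t, rfl⟩, ?_, ?_⟩
      · rw [← u.isoOpensRange_inv_comp, Category.assoc, Category.assoc, hf]
      · rw [← u.isoOpensRange_inv_comp, Category.assoc, Category.assoc, hg]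
    choose W l hW hf hg using ex'
    obtain ⟨L, hL⟩ := exists_glue W (fun x => ⟨x, hW x⟩) l (by
      intro i j T a' b' hab
      apply uniq
      · rw [Category.assoc, Category.assoc, hf, hf, ← Category.assoc, hab, Category.assoc]
      · rw [Category.assoc, Category.assoc, hg, hg, ← Category.assoc, hab, Category.assoc])
    refine ⟨L, Scheme.hom_ext_of_forall _ _ fun x => ⟨W x, hW x, ?_⟩,
      Scheme.hom_ext_of_forall _ _ fun x => ⟨W x, hW x, ?_⟩⟩
    · rw [← Category.assoc, hL, hf]
    · rw [← Category.assoc, hL, hg]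
  refine ⟨⟨w⟩, ⟨Limits.PullbackCone.IsLimit.mk w
    (fun s => (key s.pt s.fst s.snd s.condition).choose)
    (fun s => (key s.pt s.fst s.snd s.condition).choose_spec.1)
    (fun s => (key s.pt s.fst s.snd s.condition).choose_spec.2)
    fun s m hm hm' => uniq _ _ _ ?_ ?_⟩⟩
  · rw [hm, (key s.pt s.fst s.snd s.condition).choose_spec.1]
  · rw [hm', (key s.pt s.fst s.snd s.condition).choose_spec.2]

theorem eq_of_mul_eq_mul_of_isUnit_det {l m k : ℕ} {R : Type} [CommRing R]
    {P Q : Matrix (Fin l) (Fin m) R} {M : Matrix (Fin m) (Fin k) R} (J : Fin m → Fin k)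
    (hJ : IsUnit (M.submatrix id J).det) (h : P * M = Q * M) : P = Q := by
  have h' : P * M.submatrix id J = Q * M.submatrix id J :=
    congrArg (fun A => A.submatrix id J) h
  rw [← Matrix.mul_one P, ← Matrix.mul_nonsing_inv _ hJ, ← Matrix.mul_assoc, h',
    Matrix.mul_assoc, Matrix.mul_nonsing_inv _ hJ, Matrix.mul_one]

/-- If `N M = N' M'`, where `N` has a left inverse and `M'` a right inverse given by submatrices, then
both sides arise from a product `N E M'`. -/
theorem exists_mul_eq_and_mul_eq {m k : ℕ} {R : Type} [CommRing R]
    {N N' : Matrix (Fin k) (Fin m) R} {M M' : Matrix (Fin m) (Fin k) R} (I J : Fin m → Fin k)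
    (hI : IsUnit (N.submatrix I id).det) (hJ : IsUnit (M'.submatrix id J).det)
    (h : N * M = N' * M') : ∃ E : Matrix (Fin m) (Fin m) R, E * M' = M ∧ N * E = N' := by
  have h1 : N'.submatrix I id * M' = N.submatrix I id * M :=
    (congrArg (fun A => A.submatrix I id) h).symm
  have hE : (N.submatrix I id)⁻¹ * N'.submatrix I id * M' = M := by
    rw [Matrix.mul_assoc, h1, ← Matrix.mul_assoc, Matrix.nonsing_inv_mul _ hI, Matrix.one_mul]
  exact ⟨_, hE, eq_of_mul_eq_mul_of_isUnit_det J hJ (by rw [Matrix.mul_assoc, hE, h])⟩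

end Local

/-! ### The maps between total spaces -/

namespace GrassmannFlopData

variable {B : Scheme.{0}} {n r : ℕ} (D : GrassmannFlopData B n r) {T T' : Scheme.{0}}

theorem exists_mem_frame (x : B) : ∃ i : Frame D.bundles, x ∈ i.U :=
  Opens.mem_iSup.mp (D.iSup_opens ▸ Opens.mem_top x : x ∈ ⨆ i, D.opens i)

theorem exists_frame_nhds (q : T ⟶ B) (t : T) : ∃ (W : T.Opens) (i : Frame D.bundles),
    t ∈ W ∧ ⊤ ≤ (W.ι ≫ q) ⁻¹ᵁ i.U := by
  obtain ⟨i, hi⟩ := D.exists_mem_frame (q t)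
  exact ⟨q ⁻¹ᵁ i.U, i, hi, top_le_ι_preimage le_rfl⟩

theorem V_hom_ext_local {v w : T ⟶ D.V} (e : v ≫ D.pV = w ≫ D.pV)
    (h : ∀ (T' : Scheme.{0}) (u : T' ⟶ T) (i : Frame D.bundles)
      (hv : ⊤ ≤ ((u ≫ v) ≫ D.pV) ⁻¹ᵁ i.U) (hw : ⊤ ≤ ((u ≫ w) ≫ D.pV) ⁻¹ᵁ i.U),
      D.matM (u ≫ v) i hv = D.matM (u ≫ w) i hw ∧ D.matN (u ≫ v) i hv = D.matN (u ≫ w) i hw) :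
    v = w := by
  refine Scheme.hom_ext_of_forall _ _ fun t => ?_
  obtain ⟨W, i, ht, hi⟩ := D.exists_frame_nhds (v ≫ D.pV) t
  have hw : ⊤ ≤ ((W.ι ≫ w) ≫ D.pV) ⁻¹ᵁ i.U := by rw [Category.assoc, ← e]; exact hi
  have hv : ⊤ ≤ ((W.ι ≫ v) ≫ D.pV) ⁻¹ᵁ i.U := hi
  obtain ⟨h1, h2⟩ := h _ W.ι i hv hw
  exact ⟨W, ht, D.V_hom_ext (by rw [Category.assoc, Category.assoc, e]) i hv hw h1 h2⟩

theorem H_hom_ext_local {v w : T ⟶ D.H}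
    (e : v ≫ D.pH = w ≫ D.pH)
    (h : ∀ (T' : Scheme.{0}) (u : T' ⟶ T) (i : Frame D.bundles)
      (hv : ⊤ ≤ ((u ≫ v) ≫ D.pH) ⁻¹ᵁ i.U)
      (hw : ⊤ ≤ ((u ≫ w) ≫ D.pH) ⁻¹ᵁ i.U),
      D.matH (u ≫ v) i hv = D.matH (u ≫ w) i hw) : v = w := by
  refine Scheme.hom_ext_of_forall _ _ fun t => ?_
  obtain ⟨W, i, ht, hi⟩ := D.exists_frame_nhds (v ≫ D.pH) t
  have hw : ⊤ ≤ ((W.ι ≫ w) ≫ D.pH) ⁻¹ᵁ i.U := by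
    rw [Category.assoc, ← e]; exact hi
  have hv : ⊤ ≤ ((W.ι ≫ v) ≫ D.pH) ⁻¹ᵁ i.U := hi
  exact ⟨W, ht, D.H_hom_ext (by rw [Category.assoc, Category.assoc, e]) i hv hw (h _ _ _ _ _)⟩

theorem comp_actPoint (u : T' ⟶ T) (v : T ⟶ D.V) (g : GL (Fin r) Γ(T, ⊤)) :
    u ≫ D.actPoint v g = D.actPoint (u ≫ v) (Matrix.GeneralLinearGroup.map u.appTop.hom g) :=
  D.actV.comp_act u v g

theorem comp_actPoint' (u : T' ⟶ T) (v : T ⟶ D.Vt) (g₁ g₂ : GL (Fin r) Γ(T, ⊤)) :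
    u ≫ D.actPoint' v g₁ g₂ = D.actPoint' (u ≫ v) (Matrix.GeneralLinearGroup.map u.appTop.hom g₁)
      (Matrix.GeneralLinearGroup.map u.appTop.hom g₂) :=
  D.actVt.comp_act u v (g₁, g₂)

theorem inv_val_mul_val (g : GL (Fin r) Γ(T, ⊤)) : (g⁻¹).val * g.val = 1 := by
  rw [← Units.val_mul, inv_mul_cancel, Units.val_one]

theorem val_mul_inv_val (g : GL (Fin r) Γ(T, ⊤)) : g.val * (g⁻¹).val = 1 := by
  rw [← Units.val_mul, mul_inv_cancel, Units.val_one]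

theorem actPoint_toH (v : T ⟶ D.V) (g : GL (Fin r) Γ(T, ⊤)) :
    D.actPoint v g ≫ D.toH = v ≫ D.toH := by
  refine D.H_hom_ext_local ?_ fun T' u i hv hw => ?_
  · rw [Category.assoc, Category.assoc, toH_pH, actPoint_pV]
  · let g' := Matrix.GeneralLinearGroup.map u.appTop.hom g
    have e1 : u ≫ D.actPoint v g ≫ D.toH = D.actPoint (u ≫ v) g' ≫ D.toH := by
      rw [← Category.assoc, comp_actPoint]
    have e2 : u ≫ v ≫ D.toH = (u ≫ v) ≫ D.toH := (Category.assoc _ _ _).symm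
    have h2 : ⊤ ≤ ((u ≫ v) ≫ D.pV) ⁻¹ᵁ i.U := by
      rw [← toH_pH, ← Category.assoc, ← e2]; exact hw
    have h1 : ⊤ ≤ (D.actPoint (u ≫ v) g' ≫ D.pV) ⁻¹ᵁ i.U := by rw [actPoint_pV]; exact h2
    rw [D.matH_congr e1 i hv (e1 ▸ hv), D.matH_congr e2 i hw (e2 ▸ hw), D.matH_toH _ i h1,
      D.matH_toH _ i h2, D.matN_act _ i h2, D.matM_act _ i h2, Matrix.mul_assoc,
      ← Matrix.mul_assoc g'.val, val_mul_inv_val, Matrix.one_mul]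

theorem actPoint'_toVPlus (v : T ⟶ D.Vt) (g₁ g₂ : GL (Fin r) Γ(T, ⊤)) :
    D.actPoint (v ≫ D.toVPlus) g₂ = D.actPoint' v g₁ g₂ ≫ D.toVPlus := by
  refine D.V_hom_ext_local ?_ fun T' u i hv hw => ?_
  · rw [actPoint_pV, Category.assoc, Category.assoc, toVPlus_pV, actPoint'_pVt]
  · let g₁' := Matrix.GeneralLinearGroup.map u.appTop.hom g₁
    let g₂' := Matrix.GeneralLinearGroup.map u.appTop.hom g₂
    have e1 : u ≫ D.actPoint (v ≫ D.toVPlus) g₂ = D.actPoint ((u ≫ v) ≫ D.toVPlus) g₂' := by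
      rw [Category.assoc]; exact D.comp_actPoint _ _ _
    have e2 : u ≫ D.actPoint' v g₁ g₂ ≫ D.toVPlus = D.actPoint' (u ≫ v) g₁' g₂' ≫ D.toVPlus := by
      rw [← Category.assoc, comp_actPoint']
    have h1 : ⊤ ≤ ((u ≫ v) ≫ D.pVt) ⁻¹ᵁ i.U := by
      have := e1 ▸ hv
      rwa [actPoint_pV, Category.assoc, toVPlus_pV] at this
    have h2 : ⊤ ≤ (((u ≫ v) ≫ D.toVPlus) ≫ D.pV) ⁻¹ᵁ i.U := by
      rw [Category.assoc, toVPlus_pV]; exact h1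
    have h3 : ⊤ ≤ (D.actPoint' (u ≫ v) g₁' g₂' ≫ D.pVt) ⁻¹ᵁ i.U := by
      rw [actPoint'_pVt]; exact h1
    constructor
    · rw [D.matM_congr e1 i hv (e1 ▸ hv), D.matM_congr e2 i hw (e2 ▸ hw), D.matM_act _ i h2,
        D.matM_toVPlus _ i h1, D.matM_toVPlus _ i h3, D.matD'_act _ i h1, D.matM'_act _ i h1,
        Matrix.mul_assoc, Matrix.mul_assoc, ← Matrix.mul_assoc g₁'.val, val_mul_inv_val,
        Matrix.one_mul]
    · rw [D.matN_congr e1 i hv (e1 ▸ hv), D.matN_congr e2 i hw (e2 ▸ hw), D.matN_act _ i h2,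
        D.matN_toVPlus _ i h1, D.matN_toVPlus _ i h3, D.matN'_act _ i h1]

theorem actPoint'_toVMinus (v : T ⟶ D.Vt) (g₁ g₂ : GL (Fin r) Γ(T, ⊤)) :
    D.actPoint (v ≫ D.toVMinus) g₁ = D.actPoint' v g₁ g₂ ≫ D.toVMinus := by
  refine D.V_hom_ext_local ?_ fun T' u i hv hw => ?_
  · rw [actPoint_pV, Category.assoc, Category.assoc, toVMinus_pV, actPoint'_pVt]
  · let g₁' := Matrix.GeneralLinearGroup.map u.appTop.hom g₁
    let g₂' := Matrix.GeneralLinearGroup.map u.appTop.hom g₂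
    have e1 : u ≫ D.actPoint (v ≫ D.toVMinus) g₁ = D.actPoint ((u ≫ v) ≫ D.toVMinus) g₁' := by
      rw [Category.assoc]; exact D.comp_actPoint _ _ _
    have e2 : u ≫ D.actPoint' v g₁ g₂ ≫ D.toVMinus = D.actPoint' (u ≫ v) g₁' g₂' ≫ D.toVMinus := by
      rw [← Category.assoc, comp_actPoint']
    have h1 : ⊤ ≤ ((u ≫ v) ≫ D.pVt) ⁻¹ᵁ i.U := by
      have := e1 ▸ hv
      rwa [actPoint_pV, Category.assoc, toVMinus_pV] at this
    have h2 : ⊤ ≤ (((u ≫ v) ≫ D.toVMinus) ≫ D.pV) ⁻¹ᵁ i.U := by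
      rw [Category.assoc, toVMinus_pV]; exact h1
    have h3 : ⊤ ≤ (D.actPoint' (u ≫ v) g₁' g₂' ≫ D.pVt) ⁻¹ᵁ i.U := by
      rw [actPoint'_pVt]; exact h1
    constructor
    · rw [D.matM_congr e1 i hv (e1 ▸ hv), D.matM_congr e2 i hw (e2 ▸ hw), D.matM_act _ i h2,
        D.matM_toVMinus _ i h1, D.matM_toVMinus _ i h3, D.matM'_act _ i h1]
    · rw [D.matN_congr e1 i hv (e1 ▸ hv), D.matN_congr e2 i hw (e2 ▸ hw), D.matN_act _ i h2,
        D.matN_toVMinus _ i h1, D.matN_toVMinus _ i h3, D.matD'_act _ i h1, D.matN'_act _ i h1,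
        Matrix.mul_assoc (D.matN' _ _ _) g₂'.val, ← Matrix.mul_assoc g₂'.val, val_mul_inv_val,
        Matrix.one_mul, Matrix.mul_assoc]

theorem toVPlus_toH : D.toVPlus ≫ D.toH = D.toVMinus ≫ D.toH := by
  refine D.H_hom_ext_local ?_ fun T' u i hv hw => ?_
  · rw [Category.assoc, Category.assoc, toH_pH, toVPlus_pV, toVMinus_pV]
  · have e1 : u ≫ D.toVPlus ≫ D.toH = (u ≫ D.toVPlus) ≫ D.toH := (Category.assoc _ _ _).symm
    have e2 : u ≫ D.toVMinus ≫ D.toH = (u ≫ D.toVMinus) ≫ D.toH := (Category.assoc _ _ _).symm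
    have h0 : ⊤ ≤ (u ≫ D.pVt) ⁻¹ᵁ i.U := by
      rw [← toVPlus_pV, ← toH_pH]
      simpa only [Category.assoc] using hv
    have h1 : ⊤ ≤ ((u ≫ D.toVPlus) ≫ D.pV) ⁻¹ᵁ i.U := by
      rw [Category.assoc, toVPlus_pV]; exact h0
    have h2 : ⊤ ≤ ((u ≫ D.toVMinus) ≫ D.pV) ⁻¹ᵁ i.U := by
      rw [Category.assoc, toVMinus_pV]; exact h0
    rw [D.matH_congr e1 i hv (e1 ▸ hv), D.matH_congr e2 i hw (e2 ▸ hw), D.matH_toH _ i h1,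
      D.matH_toH _ i h2, D.matN_toVPlus _ i h0, D.matM_toVPlus _ i h0, D.matN_toVMinus _ i h0,
      D.matM_toVMinus _ i h0, Matrix.mul_assoc]

/-- Near a semistable point of `Ṽ`, maximal minors of `M` and `N` are invertible. -/
theorem exists_isUnit_tilde (v : T ⟶ D.Vt) (t : T)
    (ht : v t ∈ D.actVt.semistableLocus (detInvDetChar r)) :
    ∃ (W : T.Opens) (i : Frame D.bundles) (J I : Fin r → Fin n), t ∈ W ∧
      ∀ (T' : Scheme.{0}) (u : T' ⟶ T), (∀ t', u t' ∈ W) →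
        ∃ h : ⊤ ≤ ((u ≫ v) ≫ D.pVt) ⁻¹ᵁ i.U,
          IsUnit ((D.matM' (u ≫ v) i h).submatrix id J).det ∧
          IsUnit ((D.matN' (u ≫ v) i h).submatrix I id).det := by
  obtain ⟨i, hi⟩ := D.exists_mem_frame (D.pVt (v t))
  obtain ⟨W, j, htW, hW⟩ := D.chartsTilde.exists_isUnit v t ht i hi
  refine ⟨W, i, j.1, j.2, htW, fun T' u hu => ?_⟩
  obtain ⟨h, hj⟩ := hW T' u hu
  exact ⟨h, isUnit_of_mul_isUnit_left hj, isUnit_of_mul_isUnit_right hj⟩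

theorem mem_semistableLocus_tilde (v : T ⟶ D.Vt) (i : Frame D.bundles)
    (h : ⊤ ≤ (v ≫ D.pVt) ⁻¹ᵁ i.U) (J I : Fin r → Fin n)
    (hJ : IsUnit ((D.matM' v i h).submatrix id J).det)
    (hI : IsUnit ((D.matN' v i h).submatrix I id).det) (t : T) :
    v t ∈ D.actVt.semistableLocus (detInvDetChar r) :=
  D.chartsTilde.mem_semistableLocus D.isAffineOpen_preimage_pVt v i h (J, I) (hJ.mul hI) t

theorem toVPlus_mem {x : D.Vt} (hx : x ∈ D.actVt.semistableLocus (detInvDetChar r)) :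
    D.toVPlus x ∈ D.actV.semistableLocus (detChar r) := by
  obtain ⟨W, i, J, I, hxW, hW⟩ := D.exists_isUnit_tilde (𝟙 _) x hx
  obtain ⟨h, -, hI⟩ := hW _ W.ι ι_apply_mem
  obtain ⟨t, rfl⟩ := exists_ι_apply hxW
  rw [← Scheme.Hom.comp_apply, ← Category.comp_id W.ι]
  have h' : ⊤ ≤ (((W.ι ≫ 𝟙 _) ≫ D.toVPlus) ≫ D.pV) ⁻¹ᵁ i.U := by
    rw [Category.assoc, toVPlus_pV]; exact h
  refine D.chartsPlus.mem_semistableLocus D.isAffineOpen_preimage_pV _ i h' I ?_ t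
  rw [← D.matN_toVPlus _ i h h'] at hI
  exact hI

theorem toVMinus_mem {x : D.Vt} (hx : x ∈ D.actVt.semistableLocus (detInvDetChar r)) :
    D.toVMinus x ∈ D.actV.semistableLocus (detInvChar r) := by
  obtain ⟨W, i, J, I, hxW, hW⟩ := D.exists_isUnit_tilde (𝟙 _) x hx
  obtain ⟨h, hJ, -⟩ := hW _ W.ι ι_apply_mem
  obtain ⟨t, rfl⟩ := exists_ι_apply hxW
  rw [← Scheme.Hom.comp_apply, ← Category.comp_id W.ι]
  have h' : ⊤ ≤ (((W.ι ≫ 𝟙 _) ≫ D.toVMinus) ≫ D.pV) ⁻¹ᵁ i.U := by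
    rw [Category.assoc, toVMinus_pV]; exact h
  refine D.chartsMinus.mem_semistableLocus D.isAffineOpen_preimage_pV _ i h' J ?_ t
  rw [← D.matM_toVMinus _ i h h'] at hJ
  exact hJ

/-! ### The cartesian square -/

/-- Points of `Ṽ` whose images under both maps to `V` are in the same orbit are in the same orbit,
if `M` is surjective. -/
theorem actPoint'_eq_of_actPoint_eq (v w : T ⟶ D.Vt) (i : Frame D.bundles)
    (hv : ⊤ ≤ (v ≫ D.pVt) ⁻¹ᵁ i.U) (J : Fin r → Fin n)
    (hJ : IsUnit ((D.matM' v i hv).submatrix id J).det) (g₁ g₂ : GL (Fin r) Γ(T, ⊤))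
    (e₁ : D.actPoint (v ≫ D.toVMinus) g₁ = w ≫ D.toVMinus)
    (e₂ : D.actPoint (v ≫ D.toVPlus) g₂ = w ≫ D.toVPlus) : D.actPoint' v g₁ g₂ = w := by
  have e : v ≫ D.pVt = w ≫ D.pVt := by
    have := congrArg (· ≫ D.pV) e₂
    simpa only [actPoint_pV, Category.assoc, toVPlus_pV] using this
  have hw : ⊤ ≤ (w ≫ D.pVt) ⁻¹ᵁ i.U := e ▸ hv
  have hv1 : ⊤ ≤ ((v ≫ D.toVMinus) ≫ D.pV) ⁻¹ᵁ i.U := by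
    rw [Category.assoc, toVMinus_pV]; exact hv
  have hv2 : ⊤ ≤ ((v ≫ D.toVPlus) ≫ D.pV) ⁻¹ᵁ i.U := by
    rw [Category.assoc, toVPlus_pV]; exact hv
  have hw1 : ⊤ ≤ ((w ≫ D.toVMinus) ≫ D.pV) ⁻¹ᵁ i.U := by
    rw [Category.assoc, toVMinus_pV]; exact hw
  have hw2 : ⊤ ≤ ((w ≫ D.toVPlus) ≫ D.pV) ⁻¹ᵁ i.U := by
    rw [Category.assoc, toVPlus_pV]; exact hw
  have hM := D.matM_congr e₁ i (e₁ ▸ hw1) hw1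
  rw [D.matM_act _ i hv1, D.matM_toVMinus _ i hv, D.matM_toVMinus _ i hw] at hM
  have hN := D.matN_congr e₂ i (e₂ ▸ hw2) hw2
  rw [D.matN_act _ i hv2, D.matN_toVPlus _ i hv, D.matN_toVPlus _ i hw] at hN
  have hD := D.matM_congr e₂ i (e₂ ▸ hw2) hw2
  rw [D.matM_act _ i hv2, D.matM_toVPlus _ i hv, D.matM_toVPlus _ i hw, ← hM,
    ← Matrix.mul_assoc, ← Matrix.mul_assoc] at hD
  have hD' := eq_of_mul_eq_mul_of_isUnit_det J hJ hD
  refine D.Vt_hom_ext ((D.actPoint'_pVt v g₁ g₂).trans e) i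
    (by rw [actPoint'_pVt]; exact hv) hw ?_ ?_ ?_
  · rw [D.matM'_act _ i hv, hM]
  · rw [D.matD'_act _ i hv, ← Matrix.mul_assoc, hD', Matrix.mul_assoc, inv_val_mul_val,
      Matrix.mul_one]
  · rw [D.matN'_act _ i hv, hN]

theorem comp_pV_eq {v w : T ⟶ D.V} (e : v ≫ D.toH = w ≫ D.toH) : v ≫ D.pV = w ≫ D.pV := by
  rw [← toH_pH, ← Category.assoc, e, Category.assoc]

/-- Points `(M₁, N₁)` and `(M₂, N₂)` of `V` with `N₁ M₁ = N₂ M₂`, with `N₁` injective and `M₂`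
surjective, are the images of the point `(M₂, D, N₁)` of `Ṽ`, where `D` is determined by
`N₁ D = N₂`. -/
theorem exists_point_tilde (v w : T ⟶ D.V) (e : v ≫ D.toH = w ≫ D.toH) (i : Frame D.bundles)
    (hv : ⊤ ≤ (v ≫ D.pV) ⁻¹ᵁ i.U) (hw : ⊤ ≤ (w ≫ D.pV) ⁻¹ᵁ i.U) (I J : Fin r → Fin n)
    (hI : IsUnit ((D.matN v i hv).submatrix I id).det)
    (hJ : IsUnit ((D.matM w i hw).submatrix id J).det) :
    ∃ z : T ⟶ D.Vt, z ≫ D.toVPlus = v ∧ z ≫ D.toVMinus = w ∧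
      ∀ t, z t ∈ D.actVt.semistableLocus (detInvDetChar r) := by
  have eB : v ≫ D.pV = w ≫ D.pV := D.comp_pV_eq e
  have hvH : ⊤ ≤ ((v ≫ D.toH) ≫ D.pH) ⁻¹ᵁ i.U := by
    rw [Category.assoc, toH_pH]; exact hv
  have key := D.matH_congr e i hvH (e ▸ hvH)
  rw [D.matH_toH v i hv, D.matH_toH w i hw] at key
  obtain ⟨E, hE, hE'⟩ := exists_mul_eq_and_mul_eq I J hI hJ key
  obtain ⟨z, hz, hzM, hzD, hzN⟩ := D.exists_point_Vt (v ≫ D.pV) i hv (D.matM w i hw) E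
    (D.matN v i hv)
  have hz0 : ⊤ ≤ (z ≫ D.pVt) ⁻¹ᵁ i.U := hz ▸ hv
  have hzp : ⊤ ≤ ((z ≫ D.toVPlus) ≫ D.pV) ⁻¹ᵁ i.U := by
    rw [Category.assoc, toVPlus_pV]; exact hz0
  have hzm : ⊤ ≤ ((z ≫ D.toVMinus) ≫ D.pV) ⁻¹ᵁ i.U := by
    rw [Category.assoc, toVMinus_pV]; exact hz0
  refine ⟨z, ?_, ?_, ?_⟩
  · refine D.V_hom_ext (by rw [Category.assoc, toVPlus_pV, hz]) i hzp hv ?_ ?_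
    · rw [D.matM_toVPlus _ i hz0, hzD, hzM, hE]
    · rw [D.matN_toVPlus _ i hz0, hzN]
  · refine D.V_hom_ext (by rw [Category.assoc, toVMinus_pV, hz, eB]) i hzm hw ?_ ?_
    · rw [D.matM_toVMinus _ i hz0, hzM]
    · rw [D.matN_toVMinus _ i hz0, hzN, hzD, hE']
  · refine D.mem_semistableLocus_tilde z i hz0 J I ?_ ?_
    · rw [hzM]; exact hJ
    · rw [hzN]; exact hI

end GrassmannFlopData

namespace RightAction.IsPrincipalQuotient

variable {𝒢 : GroupFunctor} {V B X : Scheme.{0}} {p : V ⟶ B} {ρ : RightAction 𝒢 p} {O : V.Opens}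
  {π : O.toScheme ⟶ X} {T : Scheme.{0}}

/-- Each `T`-point of a principal quotient lifts near `t`, after any base change into a suitable
neighbourhood. -/
theorem exists_lift_nhds (h : ρ.IsPrincipalQuotient π) (a : T ⟶ X) (t : T) :
    ∃ W : T.Opens, t ∈ W ∧ ∀ (T' : Scheme.{0}) (u : T' ⟶ T), (∀ t', u t' ∈ W) →
      ∃ v : T' ⟶ O.toScheme, v ≫ π = u ≫ a := by
  obtain ⟨W, v, ht, hv⟩ := h.exists_lift a t
  refine ⟨W, ht, fun T' u hu => ⟨liftOpen W u hu ≫ v, ?_⟩⟩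
  rw [Category.assoc, hv, liftOpen_ι_assoc]

/-- Points of `O` with the same image are in the same orbit after any base change into a suitable
neighbourhood of `t`. -/
theorem sameOrbit_nhds (h : ρ.IsPrincipalQuotient π) (v w : T ⟶ O.toScheme) (e : v ≫ π = w ≫ π)
    (t : T) : ∃ W : T.Opens, t ∈ W ∧ ∀ (T' : Scheme.{0}) (u : T' ⟶ T), (∀ t', u t' ∈ W) →
      ρ.SameOrbit (u ≫ v) (u ≫ w) := by
  obtain ⟨W, ht, hW⟩ := h.sameOrbit T v w e t
  refine ⟨W, ht, fun T' u hu => ?_⟩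
  have := hW.precomp (liftOpen W u hu)
  rwa [liftOpen_ι_assoc, liftOpen_ι_assoc] at this

end RightAction.IsPrincipalQuotient

namespace GrassmannFlopData

variable {B : Scheme.{0}} {n r : ℕ} (D : GrassmannFlopData B n r)

theorem isPrincipalQuotient_plus (Q : GITQuotient D.actV (detChar r)) :
    D.actV.IsPrincipalQuotient Q.π :=
  D.chartsPlus.isPrincipalQuotient D.iSup_opens D.isAffineOpen_preimage_pV Q

theorem isPrincipalQuotient_minus (Q : GITQuotient D.actV (detInvChar r)) :
    D.actV.IsPrincipalQuotient Q.π :=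
  D.chartsMinus.isPrincipalQuotient D.iSup_opens D.isAffineOpen_preimage_pV Q

theorem isPrincipalQuotient_tilde (Q : GITQuotient D.actVt (detInvDetChar r)) :
    D.actVt.IsPrincipalQuotient Q.π :=
  D.chartsTilde.isPrincipalQuotient D.iSup_opens D.isAffineOpen_preimage_pVt Q

variable {Xp : GITQuotient D.actV (detChar r)} {Xm : GITQuotient D.actV (detInvChar r)}
  {Xt : GITQuotient D.actVt (detInvDetChar r)}
  {sp : (D.actVt.semistableLocus (detInvDetChar r)).toScheme ⟶
    (D.actV.semistableLocus (detChar r)).toScheme}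
  {sm : (D.actVt.semistableLocus (detInvDetChar r)).toScheme ⟶
    (D.actV.semistableLocus (detInvChar r)).toScheme}

/-- Semistable points of `Ṽ` with the same image in `X₊` and in `X₋` have the same image in `X̃`. -/
theorem comp_π_eq
    (hsp : sp ≫ (D.actV.semistableLocus (detChar r)).ι =
      (D.actVt.semistableLocus (detInvDetChar r)).ι ≫ D.toVPlus)
    (hsm : sm ≫ (D.actV.semistableLocus (detInvChar r)).ι =
      (D.actVt.semistableLocus (detInvDetChar r)).ι ≫ D.toVMinus)
    {T : Scheme.{0}} (v w : T ⟶ (D.actVt.semistableLocus (detInvDetChar r)).toScheme)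
    (ep : (v ≫ sp) ≫ Xp.π = (w ≫ sp) ≫ Xp.π) (em : (v ≫ sm) ≫ Xm.π = (w ≫ sm) ≫ Xm.π) :
    v ≫ Xt.π = w ≫ Xt.π := by
  refine Scheme.hom_ext_of_forall _ _ fun t => ?_
  let j := (D.actVt.semistableLocus (detInvDetChar r)).ι
  obtain ⟨W₁, i, J, I, h₁, H₁⟩ := D.exists_isUnit_tilde (v ≫ j) t (ι_apply_mem (v t))
  obtain ⟨W₂, h₂, H₂⟩ := (D.isPrincipalQuotient_plus Xp).sameOrbit_nhds _ _ ep t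
  obtain ⟨W₃, h₃, H₃⟩ := (D.isPrincipalQuotient_minus Xm).sameOrbit_nhds _ _ em t
  let u := (W₁ ⊓ W₂ ⊓ W₃).ι
  have hu : ∀ s, u s ∈ W₁ ⊓ W₂ ⊓ W₃ := ι_apply_mem
  obtain ⟨hi, hJ, -⟩ := H₁ _ u fun s => (hu s).1.1
  obtain ⟨g₂, e₂⟩ := H₂ _ u fun s => (hu s).1.2
  obtain ⟨g₁, e₁⟩ := H₃ _ u fun s => (hu s).2
  have e₂' : D.actPoint ((u ≫ v ≫ j) ≫ D.toVPlus) g₂ = (u ≫ w ≫ j) ≫ D.toVPlus := by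
    simp only [Category.assoc, hsp] at e₂ ⊢
    exact e₂
  have e₁' : D.actPoint ((u ≫ v ≫ j) ≫ D.toVMinus) g₁ = (u ≫ w ≫ j) ≫ D.toVMinus := by
    simp only [Category.assoc, hsm] at e₁ ⊢
    exact e₁
  have key := D.actPoint'_eq_of_actPoint_eq (u ≫ v ≫ j) (u ≫ w ≫ j) i hi J hJ g₁ g₂ e₁' e₂'
  refine ⟨W₁ ⊓ W₂ ⊓ W₃, ⟨⟨h₁, h₂⟩, h₃⟩, ?_⟩
  rw [← Category.assoc, ← Category.assoc]
  refine Xt.isGoodQuotient.invariant _ _ _ ⟨(g₁, g₂), ?_⟩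
  rw [Category.assoc, Category.assoc]
  exact key

theorem isPullback {hp : Xp.X ⟶ D.H} {hm : Xm.X ⟶ D.H} {fp : Xt.X ⟶ Xp.X} {fm : Xt.X ⟶ Xm.X}
    (h₁ : Xp.IsInducedTo D.toH hp) (h₂ : Xm.IsInducedTo D.toH hm)
    (h₃ : Xt.IsInduced Xp D.toVPlus fp) (h₄ : Xt.IsInduced Xm D.toVMinus fm) :
    IsPullback fp fm hp hm := by
  obtain ⟨sp, hsp, hfp⟩ := h₃
  obtain ⟨sm, hsm, hfm⟩ := h₄
  have hhp : Xp.π ≫ hp = _ := h₁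
  have hhm : Xm.π ≫ hm = _ := h₂
  refine isPullback_of_local ?_ ?_ ?_
  · apply Xt.isGoodQuotient.hom_ext
    rw [reassoc_of% hfp, reassoc_of% hfm, hhp, hhm, reassoc_of% hsp, reassoc_of% hsm, toVPlus_toH]
  -- Two points of `X̃` with the same images in `X₊` and `X₋` are equal: they lift locally.
  · intro T l l' ep em
    refine Scheme.hom_ext_of_forall _ _ fun t => ?_
    obtain ⟨W₁, h₁, H₁⟩ := (D.isPrincipalQuotient_tilde Xt).exists_lift_nhds l t
    obtain ⟨W₂, h₂, H₂⟩ := (D.isPrincipalQuotient_tilde Xt).exists_lift_nhds l' t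
    obtain ⟨v, hv⟩ := H₁ _ (W₁ ⊓ W₂).ι fun s => (ι_apply_mem s).1
    obtain ⟨w, hw⟩ := H₂ _ (W₁ ⊓ W₂).ι fun s => (ι_apply_mem s).2
    refine ⟨W₁ ⊓ W₂, ⟨h₁, h₂⟩, ?_⟩
    rw [← hv, ← hw]
    refine D.comp_π_eq (Xp := Xp) (Xm := Xm) hsp hsm v w ?_ ?_
    · rw [Category.assoc, Category.assoc, ← hfp, reassoc_of% hv, reassoc_of% hw, ep]
    · rw [Category.assoc, Category.assoc, ← hfm, reassoc_of% hv, reassoc_of% hw, em]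
  -- Points of `X₊` and `X₋` over the same point of `H` lift locally to `(M₁, N₁)` and `(M₂, N₂)`, and
  -- come from the class of `(M₂, D, N₁)`.
  · intro T a b e x
    obtain ⟨W₁, h₁, H₁⟩ := (D.isPrincipalQuotient_plus Xp).exists_lift_nhds a x
    obtain ⟨W₂, h₂, H₂⟩ := (D.isPrincipalQuotient_minus Xm).exists_lift_nhds b x
    obtain ⟨v, hv⟩ := H₁ _ (W₁ ⊓ W₂).ι fun s => (ι_apply_mem s).1
    obtain ⟨w, hw⟩ := H₂ _ (W₁ ⊓ W₂).ι fun s => (ι_apply_mem s).2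
    obtain ⟨t, rfl⟩ := exists_ι_apply (X := T) (W := W₁ ⊓ W₂) ⟨h₁, h₂⟩
    let jp := (D.actV.semistableLocus (detChar r)).ι
    let jm := (D.actV.semistableLocus (detInvChar r)).ι
    have eH : (v ≫ jp) ≫ D.toH = (w ≫ jm) ≫ D.toH := by
      rw [Category.assoc, Category.assoc, ← hhp, ← hhm, reassoc_of% hv, reassoc_of% hw, e]
    have eB : (v ≫ jp) ≫ D.pV = (w ≫ jm) ≫ D.pV := D.comp_pV_eq eH
    obtain ⟨i, hi⟩ := D.exists_mem_frame (D.pV ((v ≫ jp) t))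
    have hi' : D.pV ((w ≫ jm) t) ∈ i.U := by
      rwa [← Scheme.Hom.comp_apply, ← eB, Scheme.Hom.comp_apply]
    obtain ⟨W₃, I, h₃, H₃⟩ := D.chartsPlus.exists_isUnit (v ≫ jp) t (ι_apply_mem (v t)) i hi
    obtain ⟨W₄, J, h₄, H₄⟩ := D.chartsMinus.exists_isUnit (w ≫ jm) t (ι_apply_mem (w t)) i hi'
    obtain ⟨t, rfl⟩ := exists_ι_apply (W := W₃ ⊓ W₄) ⟨h₃, h₄⟩
    let u := (W₃ ⊓ W₄).ι
    have hu : ∀ s, u s ∈ W₃ ⊓ W₄ := ι_apply_mem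
    obtain ⟨hv', hI⟩ := H₃ _ u fun s => (hu s).1
    obtain ⟨hw', hJ⟩ := H₄ _ u fun s => (hu s).2
    obtain ⟨z, hzp, hzm, hz⟩ := D.exists_point_tilde (u ≫ v ≫ jp) (u ≫ w ≫ jm)
      (by rw [Category.assoc u, Category.assoc u, eH]) i hv' hw' I J hI hJ
    let z' := liftOpen _ z hz
    have hz' : z' ≫ (D.actVt.semistableLocus (detInvDetChar r)).ι = z := liftOpen_ι _ _ _
    have hzsp : z' ≫ sp = u ≫ v := by
      rw [← cancel_mono (D.actV.semistableLocus (detChar r)).ι, Category.assoc, hsp,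
        reassoc_of% hz', hzp, Category.assoc]
    have hzsm : z' ≫ sm = u ≫ w := by
      rw [← cancel_mono (D.actV.semistableLocus (detInvChar r)).ι, Category.assoc, hsm,
        reassoc_of% hz', hzm, Category.assoc]
    refine ⟨_, u ≫ (W₁ ⊓ W₂).ι, inferInstance, t, z' ≫ Xt.π, Scheme.Hom.comp_apply _ _ _, ?_, ?_⟩
    · rw [Category.assoc, hfp, reassoc_of% hzsp, hv, Category.assoc]
    · rw [Category.assoc, hfm, reassoc_of% hzsm, hw, Category.assoc]

end GrassmannFlopData

end GrassmannFlop
end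

theorem mainTheorem12 {B : Scheme.{0}} {n r : ℕ} (D : GrassmannFlop.GrassmannFlopData B n r) :
    Nonempty (GrassmannFlop.GITQuotient D.actV (GrassmannFlop.detChar r)) ∧
    Nonempty (GrassmannFlop.GITQuotient D.actV (GrassmannFlop.detInvChar r)) ∧
    Nonempty (GrassmannFlop.GITQuotient D.actVt (GrassmannFlop.detInvDetChar r)) ∧
    ∀ (Xp : GrassmannFlop.GITQuotient D.actV (GrassmannFlop.detChar r))
      (Xm : GrassmannFlop.GITQuotient D.actV (GrassmannFlop.detInvChar r))
      (Xt : GrassmannFlop.GITQuotient D.actVt (GrassmannFlop.detInvDetChar r)),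
      (∃! hp : Xp.X ⟶ D.H, Xp.IsInducedTo D.toH hp) ∧
      (∃! hm : Xm.X ⟶ D.H, Xm.IsInducedTo D.toH hm) ∧
      (∃! fp : Xt.X ⟶ Xp.X, Xt.IsInduced Xp D.toVPlus fp) ∧
      (∃! fm : Xt.X ⟶ Xm.X, Xt.IsInduced Xm D.toVMinus fm) ∧
      ∀ (hp : Xp.X ⟶ D.H) (hm : Xm.X ⟶ D.H) (fp : Xt.X ⟶ Xp.X) (fm : Xt.X ⟶ Xm.X),
        Xp.IsInducedTo D.toH hp → Xm.IsInducedTo D.toH hm →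
        Xt.IsInduced Xp D.toVPlus fp → Xt.IsInduced Xm D.toVMinus fm →
        IsPullback fp fm hp hm := by
  refine ⟨?_, ?_, ?_, fun Xp Xm Xt => ⟨?_, ?_, ?_, ?_, ?_⟩⟩
  · exact (D.chartsPlus.exists_gitQuotient D.iSup_opens D.isAffineOpen_preimage_pV).nonempty
  · exact (D.chartsMinus.exists_gitQuotient D.iSup_opens D.isAffineOpen_preimage_pV).nonempty
  · exact (D.chartsTilde.exists_gitQuotient D.iSup_opens D.isAffineOpen_preimage_pVt).nonempty
  · exact GrassmannFlop.GITQuotient.existsUnique_isInducedTo (D.isPrincipalQuotient_plus Xp) _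
      fun T v g => D.actPoint_toH v g
  · exact GrassmannFlop.GITQuotient.existsUnique_isInducedTo (D.isPrincipalQuotient_minus Xm) _
      fun T v g => D.actPoint_toH v g
  · exact GrassmannFlop.GITQuotient.existsUnique_isInduced (D.isPrincipalQuotient_tilde Xt) Xp _
      (fun x hx => D.toVPlus_mem hx) fun T v g => ⟨g.2, D.actPoint'_toVPlus v g.1 g.2⟩
  · exact GrassmannFlop.GITQuotient.existsUnique_isInduced (D.isPrincipalQuotient_tilde Xt) Xm _
      (fun x hx => D.toVMinus_mem hx) fun T v g => ⟨g.1, D.actPoint'_toVMinus v g.1 g.2⟩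
  · intro hp hm fp fm h₁ h₂ h₃ h₄
    exact D.isPullback h₁ h₂ h₃ h₄
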